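/- Setting. Let $(\Omega,\mathcal F,P,(\mathcal F_t)_{t\ge0})$ be a filtered probability space satisfying the usual assumptions and let $T>0$. Let $S$ be a positive continuous adapted process on $[0,T]$ with $dS_t=\Theta_t\,dt+\sigma(S_t,t)\,dB_t$, where $B$ is an $(\mathcal F_t)$-Brownian motion, $\Theta$ is adapted and locally bounded, and $\sigma>0$ is $C^{2,1}$ on $(0,\infty)\times[0,T]$. Let $\lambda\ge0$ and $\alpha>0$ be $C^{2,1}$ functions on $(0,\infty)\times[0,T]$ and $f$ a Borel function on $(0,\infty)$. Here $C^{2,1}$ means that $\partial_s^i\partial_t^j\varphi$ exists and is continuous for $i\in\{0,1,2\}$, $j\in\{0,1\}$. Let $\mathcal A$ be the set of $C^{2,1}$ functions $\varphi$ on $(0,\infty)\times[0,T)$ such that, for all $i\in\{0,1,2\}$, $j\in\{0,1\}$, $\partial_s^i\partial_t^j\varphi(S_t,t)$ converges almost surely as $t\to T$. Let $p^\alpha$ be continuous on $(0,\infty)\times[0,T]$ with $\partial_s^i\partial_t^jp^\alpha\in\mathcal A$ for all these $i,j$, with $$\partial_tp^\alpha+\tfrac12\Bigl(1+\mathrm{sgn}(\partial_s^2p^\alpha)\tfrac{2}{\alpha}\Bigr)\sigma^2\,\partial_s^2p^\alpha=0,\qquad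 p^\alpha(s,T)=f(s),$$ and such that almost surely $\{t\in[0,T):\partial_s^2p^\alpha(S_t,t)=0\}$ is a Lebesgue null set. Put $\gamma=\lambda\,\partial_s^2p^\alpha$. Let $\mathcal B$ be the set of positive functions $b$ on $(0,\infty)\times[0,T)$ with $b,1/b\in\mathcal A$. For $b\in\mathcal B$ let $\mathcal D_b=\{(x,s,t):|x|\le b(s,t)\}$ and let $\mathcal C_b$ be the set of nonnegative, piecewise $C^{0,2,1}$ functions $c$ on $\mathcal D_b$ that are even in $x$, such that $c(x,\cdot)$ is $C^{2,1}$ for every $x$, that almost surely $\sup\{|\partial_s^i\partial_t^jc(x,S_t,t)|:t\in[0,T),\ |x|\le b(S_t,t)\}<\infty$ for all $i\in\{0,1,2\}$, $j\in\{0,1\}$, and that for every compact $A\subset\mathcal D_b$ there is $K>0$ with $(x-y)(-\mathrm{sgn}(x)c(x,s,t)+\mathrm{sgn}(y)c(y,s,t))\le K|x-y|^2$ for all $(x,s,t),(y,s,t)\in A$. For such $b,c$ put $$g(x,s,t)=\exp\Bigl\{-2\int_0^{|x|}c(y,s,t)\,dy\Bigr\},\qquad a_{b,c}(s,t)=2\int_0^{b(s,t)}g(x,s,t)\,dx,$$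 $$h(x,s,t)=\frac{2\,\mathrm{sgn}(x)}{g(x,s,t)}\int_0^{|x|}\Bigl(c(z,s,t)-\frac1{a_{b,c}(s,t)}\Bigr)g(z,s,t)\,dz,$$ $$\eta_{b,c}(s,t)=\frac{2}{a_{b,c}(s,t)}\int_0^{b(s,t)}\bigl(x-\gamma(s,t)h(x,s,t)\bigr)^2g(x,s,t)\,dx .$$ The last four formulas are used pointwise in $(s,t)$ for any number $b>0$ and any bounded, piecewise continuous, even $c\ge 0$. Theorem. Fix $a\in\mathcal B$, let $\mathcal S_a$ be the set of pairs $(b,c)$ with $b\in\mathcal B$, $c\in\mathcal C_b$ and $a_{b,c}=a$ on $(0,\infty)\times[0,T)$, and let $\eta_*(s,t)=\inf_{(b,c)\in\mathcal S_a}\eta_{b,c}(s,t)$ (the set $\mathcal S_a$ is nonempty). Let $$\eta_\dagger(x)=\begin{cases}\eta_2(x),&x\le-2,\\0,&-2<x\le1,\\\eta_1(x),&1<x<2,\\\eta_2(x),&x\ge2,\end{cases}\qquad \eta_1(x)=\frac43\,\frac{(x+2)^2(x-1)}{x^3(4-x)},\qquad \eta_2(x)=\frac{(x+2)^2}{12}.$$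 Let $(s,t)\in(0,\infty)\times[0,T)$ and write $a=a(s,t)$, $\gamma=\gamma(s,t)$. (i) If $\gamma\ne0$, then $\eta_*(s,t)=|\gamma|^2\,\eta_\dagger(a/\gamma)$. (ii) If $\gamma=0$, then $\eta_*(s,t)=\lim_{\epsilon\to0}\epsilon^2\eta_\dagger(a/\epsilon)=a^2/12$. (iii) Let $\varphi_n$, $n\ge1$, be smooth functions with $\varphi_n(x)=1$ for $|x-1|\ge1/n$ and $\varphi_n(1)=1-1/n$. If $\gamma\neq 0$, put $\psi_n=\varphi_n(a/\gamma)$ and $$l=\frac{2\gamma^2(a/\gamma-1)_+}{4\gamma-a},\qquad r_n=l+(2\gamma-a)_+e^{n^2}+|\gamma|\Bigl\{\bigl(1-\tfrac1n\bigr)\wedge(2\gamma+a)_-\Bigr\}^{1/n},$$ $$b_n=r_n+\frac{\gamma+\psi_nr_n}{\gamma+\psi_nl}\Bigl(\frac a2-l\Bigr),\qquad c_n(x)=\frac{a\psi_n+2\gamma}{2(a-2l)}\,\frac{1}{\gamma+\psi_n|x|}\,1_{[l,r_n)}(|x|)$$ (if $a=4\gamma$, put $l=0$); if $\gamma=0$,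 put $b_n=a/2$ and $c_n=0$. Then for all large $n$ (depending on $(s,t)$): $b_n>0$, $c_n\ge0$, $2\int_0^{b_n}\exp\{-2\int_0^{x}c_n\}\,dx=a$, and for every $\epsilon>0$ there is $(b,c)\in\mathcal S_a$ with $|b(s,t)-b_n|<\epsilon$, $\int_0^{b(s,t)\wedge b_n}|c(x,s,t)-c_n(x)|\,dx<\epsilon$ and $|\eta_{b,c}(s,t)-\eta_{b_n,c_n}(s,t)|<\epsilon$. Moreover $\eta_{b_n,c_n}(s,t)\to\eta_*(s,t)$ as $n\to\infty$. -/

import Mathlib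

open MeasureTheory ProbabilityTheory Filter Topology Set
open scoped NNReal

noncomputable section

/-! ### Regularity of functions of `(s, t)` -/

/-- The partial derivative `∂_s^i ∂_t^j φ (s, t)` of a function on `(0,∞) × I`
(one-sided in `t` at the end points of the interval `I`). -/
def pd (I : Set ℝ) (i j : ℕ) (φ : ℝ → ℝ → ℝ) (s t : ℝ) : ℝ :=
  iteratedDeriv i (fun s' => iteratedDerivWithin j (fun t' => φ s' t') I t) s

/-- On the set `E` of pairs `(s, t)`, the function `φ` is of class `C^{2,1}` with partial
derivatives `∂_s^i ∂_t^j φ = d i j`, `i ≤ 2`, `j ≤ 1`: they all exist (relative to `E`)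
and are continuous on `E`. -/
structure HasPartialsOn (E : Set (ℝ × ℝ)) (φ : ℝ → ℝ → ℝ) (d : ℕ → ℕ → ℝ → ℝ → ℝ) : Prop where
  zero : ∀ s t, (s, t) ∈ E → d 0 0 s t = φ s t
  dt : ∀ s t, (s, t) ∈ E →
    HasDerivWithinAt (fun t' => φ s t') (d 0 1 s t) {t' | (s, t') ∈ E} t
  ds : ∀ i < 2, ∀ j ≤ 1, ∀ s t, (s, t) ∈ E →
    HasDerivWithinAt (fun s' => d i j s' t) (d (i + 1) j s t) {s' | (s', t) ∈ E} s
  cont : ∀ i ≤ 2, ∀ j ≤ 1, ContinuousOn (fun q : ℝ × ℝ => d i j q.1 q.2) E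

/-- `φ` is a `C^{2,1}` function on `(0,∞) × I`. -/
def IsC21 (I : Set ℝ) (φ : ℝ → ℝ → ℝ) : Prop :=
  HasPartialsOn (Ioi 0 ×ˢ I) φ (fun i j => pd I i j φ)

/-- `∂_s² φ (s, t)`. -/
def pss (φ : ℝ → ℝ → ℝ) (s t : ℝ) : ℝ := iteratedDeriv 2 (fun s' => φ s' t) s

/-! ### The price process -/

variable {Ω : Type*} {mΩ : MeasurableSpace Ω}

/-- The usual assumptions: the probability space is complete, the filtration is right-continuous
and its initial sigma-algebra contains all null sets. -/
def UsualAssumptions (P : Measure Ω) (𝓕 : Filtration ℝ≥0 mΩ) : Prop :=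
  𝓕.IsRightContinuous ∧ ∀ A : Set Ω, P A = 0 → MeasurableSet[𝓕 0] A

/-- `B` is a standard Brownian motion with respect to the filtration `𝓕`. -/
structure IsFBrownian (P : Measure Ω) (𝓕 : Filtration ℝ≥0 mΩ) (B : ℝ≥0 → Ω → ℝ) : Prop where
  brownian : IsBrownianReal B P
  adapted : Adapted 𝓕 B
  indep : ∀ s t : ℝ≥0, s ≤ t →
    Indep (MeasurableSpace.comap (fun ω => B t ω - B s ω) inferInstance) (𝓕 s) P

/-- `Θ` is locally bounded on `[0,T]`: along a localizing sequence of stopping times, the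
stopped processes are bounded on `[0,T]`. -/
def IsLocallyBdd (P : Measure Ω) (𝓕 : Filtration ℝ≥0 mΩ) (T : ℝ≥0) (Θ : ℝ≥0 → Ω → ℝ) : Prop :=
  ∃ τ : ℕ → Ω → WithTop ℝ≥0, IsLocalizingSequence 𝓕 τ P ∧
    ∀ n, ∃ K : ℝ, ∀ᵐ ω ∂P, ⊥ < τ n ω →
      ∀ t : ℝ≥0, t ≤ T → (t : WithTop ℝ≥0) ≤ τ n ω → |Θ t ω| ≤ K

/-- `J` is the Itô integral `∫_0^t H_u dB_u` of the continuous adapted integrand `H`: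
the limit in probability of the left-endpoint Riemann sums. -/
def IsItoIntegral (P : Measure Ω) (H B : ℝ≥0 → Ω → ℝ) (t : ℝ≥0) (J : Ω → ℝ) : Prop :=
  TendstoInMeasure P
    (fun (n : ℕ) ω => ∑ k ∈ Finset.range n,
      H (k * t / n) ω * (B ((k + 1) * t / n) ω - B (k * t / n) ω)) atTop J

/-- `S` is a positive continuous adapted process on `[0,T]` with
`dS_t = Θ_t dt + σ(S_t, t) dB_t`, where `Θ` is adapted and locally bounded (with paths that can
be integrated) and `B` is a Brownian motion. -/
structure IsPriceProcess (P : Measure Ω) (𝓕 : Filtration ℝ≥0 mΩ) (T : ℝ≥0) (σ : ℝ → ℝ → ℝ)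
    (Θ B S : ℝ≥0 → Ω → ℝ) : Prop where
  sigma_pos : ∀ s t, 0 < s → t ∈ Icc (0 : ℝ) T → 0 < σ s t
  sigma_reg : IsC21 (Icc 0 (T : ℝ)) σ
  drift_adapted : Adapted 𝓕 Θ
  drift_bdd : IsLocallyBdd P 𝓕 T Θ
  drift_int : ∀ᵐ ω ∂P,
    IntervalIntegrable (fun u : ℝ => Θ u.toNNReal ω) volume 0 T
  brownian : IsFBrownian P 𝓕 B
  adapted : Adapted 𝓕 S
  pos : ∀ᵐ ω ∂P, ∀ t ≤ T, 0 < S t ω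
  cont : ∀ᵐ ω ∂P, ContinuousOn (fun t => S t ω) (Iic T)
  sde : ∀ t ≤ T, IsItoIntegral P (fun u ω => σ (S u ω) u) B t
    (fun ω => S t ω - S 0 ω - ∫ u in (0 : ℝ)..t, Θ u.toNNReal ω)

/-! ### The function classes -/

/-- The class `𝓐`: the `C^{2,1}` functions `φ` on `(0,∞) × [0,T)` such that every
`∂_s^i ∂_t^j φ (S_t, t)`, `i ≤ 2`, `j ≤ 1`, converges almost surely (in `ℝ`) as `t → T`. -/
def ClassA (P : Measure Ω) (T : ℝ≥0) (S : ℝ≥0 → Ω → ℝ) : Set (ℝ → ℝ → ℝ) :=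
  {φ | IsC21 (Ico 0 (T : ℝ)) φ ∧
    ∀ i ≤ 2, ∀ j ≤ 1, ∀ᵐ ω ∂P, ∃ l : ℝ,
      Tendsto (fun t : ℝ≥0 => pd (Ico 0 (T : ℝ)) i j φ (S t ω) t) (𝓝[<] T) (𝓝 l)}

/-- The class `𝓑`: the positive functions `b` on `(0,∞) × [0,T)` with `b, 1/b ∈ 𝓐`. -/
def ClassB (P : Measure Ω) (T : ℝ≥0) (S : ℝ≥0 → Ω → ℝ) : Set (ℝ → ℝ → ℝ) :=
  {b | (∀ s t, 0 < s → t ∈ Ico (0 : ℝ) T → 0 < b s t) ∧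
    b ∈ ClassA P T S ∧ (fun s t => 1 / b s t) ∈ ClassA P T S}

/-- `𝓓_b`, the set of `(x, s, t)` with `|x| ≤ b(s,t)`. -/
def DomD (T : ℝ≥0) (b : ℝ → ℝ → ℝ) : Set (ℝ × ℝ × ℝ) :=
  {q | 0 < q.2.1 ∧ q.2.2 ∈ Ico (0 : ℝ) T ∧ |q.1| ≤ b q.2.1 q.2.2}

/-- A function on `𝓓_b` is piecewise continuous: finitely many continuous surfaces
`-b = β 0 ≤ β 1 ≤ ⋯ ≤ β m = b` cut `𝓓_b` into pieces `{β k < x < β (k+1)}`, on each of which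
the function extends continuously to the boundary. The surfaces are given in advance, so that
they can be shared by several functions. -/
def PiecewiseContOn (T : ℝ≥0) (b : ℝ → ℝ → ℝ) (m : ℕ) (β : ℕ → ℝ → ℝ → ℝ)
    (F : ℝ → ℝ → ℝ → ℝ) : Prop :=
  ∀ k < m, ∃ e : ℝ × ℝ × ℝ → ℝ, ContinuousOn e (DomD T b) ∧
    ∀ x s t, (x, s, t) ∈ DomD T b → β k s t < x → x < β (k + 1) s t → F x s t = e (x, s, t)

/-- The surfaces `-b = β 0 ≤ β 1 ≤ ⋯ ≤ β m = b`. -/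
structure IsCut (T : ℝ≥0) (b : ℝ → ℝ → ℝ) (m : ℕ) (β : ℕ → ℝ → ℝ → ℝ) : Prop where
  cont : ∀ k ≤ m, ContinuousOn (fun q : ℝ × ℝ => β k q.1 q.2) (Ioi 0 ×ˢ Ico 0 (T : ℝ))
  first : ∀ s t, 0 < s → t ∈ Ico (0 : ℝ) T → β 0 s t = -b s t
  last : ∀ s t, 0 < s → t ∈ Ico (0 : ℝ) T → β m s t = b s t
  mono : ∀ k < m, ∀ s t, 0 < s → t ∈ Ico (0 : ℝ) T → β k s t ≤ β (k + 1) s t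

/-- The class `𝓒_b` of the nonnegative, piecewise `C^{0,2,1}` functions `c` on `𝓓_b`, even in `x`,
such that each `c(x,·)` is `C^{2,1}`, with partial derivatives `d i j` that are almost surely
bounded along the path of `S`, and such that `c` satisfies the one-sided Lipschitz condition on
compact sets. -/
def ClassC (P : Measure Ω) (T : ℝ≥0) (S : ℝ≥0 → Ω → ℝ) (b : ℝ → ℝ → ℝ) :
    Set (ℝ → ℝ → ℝ → ℝ) :=
  {c | (∀ x s t, (x, s, t) ∈ DomD T b → 0 ≤ c x s t) ∧
    (∀ x s t, (x, s, t) ∈ DomD T b → c x s t = c (-x) s t) ∧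
    (∃ d : ℕ → ℕ → ℝ → ℝ → ℝ → ℝ,
      (∀ x, HasPartialsOn {q | (x, q.1, q.2) ∈ DomD T b} (c x) (fun i j => d i j x)) ∧
      (∃ (m : ℕ) (β : ℕ → ℝ → ℝ → ℝ), IsCut T b m β ∧
        ∀ i ≤ 2, ∀ j ≤ 1, PiecewiseContOn T b m β (d i j)) ∧
      (∀ i ≤ 2, ∀ j ≤ 1, ∀ᵐ ω ∂P, ∃ M : ℝ, ∀ t : ℝ≥0, t < T →
        ∀ x, |x| ≤ b (S t ω) t → |d i j x (S t ω) t| ≤ M)) ∧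
    (∀ A : Set (ℝ × ℝ × ℝ), IsCompact A → A ⊆ DomD T b → ∃ K : ℝ, 0 < K ∧
      ∀ x y s t, (x, s, t) ∈ A → (y, s, t) ∈ A →
        (x - y) * (-Real.sign x * c x s t + Real.sign y * c y s t) ≤ K * |x - y| ^ 2)}

/-! ### The asymptotic variance, at a fixed `(s, t)` -/

/-- `g(x) = exp (-2 ∫_0^{|x|} c(y) dy)`. -/
def gFun (c : ℝ → ℝ) (x : ℝ) : ℝ := Real.exp (-2 * ∫ y in (0 : ℝ)..|x|, c y)

/-- `a = 2 ∫_0^b g(x) dx`. -/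
def aVal (b : ℝ) (c : ℝ → ℝ) : ℝ := 2 * ∫ x in (0 : ℝ)..b, gFun c x

/-- `h(x) = (2 sgn(x) / g(x)) ∫_0^{|x|} (c(z) - 1/a) g(z) dz`. -/
def hFun (b : ℝ) (c : ℝ → ℝ) (x : ℝ) : ℝ :=
  2 * Real.sign x / gFun c x * ∫ z in (0 : ℝ)..|x|, (c z - 1 / aVal b c) * gFun c z

/-- `η = (2/a) ∫_0^b (x - γ h(x))² g(x) dx`. -/
def etaVal (γ b : ℝ) (c : ℝ → ℝ) : ℝ :=
  2 / aVal b c * ∫ x in (0 : ℝ)..b, (x - γ * hFun b c x) ^ 2 * gFun c x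

/-- `γ(s,t) = λ(s,t) ∂_s² p(s,t)`. -/
def gam (lam p : ℝ → ℝ → ℝ) (s t : ℝ) : ℝ := lam s t * pss p s t

/-- `η_{b,c}(s,t)`. -/
def etaBC (lam p b : ℝ → ℝ → ℝ) (c : ℝ → ℝ → ℝ → ℝ) (s t : ℝ) : ℝ :=
  etaVal (gam lam p s t) (b s t) (fun x => c x s t)

/-- `𝓢_a`: the pairs `(b, c)` with `b ∈ 𝓑`, `c ∈ 𝓒_b` and `a = 2 ∫_0^b g(x) dx` everywhere. -/
def StratS (P : Measure Ω) (T : ℝ≥0) (S : ℝ≥0 → Ω → ℝ) (a : ℝ → ℝ → ℝ) :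
    Set ((ℝ → ℝ → ℝ) × (ℝ → ℝ → ℝ → ℝ)) :=
  {bc | bc.1 ∈ ClassB P T S ∧ bc.2 ∈ ClassC P T S bc.1 ∧
    ∀ s t, 0 < s → t ∈ Ico (0 : ℝ) T → a s t = aVal (bc.1 s t) (fun x => bc.2 x s t)}

/-- The values `η_{b,c}(s,t)`, `(b,c) ∈ 𝓢_a`. -/
def etaSet (P : Measure Ω) (T : ℝ≥0) (S : ℝ≥0 → Ω → ℝ) (lam p a : ℝ → ℝ → ℝ) (s t : ℝ) : Set ℝ :=
  (fun bc => etaBC lam p bc.1 bc.2 s t) '' StratS P T S a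

/-- `η_*(s,t)`, the infimum of `η_{b,c}(s,t)` over `(b,c) ∈ 𝓢_a`. -/
def etaStar (P : Measure Ω) (T : ℝ≥0) (S : ℝ≥0 → Ω → ℝ) (lam p a : ℝ → ℝ → ℝ) (s t : ℝ) : ℝ :=
  sInf (etaSet P T S lam p a s t)

def eta1 (x : ℝ) : ℝ := 4 / 3 * ((x + 2) ^ 2 * (x - 1) / (x ^ 3 * (4 - x)))

def eta2 (x : ℝ) : ℝ := 1 / 12 * (x + 2) ^ 2

/-- The function `η_†`. -/
def etaDagger (x : ℝ) : ℝ :=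
  if x ≤ -2 then eta2 x else if x ≤ 1 then 0 else if x < 2 then eta1 x else eta2 x

/-! ### The modified option price -/

/-- `p` is a solution, regular in the required sense, of the pricing equation with volatility
modified by `α`, `∂_t p + (1/2) (1 + sgn(∂_s² p) 2/α) σ² ∂_s² p = 0`, `p(s,T) = f(s)`, and
`∂_s² p` is nondegenerate along `S`. -/
structure IsModifiedPrice (P : Measure Ω) (T : ℝ≥0) (S : ℝ≥0 → Ω → ℝ) (σ α : ℝ → ℝ → ℝ)
    (f : ℝ → ℝ) (p : ℝ → ℝ → ℝ) : Prop where
  payoff_borel : Measurable fun s : Ioi (0 : ℝ) => f s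
  alpha_pos : ∀ s t, 0 < s → t ∈ Icc (0 : ℝ) T → 0 < α s t
  alpha_reg : IsC21 (Icc 0 (T : ℝ)) α
  cont : ContinuousOn (fun q : ℝ × ℝ => p q.1 q.2) (Ioi 0 ×ˢ Icc 0 (T : ℝ))
  reg : ∀ i ≤ 2, ∀ j ≤ 1, pd (Ico 0 (T : ℝ)) i j p ∈ ClassA P T S
  pde : ∀ s t, 0 < s → t ∈ Ico (0 : ℝ) T →
    pd (Ico 0 (T : ℝ)) 0 1 p s t
      + 1 / 2 * (1 + Real.sign (pss p s t) * (2 / α s t)) * σ s t ^ 2 * pss p s t = 0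
  terminal : ∀ s, 0 < s → p s T = f s
  nondeg : ∀ᵐ ω ∂P,
    volume {t : ℝ | t ∈ Ico (0 : ℝ) T ∧ pss p (S t.toNNReal ω) t = 0} = 0

/-! ### The explicit sequence, at a fixed `(s, t)`

Below `a = a(s,t) > 0` and `γ = γ(s,t)`; limits as `x → γ` only matter for `γ = 0`, where they
give `l = 0` and `ψ = 1`. -/

/-- `l = 2 γ² (a/γ - 1)₊ / (4γ - a)`, and `l = 0` if `γ = 0`. Its value does not affect `bSeq` and
`cSeq` when `a/γ ≥ 2`; in particular it is immaterial for `a = 4γ`. -/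
def lVal (γ a : ℝ) : ℝ := if γ = 0 then 0 else 2 * γ ^ 2 * max (a / γ - 1) 0 / (4 * γ - a)

/-- `r_n = l + (2γ - a)₊ e^{n²} + |γ| ((1 - 1/n) ∧ (2γ + a)₋)^{1/n}`. -/
def rSeq (γ a : ℝ) (n : ℕ) : ℝ :=
  lVal γ a + max (2 * γ - a) 0 * Real.exp ((n : ℝ) ^ 2)
    + |γ| * (min (1 - 1 / (n : ℝ)) (max (-(2 * γ + a)) 0)) ^ (1 / (n : ℝ))

/-- `ψ_n = φ_n(a/γ)`, and `ψ_n = 1` if `γ = 0`. -/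
def psiSeq (φ : ℕ → ℝ → ℝ) (γ a : ℝ) (n : ℕ) : ℝ := if γ = 0 then 1 else φ n (a / γ)

/-- `b_n = r_n + (γ + ψ_n r_n) / (γ + ψ_n l) (a/2 - l)`, where the quotient is read as `1` if
`γ = 0`, that is, `b_n = a/2`. -/
def bSeq (φ : ℕ → ℝ → ℝ) (γ a : ℝ) (n : ℕ) : ℝ :=
  if γ = 0 then a / 2
  else rSeq γ a n + (γ + psiSeq φ γ a n * rSeq γ a n) / (γ + psiSeq φ γ a n * lVal γ a)
    * (a / 2 - lVal γ a)

open Classical in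
/-- `c_n(x) = (a ψ_n + 2γ) / (2 (a - 2l)) / (γ + ψ_n |x|)` if `l ≤ |x| < r_n`, and `0` otherwise. -/
def cSeq (φ : ℕ → ℝ → ℝ) (γ a : ℝ) (n : ℕ) (x : ℝ) : ℝ :=
  if lVal γ a ≤ |x| ∧ |x| < rSeq γ a n then
    (a * psiSeq φ γ a n + 2 * γ) / (2 * (a - 2 * lVal γ a)) * (1 / (γ + psiSeq φ γ a n * |x|))
  else 0

end

noncomputable section

/-! ### Absolutely continuous functions -/

/-! The control `c` enters `h` only through `∫ c g`, and `∫_0^x c g = (1 - g(x)) / 2`. With `G(x) =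
∫_0^x g` and `v = 1 - 2 G / a` this gives `h = v / g - 1` (`hFun_eq`). As `x` runs from `0` to `b`,
`v` falls from `1` to `0` with `dv = -(2/a) g dx`. Taking `v` as the variable and writing `y = x +
γ`, `k = 2γ/a`, one gets `η = ∫_0^1 (y + k v y')² dv` with `y(1) = γ` and `y' = -(a/2) / g`. This is
a convex quadratic functional, and `c ≥ 0` forces the linear constraint `1/g ≥ 1`.

Lower bound, by weak duality (`le_etaVal`): for a test function `φ` with primitive `Φ`, use `Y² ≥
2φY - φ²`, integrate by parts, and use `1/g ≥ 1` against the nonnegative multiplier `Φ - k v φ`. The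
right `φ` is the residual `Y` of the expected optimum. For `2|γ| ≤ a` that optimum is `c = 0`, which
gives `(a + 2γ)²/12` (`sq_div_twelve_le_etaVal`). For `1 < a/γ < 2` the residual of `c = 0` is kept
for large `v` and continued to small `v` by a power making the multiplier vanish (`eta1_le_etaVal`).
Otherwise the bound is just `0`.

Upper bound: for the hyperbolic control, `g` is a power of `w(x) = 1 + (x - l)/q` on `[l, r]` and
`v/g` is affine there. For `q = γ + l` the residual is proportional to `l w` on `[l, r]`, so it
vanishes if `l = 0`, and the part beyond `r` costs a multiple of `w(r)^(2 - ν)`. This tail is killed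
by `w(r) → ∞` when `ν > 2` and by `w(r) → 0` when `ν < -1`. For `a = γ` and `ψ = 1` one has `ν = 2`
and the tail would not decay; `ψ_n < 1` pushes `ν` above `2` at a cost `O(1/n)`.

Transfer to `𝓢_a`: the explicit controls jump, so they are mollified and the boundary is solved for
again to keep `a` (`IsAdmissible.exists_smooth`). A smooth control at one point extends to all `(s,
t)` by scaling, because passing to `b/θ` and `θ c(θ ·)` divides `a` by `θ` (`aVal_scale`,
`exists_mem_stratS`). -/

lemma AbsolutelyContinuousOnInterval.lipschitzOnWith_comp {f φ : ℝ → ℝ} {a b : ℝ} {K : ℝ≥0}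
    (hf : AbsolutelyContinuousOnInterval f a b) (hφ : LipschitzOnWith K φ (f '' uIcc a b)) :
    AbsolutelyContinuousOnInterval (fun x => φ (f x)) a b := by
  unfold AbsolutelyContinuousOnInterval at hf ⊢
  apply squeeze_zero' ?_ ?_ (by simpa using hf.const_mul (K : ℝ))
  · exact Filter.Eventually.of_forall <| fun _ ↦ Finset.sum_nonneg (fun i hi ↦ dist_nonneg)
  rw [eventually_inf_principal]
  filter_upwards with (n, I) hnI
  simp only [Finset.mul_sum]
  gcongr with i hi
  simp only [AbsolutelyContinuousOnInterval.disjWithin, mem_ofPred_eq] at hnI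
  exact hφ.dist_le_mul _ (mem_image_of_mem _ (hnI.left i hi).left) _
    (mem_image_of_mem _ (hnI.left i hi).right)

/-- As `c` is merely integrable, the exponential is only absolutely continuous. Its sum with twice
the integral on the left has derivative zero almost everywhere, and absolute continuity makes that
sum constant. -/
lemma integral_mul_exp_neg_two {c : ℝ → ℝ} {b : ℝ}
    (hc : IntervalIntegrable c volume 0 b) :
    ∫ z in (0 : ℝ)..b, c z * Real.exp (-2 * ∫ y in (0 : ℝ)..z, c y)
      = (1 - Real.exp (-2 * ∫ y in (0 : ℝ)..b, c y)) / 2 := by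
  have hAC := hc.absolutelyContinuousOnInterval_intervalIntegral (c := 0) (by simp)
  -- The exponential is Lipschitz only on bounded sets, so the range of the primitive is first
  -- enclosed in a ball.
  have hcpt : IsCompact ((fun x => ∫ v in (0 : ℝ)..x, c v) '' uIcc 0 b) :=
    isCompact_uIcc.image_of_continuousOn hAC.continuousOn
  obtain ⟨R, hR⟩ := hcpt.isBounded.subset_closedBall 0
  obtain ⟨K, hK⟩ := (ContDiff.contDiffOn (by fun_prop : ContDiff ℝ 1
    (fun x : ℝ => Real.exp (-2 * x)))).exists_lipschitzOnWith (by decide)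
    (convex_closedBall (0 : ℝ) R) (isCompact_closedBall 0 R)
  have hE := hAC.lipschitzOnWith_comp (hK.mono hR)
  have hint : IntervalIntegrable
      (fun z => c z * Real.exp (-2 * ∫ y in (0 : ℝ)..z, c y)) volume 0 b :=
    hc.mul_continuousOn hE.continuousOn
  have hAC2 := hint.absolutelyContinuousOnInterval_intervalIntegral (c := 0) (by simp)
  have hsum := hE.fun_add (hAC2.const_mul 2)
  obtain ⟨C, hC⟩ := hsum.const_of_ae_hasDerivAt_zero (by
    filter_upwards [hc.ae_hasDerivAt_integral, hint.ae_hasDerivAt_integral] with x h1 h2 hx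
    have e1 := h1 hx 0 (by simp)
    have e2 := h2 hx 0 (by simp)
    convert! ((e1.const_mul (-2)).exp).add (e2.const_mul 2) using 1
    ring)
  have h0 := hC 0 (by simp)
  have h1 := hC b (by simp)
  simp only [intervalIntegral.integral_same, mul_zero, Real.exp_zero, add_zero] at h0
  rw [← h0] at h1
  linarith

/-! ### Reformulation of the asymptotic variance -/

lemma gFun_pos (c : ℝ → ℝ) (x : ℝ) : 0 < gFun c x := Real.exp_pos _

lemma gFun_zero (c : ℝ → ℝ) : gFun c 0 = 1 := by simp [gFun]

lemma gFun_of_nonneg (c : ℝ → ℝ) {x : ℝ} (hx : 0 ≤ x) :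
    gFun c x = Real.exp (-2 * ∫ y in (0 : ℝ)..x, c y) := by
  rw [gFun, abs_of_nonneg hx]

/-- `G(x) = ∫_0^x g(y) dy`. -/
def gInt (c : ℝ → ℝ) (x : ℝ) : ℝ := ∫ y in (0 : ℝ)..x, gFun c y

lemma aVal_eq_gInt (b : ℝ) (c : ℝ → ℝ) : aVal b c = 2 * gInt c b := rfl

section Profile

variable {b : ℝ} {c : ℝ → ℝ}

lemma intervalIntegrable_sub {x y : ℝ} (hc : IntervalIntegrable c volume 0 b)
    (hx : x ∈ Icc 0 b) (hy : y ∈ Icc 0 b) : IntervalIntegrable c volume x y := by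
  refine hc.mono_set ?_
  rw [uIcc_of_le (hx.1.trans hx.2)]
  exact ordConnected_Icc.uIcc_subset hx hy

lemma continuousOn_gFun (hb : 0 ≤ b) (hc : IntervalIntegrable c volume 0 b) :
    ContinuousOn (gFun c) (Icc 0 b) := by
  have h := (hc.absolutelyContinuousOnInterval_intervalIntegral (c := 0) (by simp)).continuousOn
  rw [uIcc_of_le hb] at h
  have h' : ContinuousOn (fun x => Real.exp (-2 * ∫ y in (0 : ℝ)..x, c y)) (Icc 0 b) :=
    (h.const_smul (-2 : ℝ)).rexp
  exact h'.congr fun x hx => gFun_of_nonneg c hx.1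

lemma gFun_le_one (h0 : ∀ x ∈ Icc 0 b, 0 ≤ c x)
    {x : ℝ} (hx : x ∈ Icc 0 b) : gFun c x ≤ 1 := by
  rw [gFun_of_nonneg c hx.1, Real.exp_le_one_iff]
  have : 0 ≤ ∫ y in (0 : ℝ)..x, c y :=
    intervalIntegral.integral_nonneg hx.1 fun y hy => h0 y ⟨hy.1, hy.2.trans hx.2⟩
  linarith

lemma intervalIntegrable_gFun (hb : 0 ≤ b) (hc : IntervalIntegrable c volume 0 b) :
    IntervalIntegrable (gFun c) volume 0 b :=
  ContinuousOn.intervalIntegrable (by rw [uIcc_of_le hb]; exact continuousOn_gFun hb hc)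

lemma continuousOn_gInt (hb : 0 ≤ b) (hc : IntervalIntegrable c volume 0 b) :
    ContinuousOn (gInt c) (Icc 0 b) := by
  have := intervalIntegral.continuousOn_primitive_interval' (intervalIntegrable_gFun hb hc)
    (a := 0) (by simp)
  rwa [uIcc_of_le hb] at this

lemma gInt_zero (c : ℝ → ℝ) : gInt c 0 = 0 := by simp [gInt]

lemma hasDerivAt_gInt (hc : IntervalIntegrable c volume 0 b) {x : ℝ} (hx : x ∈ Ioo 0 b) :
    HasDerivAt (gInt c) (gFun c x) x := by
  have hb : 0 ≤ b := hx.1.le.trans hx.2.le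
  have hcont : ContinuousOn (gFun c) (Ioo 0 b) :=
    (continuousOn_gFun hb hc).mono Ioo_subset_Icc_self
  refine intervalIntegral.integral_hasDerivAt_right
    (intervalIntegrable_sub (intervalIntegrable_gFun hb hc) ⟨le_rfl, hb⟩ ⟨hx.1.le, hx.2.le⟩)
    (hcont.stronglyMeasurableAtFilter isOpen_Ioo x hx)
    (hcont.continuousAt (isOpen_Ioo.mem_nhds hx))

lemma strictMonoOn_gInt (hb : 0 ≤ b) (hc : IntervalIntegrable c volume 0 b) :
    StrictMonoOn (gInt c) (Icc 0 b) := by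
  refine strictMonoOn_of_deriv_pos (convex_Icc 0 b) (continuousOn_gInt hb hc) fun x hx => ?_
  rw [interior_Icc] at hx
  rw [(hasDerivAt_gInt hc hx).deriv]
  exact gFun_pos c x

/-- Eliminates `c` from the variance, leaving only `g` and its primitive. -/
lemma hFun_eq (hc : IntervalIntegrable c volume 0 b) {x : ℝ} (hx : x ∈ Icc 0 b) :
    hFun b c x = (1 - 2 * gInt c x / aVal b c) / gFun c x - 1 := by
  rcases hx.1.eq_or_lt with rfl | hx0
  · simp [hFun, gInt, gFun_zero]
  have hcx := intervalIntegrable_sub hc ⟨le_rfl, hx.1.trans hx.2⟩ hx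
  have e1 : ∫ z in (0 : ℝ)..x, c z * gFun c z = (1 - gFun c x) / 2 := by
    rw [gFun_of_nonneg c hx.1, ← integral_mul_exp_neg_two hcx]
    refine intervalIntegral.integral_congr fun z hz => ?_
    rw [uIcc_of_le hx.1] at hz
    simp only [gFun_of_nonneg c hz.1]
  have e2 : ∫ z in (0 : ℝ)..x, (c z - 1 / aVal b c) * gFun c z
      = (1 - gFun c x) / 2 - 1 / aVal b c * gInt c x := by
    rw [← e1, gInt, ← intervalIntegral.integral_const_mul, ← intervalIntegral.integral_sub]
    · simp only [sub_mul]
    · refine hcx.mul_continuousOn ?_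
      rw [uIcc_of_le hx.1]; exact continuousOn_gFun hx.1 hcx
    · exact (intervalIntegrable_gFun hx.1 hcx).const_mul _
  have hg := (gFun_pos c x).ne'
  rw [hFun, abs_of_pos hx0, e2, Real.sign_of_pos hx0]
  field_simp
  ring

/-- The integrand `(x - γ h(x))² g(x)`, without the integral in the definition of `h`;
here `a` stands for `2 ∫_0^b g`. -/
def etaIntegrand (γ a : ℝ) (c : ℝ → ℝ) (x : ℝ) : ℝ :=
  (x + γ - γ * ((1 - 2 * gInt c x / a) / gFun c x)) ^ 2 * gFun c x

lemma etaVal_eq (hb : 0 ≤ b) (hc : IntervalIntegrable c volume 0 b) (γ : ℝ) :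
    etaVal γ b c = 2 / aVal b c * ∫ x in (0 : ℝ)..b, etaIntegrand γ (aVal b c) c x := by
  rw [etaVal]
  congr 1
  refine intervalIntegral.integral_congr fun x hx => ?_
  rw [uIcc_of_le hb] at hx
  simp only [hFun_eq hc hx, etaIntegrand]
  ring

lemma continuousOn_etaIntegrand (hb : 0 ≤ b) (hc : IntervalIntegrable c volume 0 b) (γ a : ℝ) :
    ContinuousOn (etaIntegrand γ a c) (Icc 0 b) := by
  have h1 := continuousOn_gFun hb hc
  have h2 := continuousOn_gInt hb hc
  have h3 : ContinuousOn (fun x => (1 - 2 * gInt c x / a) / gFun c x) (Icc 0 b) :=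
    ((continuousOn_const (c := (1 : ℝ))).sub ((h2.const_smul (2 : ℝ)).div_const a)).div h1
      fun x _ => (gFun_pos c x).ne'
  exact (((continuousOn_id.add continuousOn_const).sub (h3.const_smul γ)).pow 2).mul h1

/-- A lower bound for the asymptotic variance, by duality with a test function `φ`. -/
lemma le_etaVal (hb : 0 < b) (hc : IntervalIntegrable c volume 0 b)
    (h0 : ∀ x ∈ Icc 0 b, 0 ≤ c x) (γ : ℝ) {φ Φ Ψ M : ℝ → ℝ}
    (hΦc : ContinuousOn Φ (Icc 0 1)) (hΨc : ContinuousOn Ψ (Icc 0 1))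
    (hMc : ContinuousOn M (Icc 0 1))
    (hΦ : ∀ v ∈ Ioo (0 : ℝ) 1, HasDerivAt Φ (φ v) v)
    (hΨ : ∀ v ∈ Ioo (0 : ℝ) 1, HasDerivAt Ψ (φ v ^ 2) v)
    (hM : ∀ v ∈ Ioo (0 : ℝ) 1, HasDerivAt M (Φ v - 2 * γ / aVal b c * v * φ v) v)
    (hnn : ∀ v ∈ Ioo (0 : ℝ) 1, 0 ≤ Φ v - 2 * γ / aVal b c * v * φ v)
    (hΦ0 : Φ 0 = 0) (hΨ0 : Ψ 0 = 0) (hM0 : M 0 = 0) :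
    2 * γ * Φ 1 - Ψ 1 + aVal b c * M 1 ≤ etaVal γ b c := by
  have hGb : 0 < gInt c b := by
    have := strictMonoOn_gInt hb.le hc (left_mem_Icc.2 hb.le) (right_mem_Icc.2 hb.le) hb
    rwa [gInt_zero] at this
  have hA : 0 < aVal b c := by rw [aVal_eq_gInt]; linarith
  rw [etaVal_eq hb.le hc]
  set A := aVal b c with hAdef
  have hAG : A = 2 * gInt c b := rfl
  -- The new variable: it decreases from `1` at `x = 0` to `0` at `x = b`, so the test functions
  -- live on `[0, 1]`.
  set v : ℝ → ℝ := fun x => 1 - 2 * gInt c x / A with hv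
  have hv0 : v 0 = 1 := by simp [hv, gInt_zero]
  have hvb : v b = 0 := by simp only [hv, ← hAG]; field_simp; simp
  have hanti : ∀ x ∈ Icc 0 b, ∀ y ∈ Icc 0 b, x < y → v y < v x := by
    intro x hx y hy hxy
    have := strictMonoOn_gInt hb.le hc hx hy hxy
    simp only [hv]; gcongr
  have hvmem : ∀ x ∈ Ioo 0 b, v x ∈ Ioo (0 : ℝ) 1 := fun x hx =>
    ⟨by rw [← hvb]; exact hanti x ⟨hx.1.le, hx.2.le⟩ b (right_mem_Icc.2 hb.le) hx.2,
      by rw [← hv0]; exact hanti 0 (left_mem_Icc.2 hb.le) x ⟨hx.1.le, hx.2.le⟩ hx.1⟩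
  have hvmaps : MapsTo v (Icc 0 b) (Icc 0 1) := by
    intro x hx
    constructor
    · rcases hx.2.eq_or_lt with h | h
      · rw [h, hvb]
      · rw [← hvb]; exact (hanti x hx b (right_mem_Icc.2 hb.le) h).le
    · rcases hx.1.eq_or_lt with h | h
      · rw [← h, hv0]
      · rw [← hv0]; exact (hanti 0 (left_mem_Icc.2 hb.le) x hx h).le
  have hvc : ContinuousOn v (Icc 0 b) := by
    have := continuousOn_gInt hb.le hc
    exact (continuousOn_const (c := (1 : ℝ))).sub ((this.const_smul (2 : ℝ)).div_const A)
  have hEc := continuousOn_etaIntegrand hb.le hc γ A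
  have hEi : IntervalIntegrable (etaIntegrand γ A c) volume 0 b :=
    ContinuousOn.intervalIntegrable (by rwa [uIcc_of_le hb.le])
  -- Cost accumulated on `[0, x]` plus the dual value still to come. `F 0` is the claimed bound and
  -- `F b` is `η`, so monotonicity is all that is needed.
  set F : ℝ → ℝ := fun x => 2 / A * (∫ z in (0 : ℝ)..x, etaIntegrand γ A c z)
    + 2 * (x + γ) * Φ (v x) - Ψ (v x) + A * M (v x) with hF
  have hmono : MonotoneOn F (Icc 0 b) := by
    have hIc : ContinuousOn (fun x => ∫ z in (0 : ℝ)..x, etaIntegrand γ A c z) (Icc 0 b) := by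
      have := intervalIntegral.continuousOn_primitive_interval' hEi (a := 0) (by simp)
      rwa [uIcc_of_le hb.le] at this
    have hlin : ContinuousOn (fun x : ℝ => 2 * (x + γ)) (Icc 0 b) := by fun_prop
    -- The derivative is the completed square `(Y - φ)²` (from `Y² ≥ 2φY - φ²`) plus the multiplier
    -- times the slack `1 - g`. Only the sign of the slack uses `c ≥ 0`.
    refine monotoneOn_of_hasDerivWithinAt_nonneg (convex_Icc 0 b)
      (f' := fun x => 2 / A * gFun c x * ((x + γ - γ * (v x / gFun c x)) - φ (v x)) ^ 2
        + 2 * (Φ (v x) - 2 * γ / A * v x * φ (v x)) * (1 - gFun c x)) ?_ ?_ ?_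
    · exact (((hIc.const_smul (2 / A)).add (hlin.mul (hΦc.comp hvc hvmaps))).sub
        (hΨc.comp hvc hvmaps)).add ((hMc.comp hvc hvmaps).const_smul A)
    · intro x hx
      rw [interior_Icc] at hx
      refine HasDerivAt.hasDerivWithinAt ?_
      have hvd : HasDerivAt v (-(2 / A * gFun c x)) x := by
        have := ((hasDerivAt_gInt hc hx).const_mul 2).div_const A |>.const_sub 1
        convert! this using 1; ring
      have hId : HasDerivAt (fun x => ∫ z in (0 : ℝ)..x, etaIntegrand γ A c z)
          (etaIntegrand γ A c x) x := by
        have hcont := hEc.mono Ioo_subset_Icc_self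
        exact intervalIntegral.integral_hasDerivAt_right
          (intervalIntegrable_sub hEi ⟨le_rfl, hb.le⟩ ⟨hx.1.le, hx.2.le⟩)
          (hcont.stronglyMeasurableAtFilter isOpen_Ioo x hx)
          (hcont.continuousAt (isOpen_Ioo.mem_nhds hx))
      have hvx := hvmem x hx
      have d1 := (((hasDerivAt_id x).add_const γ).const_mul 2).mul ((hΦ _ hvx).comp x hvd)
      have d2 := (hΨ _ hvx).comp x hvd
      have d3 := ((hM _ hvx).comp x hvd).const_mul A
      have := (((hId.const_mul (2 / A)).add d1).sub d2).add d3
      convert! this using 1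
      have hg := (gFun_pos c x).ne'
      simp only [etaIntegrand, id, Function.comp]
      change _ = 2 / A * ((x + γ - γ * (v x / gFun c x)) ^ 2 * gFun c x) + _ - _ + _
      field_simp
      ring
    · intro x hx
      rw [interior_Icc] at hx
      have h1 := hnn _ (hvmem x hx)
      have h2 := gFun_le_one h0 ⟨hx.1.le, hx.2.le⟩
      have h3 := gFun_pos c x
      have : 0 ≤ 1 - gFun c x := by linarith
      positivity
  have := hmono (left_mem_Icc.2 hb.le) (right_mem_Icc.2 hb.le) hb.le
  simp only [hF, hv0, hvb, hΦ0, hΨ0, hM0, intervalIntegral.integral_same] at this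
  linarith

end Profile
end

noncomputable section

/-! ### The lower bound -/

lemma hasDerivAt_ite_le {f₁ f₂ d₁ d₂ : ℝ → ℝ} {p x : ℝ} (hf : f₁ p = f₂ p) (hd : d₁ p = d₂ p)
    (h₁ : x ≤ p → HasDerivAt f₁ (d₁ x) x) (h₂ : p ≤ x → HasDerivAt f₂ (d₂ x) x) :
    HasDerivAt (fun v => if v ≤ p then f₁ v else f₂ v) (if x ≤ p then d₁ x else d₂ x) x := by
  rcases lt_trichotomy x p with h | rfl | h
  · rw [if_pos h.le]
    refine (h₁ h.le).congr_of_eventuallyEq ?_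
    filter_upwards [Iio_mem_nhds h] with v hv
    rw [if_pos (le_of_lt hv)]
  · rw [if_pos le_rfl, ← hasDerivWithinAt_univ, ← Iic_union_Ici (a := x)]
    refine HasDerivWithinAt.union ?_ ?_
    · refine (h₁ le_rfl).hasDerivWithinAt.congr (fun v hv => ?_) ?_
      · rw [if_pos (mem_Iic.1 hv)]
      · rw [if_pos le_rfl]
    · rw [hd]
      refine (h₂ le_rfl).hasDerivWithinAt.congr (fun v hv => ?_) ?_
      · rcases (mem_Ici.1 hv).eq_or_lt with h | h
        · rw [← h, if_pos le_rfl, hf]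
        · rw [if_neg (not_le.2 h)]
      · rw [if_pos le_rfl, hf]
  · rw [if_neg (not_le.2 h)]
    refine (h₂ h.le).congr_of_eventuallyEq ?_
    filter_upwards [Ioi_mem_nhds h] with v hv
    rw [if_neg (not_le.2 hv)]

lemma continuousAt_ite_le_of_lt {f₁ f₂ : ℝ → ℝ} {p x : ℝ} (hx : x < p) (h : ContinuousAt f₁ x) :
    ContinuousAt (fun v => if v ≤ p then f₁ v else f₂ v) x := by
  refine h.congr ?_
  filter_upwards [Iio_mem_nhds hx] with v hv
  rw [if_pos (le_of_lt hv)]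

section Profile

variable {b : ℝ} {c : ℝ → ℝ}

lemma etaVal_nonneg (hb : 0 ≤ b) (γ : ℝ) : 0 ≤ etaVal γ b c := by
  have h1 : 0 ≤ aVal b c :=
    mul_nonneg zero_le_two (intervalIntegral.integral_nonneg hb fun x _ => (gFun_pos c x).le)
  exact mul_nonneg (by positivity) (intervalIntegral.integral_nonneg hb fun x _ =>
    mul_nonneg (sq_nonneg _) (gFun_pos c x).le)

lemma aVal_pos (hb : 0 < b) (hc : IntervalIntegrable c volume 0 b) : 0 < aVal b c := by
  have := strictMonoOn_gInt hb.le hc (left_mem_Icc.2 hb.le) (right_mem_Icc.2 hb.le) hb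
  rw [gInt_zero] at this
  rw [aVal_eq_gInt]; linarith

/-- The test function `κ (1 - v)` is the residual of `c = 0`, where `x = (a/2)(1 - v)`. The bounds
on `2γ` give `κ ≥ 0` and `k ≤ 1`, which make the multiplier nonnegative. -/
lemma sq_div_twelve_le_etaVal (hb : 0 < b) (hc : IntervalIntegrable c volume 0 b)
    (h0 : ∀ x ∈ Icc 0 b, 0 ≤ c x) {γ : ℝ} (h1 : 2 * γ ≤ aVal b c) (h2 : -aVal b c ≤ 2 * γ) :
    (aVal b c + 2 * γ) ^ 2 / 12 ≤ etaVal γ b c := by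
  have hA := aVal_pos hb hc
  set A := aVal b c with hAdef
  obtain ⟨k, hk⟩ : ∃ k, k = 2 * γ / A := ⟨_, rfl⟩
  have hγ : γ = A * k / 2 := by rw [hk]; field_simp
  have hk1 : k ≤ 1 := by rw [hk, div_le_one hA]; exact h1
  have hκ : 0 ≤ γ + A / 2 := by linarith
  set κ := γ + A / 2 with hκdef
  have := le_etaVal hb hc h0 γ (φ := fun v => κ * (1 - v)) (Φ := fun v => κ * (v - v ^ 2 / 2))
    (Ψ := fun v => κ ^ 2 * (v - v ^ 2 + v ^ 3 / 3))
    (M := fun v => κ * (v ^ 2 / 2 - v ^ 3 / 6 - k * v ^ 2 / 2 + k * v ^ 3 / 3))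
    (by fun_prop) (by fun_prop) (by fun_prop)
    (fun v _ => by
      convert! (((hasDerivAt_id v).sub (((hasDerivAt_id v).pow 2).div_const 2)).const_mul κ) using 1
      simp)
    (fun v _ => by
      convert! ((((hasDerivAt_id v).sub ((hasDerivAt_id v).pow 2)).add
        (((hasDerivAt_id v).pow 3).div_const 3)).const_mul (κ ^ 2)) using 1
      simp; ring)
    (fun v _ => by
      rw [← hAdef, ← hk]
      convert! (((((((hasDerivAt_id v).pow 2).div_const 2).sub
        (((hasDerivAt_id v).pow 3).div_const 6)).sub
        ((((hasDerivAt_id v).pow 2).const_mul k).div_const 2)).add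
        ((((hasDerivAt_id v).pow 3).const_mul k).div_const 3)).const_mul κ) using 1
      simp; ring)
    (fun v hv => by
      rw [← hAdef, ← hk]
      have : κ * (v - v ^ 2 / 2) - k * v * (κ * (1 - v))
        = κ * (v * ((1 - k) * (1 - v) + v / 2)) := by ring
      simp only [this]
      have h3 : 0 ≤ 1 - v := by linarith [hv.2]
      have h4 : 0 ≤ 1 - k := by linarith
      have h5 := hv.1
      positivity)
    (by simp) (by simp) (by simp)
  refine le_trans (le_of_eq ?_) this
  simp only [hκdef, hγ]
  ring

/-- For `v ≥ p` the test function is again the residual `κ (1 - v)` of a stretch with `g = 1`. For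
`v ≤ p` it is the multiple of `v^(ξ/2 - 1)` that matches at `p`; this exponent solves `Φ = (2/ξ) v
φ`, so the multiplier vanishes where the control acts. Square integrability of the power at `0` is
the condition `ξ > 1`. -/
lemma eta1_le_etaVal (hb : 0 < b) (hc : IntervalIntegrable c volume 0 b)
    (h0 : ∀ x ∈ Icc 0 b, 0 ≤ c x) {γ : ℝ} (h1 : γ < aVal b c) (h2 : aVal b c < 2 * γ) :
    γ ^ 2 * eta1 (aVal b c / γ) ≤ etaVal γ b c := by
  have hA := aVal_pos hb hc
  set A := aVal b c with hAdef
  have hγ : 0 < γ := by linarith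
  obtain ⟨ξ, hξ⟩ : ∃ ξ, ξ = A / γ := ⟨_, rfl⟩
  have hAξ : A = γ * ξ := by rw [hξ]; field_simp
  have hξ1 : 1 < ξ := by rw [hξ, lt_div_iff₀ hγ]; linarith
  have hξ2 : ξ < 2 := by rw [hξ, div_lt_iff₀ hγ]; linarith
  have hkξ : 2 * γ / A = 2 / ξ := by rw [hAξ]; field_simp
  have h4ξ : 0 < 4 - ξ := by linarith
  have hξ0 : 0 < ξ := by linarith
  have hp0 : 0 < 4 - ξ ^ 2 := by nlinarith
  -- The breakpoint is `p = 1 - 2l/a`, the value of `v` at the left end `x = l` of the explicit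
  -- control.
  obtain ⟨p, hp⟩ : ∃ p, p = (4 - ξ ^ 2) / (ξ * (4 - ξ)) := ⟨_, rfl⟩
  have hppos : 0 < p := by rw [hp]; positivity
  have hp1 : p < 1 := by rw [hp, div_lt_one (by positivity)]; nlinarith
  obtain ⟨κ, hκ⟩ : ∃ κ, κ = γ * (1 + ξ / 2) := ⟨_, rfl⟩
  have hκ0 : 0 < κ := by rw [hκ]; positivity
  set φ₁ : ℝ → ℝ := fun v => κ * (1 - p) * (v / p) ^ (ξ / 2 - 1) with hφ₁
  set Φ₁ : ℝ → ℝ := fun v => κ * (1 - p) * p * (2 / ξ) * (v / p) ^ (ξ / 2) with hΦ₁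
  set Ψ₁ : ℝ → ℝ := fun v => (κ * (1 - p)) ^ 2 * p / (ξ - 1) * (v / p) ^ (ξ - 1) with hΨ₁
  set φ₂ : ℝ → ℝ := fun v => κ * (1 - v) with hφ₂
  set Φ₂ : ℝ → ℝ := fun v => κ * (1 - p) * p * (2 / ξ) + κ * ((v - v ^ 2 / 2) - (p - p ^ 2 / 2))
    with hΦ₂
  set Ψ₂ : ℝ → ℝ := fun v => (κ * (1 - p)) ^ 2 * p / (ξ - 1)
    + κ ^ 2 * ((v - v ^ 2 + v ^ 3 / 3) - (p - p ^ 2 + p ^ 3 / 3)) with hΨ₂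
  set M₂ : ℝ → ℝ := fun v => κ * ((2 / ξ * p * (1 - p) - p + p ^ 2 / 2) * (v - p)
    + (1 - 2 / ξ) * (v ^ 2 - p ^ 2) / 2 + (2 * (2 / ξ) - 1) * (v ^ 3 - p ^ 3) / 6) with hM₂
  have hpp : p / p = 1 := div_self hppos.ne'
  have hrpow : ∀ (e v : ℝ), 0 < v →
      HasDerivAt (fun v => (v / p) ^ e) (e * (v / p) ^ (e - 1) / p) v := by
    intro e v hv
    convert! ((hasDerivAt_id v).div_const p).rpow_const (p := e)
      (Or.inl (div_pos hv hppos).ne') using 1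
    simp; ring
  have hsplit : ∀ v, 0 < v → v / p * (v / p) ^ (ξ / 2 - 1) = (v / p) ^ (ξ / 2) := by
    intro v hv
    have hvp : 0 < v / p := div_pos hv hppos
    nth_rewrite 1 [← Real.rpow_one (v / p)]
    rw [← Real.rpow_add hvp]; congr 1; ring
  have hzero : ∀ v, 0 < v → Φ₁ v - 2 / ξ * v * φ₁ v = 0 := by
    intro v hv
    simp only [hΦ₁, hφ₁, ← hsplit v hv]
    field_simp
    ring
  have hΦd : ∀ v ∈ Ioi (0 : ℝ), HasDerivAt (fun v => if v ≤ p then Φ₁ v else Φ₂ v)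
      (if v ≤ p then φ₁ v else φ₂ v) v := by
    intro v hv
    refine hasDerivAt_ite_le (by simp [hΦ₁, hΦ₂, hpp]) (by simp [hφ₁, hφ₂, hpp])
      (fun _ => ?_) (fun _ => ?_)
    · convert! (hrpow (ξ / 2) v hv).const_mul (κ * (1 - p) * p * (2 / ξ)) using 1
      simp only [hφ₁]; field_simp
    · convert! ((((hasDerivAt_id v).sub (((hasDerivAt_id v).pow 2).div_const 2)).sub_const
        (p - p ^ 2 / 2)).const_mul κ).const_add (κ * (1 - p) * p * (2 / ξ)) using 1
      simp only [hφ₂]; simp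
  have hΨd : ∀ v ∈ Ioi (0 : ℝ), HasDerivAt (fun v => if v ≤ p then Ψ₁ v else Ψ₂ v)
      (if v ≤ p then φ₁ v ^ 2 else φ₂ v ^ 2) v := by
    intro v hv
    refine hasDerivAt_ite_le (d₁ := fun v => φ₁ v ^ 2) (d₂ := fun v => φ₂ v ^ 2)
      (by simp [hΨ₁, hΨ₂, hpp]) (by simp [hφ₁, hφ₂, hpp]) (fun _ => ?_) (fun _ => ?_)
    · convert! (hrpow (ξ - 1) v hv).const_mul ((κ * (1 - p)) ^ 2 * p / (ξ - 1)) using 1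
      have hvp : 0 < v / p := div_pos hv hppos
      have : ((v / p) ^ (ξ / 2 - 1)) ^ 2 = (v / p) ^ (ξ - 1 - 1) := by
        rw [← Real.rpow_natCast, ← Real.rpow_mul hvp.le]; congr 1; push_cast; ring
      have h3 : ξ - 1 ≠ 0 := by linarith
      simp only [hφ₁, mul_pow, this]; field_simp
    · convert! (((((hasDerivAt_id v).sub ((hasDerivAt_id v).pow 2)).add
        (((hasDerivAt_id v).pow 3).div_const 3)).sub_const
        (p - p ^ 2 + p ^ 3 / 3)).const_mul (κ ^ 2)).const_add
        ((κ * (1 - p)) ^ 2 * p / (ξ - 1)) using 1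
      simp only [hφ₂]; simp; ring
  have hM2d : ∀ v, HasDerivAt M₂ (Φ₂ v - 2 / ξ * v * φ₂ v) v := by
    intro v
    convert! (((((hasDerivAt_id v).sub_const p).const_mul
      (2 / ξ * p * (1 - p) - p + p ^ 2 / 2)).add
      (((((hasDerivAt_id v).pow 2).sub_const (p ^ 2)).const_mul (1 - 2 / ξ)).div_const 2)).add
      (((((hasDerivAt_id v).pow 3).sub_const (p ^ 3)).const_mul
        (2 * (2 / ξ) - 1)).div_const 6)).const_mul κ using 1
    simp only [hΦ₂, hφ₂]; simp; ring
  have hMd : ∀ v ∈ Ioi (0 : ℝ), HasDerivAt (fun v => if v ≤ p then (0 : ℝ) else M₂ v)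
      ((if v ≤ p then Φ₁ v else Φ₂ v) - 2 / ξ * v * (if v ≤ p then φ₁ v else φ₂ v)) v := by
    intro v hv
    have : ((if v ≤ p then Φ₁ v else Φ₂ v) - 2 / ξ * v * (if v ≤ p then φ₁ v else φ₂ v))
        = if v ≤ p then 0 else Φ₂ v - 2 / ξ * v * φ₂ v := by
      split_ifs
      · exact hzero v hv
      · rfl
    rw [this]
    refine hasDerivAt_ite_le (f₁ := fun _ => 0) (d₁ := fun _ => 0)
      (d₂ := fun v => Φ₂ v - 2 / ξ * v * φ₂ v) (by simp [hM₂]) (by simp [hΦ₂, hφ₂]; ring)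
      (fun _ => hasDerivAt_const _ _) (fun _ => hM2d v)
  have hcont : ∀ {f d : ℝ → ℝ}, (∀ v ∈ Ioi (0 : ℝ), HasDerivAt f (d v) v) → ContinuousAt f 0 →
      ContinuousOn f (Icc 0 1) := by
    intro f d hf hf0 v hv
    rcases hv.1.eq_or_lt with rfl | h
    · exact hf0.continuousWithinAt
    · exact (hf v h).continuousAt.continuousWithinAt
  -- The power in `φ₁` has a negative exponent, but those in `Φ₁` and `Ψ₁` are positive, so the
  -- primitives stay continuous at `v = 0`.
  have hpow0 : ∀ e : ℝ, 0 < e → ContinuousAt (fun v => (v / p) ^ e) 0 := by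
    intro e he
    exact (Real.continuousAt_rpow_const _ _ (Or.inr he.le)).comp
      (continuousAt_id.div_const p)
  have key := le_etaVal hb hc h0 γ
    (hcont hΦd (continuousAt_ite_le_of_lt hppos ((hpow0 (ξ / 2) (by linarith)).const_mul _)))
    (hcont hΨd (continuousAt_ite_le_of_lt hppos ((hpow0 (ξ - 1) (by linarith)).const_mul _)))
    (hcont hMd (continuousAt_ite_le_of_lt hppos continuousAt_const))
    (fun v hv => hΦd v hv.1)
    (fun v hv => by
      convert! hΨd v hv.1 using 1
      split_ifs <;> rfl)
    (fun v hv => by rw [← hAdef, hkξ]; exact hMd v hv.1)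
    (fun v hv => by
      rw [← hAdef, hkξ]
      split_ifs with h
      · exact (hzero v hv.1).ge
      · have hvp : 0 ≤ v - p := by linarith
        -- Taylor expansion of the multiplier at `p`, where it vanishes. Its slope there is
        -- nonnegative because `ξ < 2`, its second-order coefficient because `ξ < 4`.
        have e : Φ₂ v - 2 / ξ * v * φ₂ v = κ * ((v - p) * (((1 - 2 / ξ) + (2 * (2 / ξ) - 1) * p)
            + (2 * (2 / ξ) - 1) / 2 * (v - p))) := by
          simp only [hΦ₂, hφ₂]; ring
        have e1 : (1 - 2 / ξ) + (2 * (2 / ξ) - 1) * p = 2 * (2 - ξ) / ξ ^ 2 := by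
          rw [hp]; field_simp; ring
        have e2 : 2 * (2 / ξ) - 1 = (4 - ξ) / ξ := by field_simp; ring
        rw [e, e1, e2]
        have : 0 < 2 - ξ := by linarith
        positivity)
    (by
      rw [if_pos hppos.le]
      simp [hΦ₁, Real.zero_rpow (by positivity : ξ / 2 ≠ 0)])
    (by
      rw [if_pos hppos.le]
      simp [hΨ₁, Real.zero_rpow (by linarith : ξ - 1 ≠ 0)])
    (by rw [if_pos hppos.le])
  rw [if_neg (not_le.2 hp1), if_neg (not_le.2 hp1), if_neg (not_le.2 hp1)] at key
  refine le_trans (le_of_eq ?_) key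
  rw [← hAdef, ← hξ]
  have h3 : ξ - 1 ≠ 0 := by linarith
  simp only [hΦ₂, hΨ₂, hM₂, hκ, hAξ, eta1, hp]
  field_simp
  ring

/-- The infimum of the asymptotic variance over all `b, c` with `2 ∫_0^b g = a`. -/
def etaMin (γ a : ℝ) : ℝ := if γ = 0 then a ^ 2 / 12 else |γ| ^ 2 * etaDagger (a / γ)

lemma etaMin_le_etaVal (hb : 0 < b) (hc : IntervalIntegrable c volume 0 b)
    (h0 : ∀ x ∈ Icc 0 b, 0 ≤ c x) (γ : ℝ) : etaMin γ (aVal b c) ≤ etaVal γ b c := by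
  have hA := aVal_pos hb hc
  have hquad : γ ≠ 0 → |γ| ^ 2 * eta2 (aVal b c / γ) = (aVal b c + 2 * γ) ^ 2 / 12 := by
    intro h
    rw [sq_abs, eta2]; field_simp
  rw [etaMin]
  split_ifs with hγ
  · have := sq_div_twelve_le_etaVal hb hc h0 (γ := γ) (by linarith) (by linarith)
    simpa [hγ] using this
  rw [etaDagger]
  split_ifs with h1 h2 h3
  · rw [hquad hγ]
    have : γ < 0 := by
      rcases lt_or_gt_of_ne hγ with h | h
      · exact h
      · have := div_pos hA h; linarith
    rw [div_le_iff_of_neg this] at h1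
    exact sq_div_twelve_le_etaVal hb hc h0 (by linarith) (by linarith)
  · simpa using etaVal_nonneg hb.le γ
  · have : 0 < γ := by
      rcases lt_or_gt_of_ne hγ with h | h
      · have := div_neg_of_pos_of_neg hA h; linarith
      · exact h
    rw [sq_abs]
    exact eta1_le_etaVal hb hc h0 (by rw [not_le, lt_div_iff₀ this] at h2; linarith)
      (by rw [div_lt_iff₀ this] at h3; linarith)
  · rw [hquad hγ]
    have : 0 < γ := by
      rcases lt_or_gt_of_ne hγ with h | h
      · have := div_neg_of_pos_of_neg hA h; linarith
      · exact h
    rw [not_lt, le_div_iff₀ this] at h3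
    exact sq_div_twelve_le_etaVal hb hc h0 (by linarith) (by linarith)

end Profile
end

noncomputable section

/-! ### Controls that are a multiple of `1 / (γ + ψ |x|)` on an interval -/

/-- A bounded, even, compactly supported control `c ≥ 0` and a boundary `b > 0` such that
`2 ∫_0^b g = a`. -/
structure IsAdmissible (a b : ℝ) (c : ℝ → ℝ) : Prop where
  pos : 0 < b
  nonneg : ∀ x, 0 ≤ c x
  even : ∀ x, c (-x) = c x
  measurable : Measurable c
  bounded : ∃ K, ∀ x, c x ≤ K
  support : ∃ R, ∀ x, R ≤ |x| → c x = 0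
  aVal_eq : aVal b c = a

lemma intervalIntegrable_of_bounded {c : ℝ → ℝ} (hm : Measurable c) {K : ℝ}
    (hK : ∀ x, |c x| ≤ K) (x y : ℝ) : IntervalIntegrable c volume x y :=
  (intervalIntegrable_const (c := K)).mono_fun hm.aestronglyMeasurable
    (Eventually.of_forall fun z => (hK z).trans (le_abs_self K))

lemma IsAdmissible.intervalIntegrable {a b : ℝ} {c : ℝ → ℝ} (h : IsAdmissible a b c) (x y : ℝ) :
    IntervalIntegrable c volume x y := by
  obtain ⟨K, hK⟩ := h.bounded
  exact intervalIntegrable_of_bounded h.measurable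
    (fun z => by rw [abs_of_nonneg (h.nonneg z)]; exact hK z) x y

open Classical in
/-- The control `(ν + 1) / (2 (q + |x| - l))` on `l ≤ |x| < r`. -/
def hyperbolicControl (l r q ν x : ℝ) : ℝ :=
  if l ≤ |x| ∧ |x| < r then (ν + 1) / 2 / (q + (|x| - l)) else 0

section Hyperbolic

variable {l r q ν L : ℝ}

/-- An affine function equal to `1` at `l` and positive at `r` is positive in between. The sign of
`q` is left free since `q = γ < 0` occurs. -/
lemma one_add_div_pos (hw : 0 < 1 + (r - l) / q) {x : ℝ} (h1 : l ≤ x) (h2 : x ≤ r) :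
    0 < 1 + (x - l) / q := by
  rcases lt_or_ge q 0 with h | h
  · have : (r - l) / q ≤ (x - l) / q := div_le_div_of_nonpos_of_le h.le (by linarith)
    linarith
  · have : 0 ≤ (x - l) / q := div_nonneg (by linarith) h
    linarith

lemma min_le_one_add_div {x : ℝ} (h1 : l ≤ x) (h2 : x ≤ r) :
    min 1 (1 + (r - l) / q) ≤ 1 + (x - l) / q := by
  rcases lt_or_ge q 0 with h | h
  · have : (r - l) / q ≤ (x - l) / q := div_le_div_of_nonpos_of_le h.le (by linarith)
    exact (min_le_right _ _).trans (by linarith)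
  · have : 0 ≤ (x - l) / q := div_nonneg (by linarith) h
    exact (min_le_left _ _).trans (by linarith)

lemma measurable_hyperbolicControl : Measurable (hyperbolicControl l r q ν) := by
  unfold hyperbolicControl
  refine Measurable.ite ?_ ?_ measurable_const
  · exact (measurableSet_le measurable_const measurable_norm).inter
      (measurableSet_lt measurable_norm measurable_const)
  · have : Measurable fun x : ℝ => |x| := measurable_norm
    fun_prop

lemma hyperbolicControl_neg (x : ℝ) :
    hyperbolicControl l r q ν (-x) = hyperbolicControl l r q ν x := by
  simp [hyperbolicControl]

lemma hyperbolicControl_of_le {x : ℝ} (h : r ≤ |x|) : hyperbolicControl l r q ν x = 0 := by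
  rw [hyperbolicControl, if_neg]
  exact fun h' => absurd h'.2 (not_lt.2 h)

lemma hyperbolicControl_nonneg (hq : q ≠ 0) (hw : 0 < 1 + (r - l) / q) (hν : 0 ≤ (ν + 1) / q)
    (x : ℝ) : 0 ≤ hyperbolicControl l r q ν x := by
  rw [hyperbolicControl]
  split_ifs with h
  · have h1 := one_add_div_pos hw h.1 h.2.le
    have : (ν + 1) / 2 / (q + (|x| - l)) = (ν + 1) / q / 2 / (1 + (|x| - l) / q) := by
      field_simp
    rw [this]; positivity
  · exact le_rfl

lemma abs_hyperbolicControl_le (hq : q ≠ 0) (hw : 0 < 1 + (r - l) / q) (x : ℝ) :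
    |hyperbolicControl l r q ν x| ≤ |(ν + 1) / q| / 2 / min 1 (1 + (r - l) / q) := by
  have hmin : 0 < min 1 (1 + (r - l) / q) := lt_min one_pos hw
  rw [hyperbolicControl]
  split_ifs with h
  · have h1 := one_add_div_pos hw h.1 h.2.le
    have : (ν + 1) / 2 / (q + (|x| - l)) = (ν + 1) / q / 2 / (1 + (|x| - l) / q) := by
      field_simp
    rw [this, abs_div, abs_div, abs_of_pos h1, abs_two]
    gcongr
    exact min_le_one_add_div h.1 h.2.le
  · rw [abs_zero]; positivity

lemma intervalIntegrable_hyperbolicControl (hq : q ≠ 0) (hw : 0 < 1 + (r - l) / q) (x y : ℝ) :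
    IntervalIntegrable (hyperbolicControl l r q ν) volume x y :=
  intervalIntegrable_of_bounded measurable_hyperbolicControl (abs_hyperbolicControl_le hq hw) x y

lemma integral_hyperbolicControl_left {x : ℝ} (hx0 : 0 ≤ x) (hxl : x ≤ l) :
    ∫ y in (0 : ℝ)..x, hyperbolicControl l r q ν y = 0 := by
  rw [intervalIntegral.integral_congr_Ioo_of_le (g := fun _ => (0 : ℝ)) hx0]
  · simp
  · intro y hy
    simp only [hyperbolicControl]
    rw [if_neg]
    rw [abs_of_pos hy.1]
    exact fun h => absurd h.1 (not_le.2 (hy.2.trans_le hxl))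

lemma hasDerivAt_one_add_div (x : ℝ) : HasDerivAt (fun x => 1 + (x - l) / q) (1 / q) x :=
  (((hasDerivAt_id x).sub_const l).div_const q).const_add 1

lemma integral_hyperbolicControl_mid (hl : 0 ≤ l) (hq : q ≠ 0) (hw : 0 < 1 + (r - l) / q) {x : ℝ}
    (hlx : l ≤ x) (hxr : x ≤ r) :
    ∫ y in (0 : ℝ)..x, hyperbolicControl l r q ν y = (ν + 1) / 2 * Real.log (1 + (x - l) / q) := by
  rw [← intervalIntegral.integral_add_adjacent_intervals
    (intervalIntegrable_hyperbolicControl hq hw 0 l)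
    (intervalIntegrable_hyperbolicControl hq hw l x), integral_hyperbolicControl_left hl le_rfl,
    zero_add, intervalIntegral.integral_congr_Ioo_of_le
      (g := fun y => (ν + 1) / 2 * (1 / q / (1 + (y - l) / q))) hlx]
  · rw [intervalIntegral.integral_eq_sub_of_hasDerivAt
      (f := fun y => (ν + 1) / 2 * Real.log (1 + (y - l) / q))]
    · simp
    · intro y hy
      rw [uIcc_of_le hlx] at hy
      exact ((hasDerivAt_one_add_div y).log
        (one_add_div_pos hw hy.1 (hy.2.trans hxr)).ne').const_mul _
    · refine ContinuousOn.intervalIntegrable ?_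
      rw [uIcc_of_le hlx]
      refine continuousOn_const.mul (continuousOn_const.div ?_ ?_)
      · fun_prop
      exact fun y hy => (one_add_div_pos hw hy.1 (hy.2.trans hxr)).ne'
  · intro y hy
    have hy0 : 0 < y := hl.trans_lt hy.1
    have := one_add_div_pos hw hy.1.le (hy.2.le.trans hxr)
    simp only [hyperbolicControl, abs_of_pos hy0]
    rw [if_pos ⟨hy.1.le, hy.2.trans_le hxr⟩]
    field_simp

lemma integral_hyperbolicControl_right (hl : 0 ≤ l) (hlr : l ≤ r) (hq : q ≠ 0)
    (hw : 0 < 1 + (r - l) / q) {x : ℝ} (hrx : r ≤ x) :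
    ∫ y in (0 : ℝ)..x, hyperbolicControl l r q ν y = (ν + 1) / 2 * Real.log (1 + (r - l) / q) := by
  rw [← intervalIntegral.integral_add_adjacent_intervals
    (intervalIntegrable_hyperbolicControl hq hw 0 r)
    (intervalIntegrable_hyperbolicControl hq hw r x),
    integral_hyperbolicControl_mid hl hq hw hlr le_rfl,
    intervalIntegral.integral_congr_Ioo_of_le (g := fun _ => (0 : ℝ)) hrx]
  · simp
  · intro y hy
    exact hyperbolicControl_of_le (hy.1.le.trans (le_abs_self y))

lemma exp_neg_two_mul_log {w : ℝ} (hw : 0 < w) :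
    Real.exp (-2 * ((ν + 1) / 2 * Real.log w)) = w ^ (-(ν + 1)) := by
  rw [Real.rpow_def_of_pos hw]; congr 1; ring

lemma gFun_hyperbolicControl_left {x : ℝ} (hx0 : 0 ≤ x) (hxl : x ≤ l) :
    gFun (hyperbolicControl l r q ν) x = 1 := by
  rw [gFun_of_nonneg _ hx0, integral_hyperbolicControl_left hx0 hxl]; simp

lemma gFun_hyperbolicControl_mid (hl : 0 ≤ l) (hq : q ≠ 0) (hw : 0 < 1 + (r - l) / q) {x : ℝ}
    (hlx : l ≤ x) (hxr : x ≤ r) :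
    gFun (hyperbolicControl l r q ν) x = (1 + (x - l) / q) ^ (-(ν + 1)) := by
  rw [gFun_of_nonneg _ (hl.trans hlx), integral_hyperbolicControl_mid hl hq hw hlx hxr,
    exp_neg_two_mul_log (one_add_div_pos hw hlx hxr)]

lemma gFun_hyperbolicControl_right (hl : 0 ≤ l) (hlr : l ≤ r) (hq : q ≠ 0)
    (hw : 0 < 1 + (r - l) / q) {x : ℝ} (hrx : r ≤ x) :
    gFun (hyperbolicControl l r q ν) x = (1 + (r - l) / q) ^ (-(ν + 1)) := by
  rw [gFun_of_nonneg _ (hl.trans (hlr.trans hrx)),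
    integral_hyperbolicControl_right hl hlr hq hw hrx, exp_neg_two_mul_log hw]

lemma intervalIntegrable_gFun' {c : ℝ → ℝ} (hc : ∀ x y, IntervalIntegrable c volume x y)
    {x y : ℝ} (hx : 0 ≤ x) (hxy : x ≤ y) : IntervalIntegrable (gFun c) volume x y :=
  intervalIntegrable_sub (intervalIntegrable_gFun (hx.trans hxy) (hc 0 y))
    ⟨hx, hxy⟩ ⟨hx.trans hxy, le_rfl⟩

lemma gInt_hyperbolicControl_left {x : ℝ} (hx0 : 0 ≤ x) (hxl : x ≤ l) :
    gInt (hyperbolicControl l r q ν) x = x := by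
  rw [gInt, intervalIntegral.integral_congr (g := fun _ => (1 : ℝ))]
  · simp
  · intro y hy
    rw [uIcc_of_le hx0] at hy
    exact gFun_hyperbolicControl_left hy.1 (hy.2.trans hxl)

lemma hasDerivAt_one_add_div_rpow (e : ℝ) {x : ℝ} (hx : 0 < 1 + (x - l) / q) :
    HasDerivAt (fun x => (1 + (x - l) / q) ^ e) (e / q * (1 + (x - l) / q) ^ (e - 1)) x := by
  convert! (hasDerivAt_one_add_div x).rpow_const (p := e) (Or.inl hx.ne') using 1
  ring

lemma integral_one_add_div_rpow (hq : q ≠ 0) (hw : 0 < 1 + (r - l) / q) {e x : ℝ} (he : e ≠ 0)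
    (hlx : l ≤ x) (hxr : x ≤ r) :
    ∫ y in l..x, (1 + (y - l) / q) ^ (e - 1) = q / e * ((1 + (x - l) / q) ^ e - 1) := by
  rw [intervalIntegral.integral_eq_sub_of_hasDerivAt
    (f := fun y => q / e * (1 + (y - l) / q) ^ e)]
  · simp; ring
  · intro y hy
    rw [uIcc_of_le hlx] at hy
    convert! (hasDerivAt_one_add_div_rpow e
      (one_add_div_pos hw hy.1 (hy.2.trans hxr))).const_mul (q / e) using 1
    field_simp
  · refine ContinuousOn.intervalIntegrable ?_
    rw [uIcc_of_le hlx]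
    refine ContinuousOn.rpow_const (by fun_prop) fun y hy => Or.inl ?_
    exact (one_add_div_pos hw hy.1 (hy.2.trans hxr)).ne'

lemma gInt_hyperbolicControl_mid (hl : 0 ≤ l) (hq : q ≠ 0) (hL : L ≠ 0) (hν : ν = q / L)
    (hw : 0 < 1 + (r - l) / q) {x : ℝ} (hlx : l ≤ x) (hxr : x ≤ r) :
    gInt (hyperbolicControl l r q ν) x = l + L * (1 - (1 + (x - l) / q) ^ (-ν)) := by
  have hi := intervalIntegrable_hyperbolicControl (ν := ν) hq hw
  have hν0 : -ν ≠ 0 := by rw [hν]; exact neg_ne_zero.2 (div_ne_zero hq hL)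
  have h1 := gInt_hyperbolicControl_left (r := r) (q := q) (ν := ν) hl le_rfl
  rw [gInt] at h1 ⊢
  rw [← intervalIntegral.integral_add_adjacent_intervals
    (intervalIntegrable_gFun' hi le_rfl hl) (intervalIntegrable_gFun' hi hl hlx), h1,
    intervalIntegral.integral_congr (a := l) (g := fun y => (1 + (y - l) / q) ^ (-ν - 1)),
    integral_one_add_div_rpow hq hw hν0 hlx hxr]
  · have : q / -ν = -L := by rw [hν]; field_simp
    rw [this]; ring
  · intro y hy
    rw [uIcc_of_le hlx] at hy
    simp only [gFun_hyperbolicControl_mid hl hq hw hy.1 (hy.2.trans hxr)]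
    congr 1; ring

lemma gInt_hyperbolicControl_right (hl : 0 ≤ l) (hlr : l ≤ r) (hq : q ≠ 0) (hL : L ≠ 0)
    (hν : ν = q / L) (hw : 0 < 1 + (r - l) / q) {x : ℝ} (hrx : r ≤ x) :
    gInt (hyperbolicControl l r q ν) x = l + L * (1 - (1 + (r - l) / q) ^ (-ν))
      + (1 + (r - l) / q) ^ (-(ν + 1)) * (x - r) := by
  have hi := intervalIntegrable_hyperbolicControl (ν := ν) hq hw
  have h1 := gInt_hyperbolicControl_mid hl hq hL hν hw hlr le_rfl
  rw [gInt] at h1 ⊢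
  rw [← intervalIntegral.integral_add_adjacent_intervals
    (intervalIntegrable_gFun' hi le_rfl (hl.trans hlr))
    (intervalIntegrable_gFun' hi (hl.trans hlr) hrx), h1,
    intervalIntegral.integral_congr (a := r) (g := fun _ => (1 + (r - l) / q) ^ (-(ν + 1)))]
  · simp; ring
  · intro y hy
    rw [uIcc_of_le hrx] at hy
    exact gFun_hyperbolicControl_right hl hlr hq hw hy.1

lemma rpow_neg_add_one_mul {w : ℝ} (hw : 0 < w) (ν : ℝ) : w ^ (-(ν + 1)) * w = w ^ (-ν) := by
  nth_rewrite 2 [← Real.rpow_one w]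
  rw [← Real.rpow_add hw]; congr 1; ring

/-- With `ν = q / L`, the integral of `g` up to `r` falls short of `l + L` by `L w^(-ν)`. Beyond
`r`, `g` is the constant `w^(-(ν + 1))`, so a stretch of length `w L` supplies exactly that. -/
lemma aVal_hyperbolicControl (hl : 0 ≤ l) (hlr : l ≤ r) (hq : q ≠ 0) (hL : 0 < L)
    (hν : ν = q / L) (hw : 0 < 1 + (r - l) / q) :
    aVal (r + (1 + (r - l) / q) * L) (hyperbolicControl l r q ν) = 2 * (l + L) := by
  rw [aVal_eq_gInt, gInt_hyperbolicControl_right hl hlr hq hL.ne' hν hw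
    (by have := mul_pos hw hL; linarith), ← rpow_neg_add_one_mul hw ν]
  ring

lemma isAdmissible_hyperbolicControl (hl : 0 ≤ l) (hlr : l ≤ r) (hq : q ≠ 0) (hL : 0 < L)
    (hν : ν = q / L) (hw : 0 < 1 + (r - l) / q) (hc : 0 ≤ (ν + 1) / q) :
    IsAdmissible (2 * (l + L)) (r + (1 + (r - l) / q) * L) (hyperbolicControl l r q ν) where
  pos := by have := mul_pos hw hL; linarith
  nonneg := hyperbolicControl_nonneg hq hw hc
  even := hyperbolicControl_neg
  measurable := measurable_hyperbolicControl
  bounded := ⟨_, fun x => (le_abs_self _).trans (abs_hyperbolicControl_le hq hw x)⟩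
  support := ⟨r, fun _ => hyperbolicControl_of_le⟩
  aVal_eq := aVal_hyperbolicControl hl hlr hq hL hν hw

/-- The residual is affine on each of the three pieces. On `[l, r]` both `v` and `g` are powers of
`1 + (x - l)/q`, with quotient `L / (l + L)` times its first power. -/
lemma etaVal_hyperbolicControl (hl : 0 ≤ l) (hlr : l ≤ r) (hq : q ≠ 0) (hL : 0 < L)
    (hν : ν = q / L) (hw : 0 < 1 + (r - l) / q) (γ : ℝ) :
    etaVal γ (r + (1 + (r - l) / q) * L) (hyperbolicControl l r q ν)
      = 1 / (l + L) * ((1 + γ / (l + L)) ^ 2 * (l ^ 3 / 3)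
        + (∫ x in l..r, (x + γ - γ * L / (l + L) * (1 + (x - l) / q)) ^ 2
            * (1 + (x - l) / q) ^ (-(ν + 1)))
        + (1 + (r - l) / q) ^ (-(ν + 1)) * ∫ y in (0 : ℝ)..(1 + (r - l) / q) * L,
            (r + γ - γ * L / (l + L) * (1 + (r - l) / q) + (1 + γ / (l + L)) * y) ^ 2) := by
  have hi := intervalIntegrable_hyperbolicControl (ν := ν) hq hw
  have hwL := mul_pos hw hL
  have hr : 0 ≤ r := hl.trans hlr
  set w := 1 + (r - l) / q with hwdef
  have hrb : r ≤ r + w * L := by linarith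
  have hb : 0 ≤ r + w * L := hr.trans hrb
  have hlL : 0 < l + L := by linarith
  rw [etaVal_eq hb (hi 0 _), aVal_hyperbolicControl hl hlr hq hL hν hw]
  have hI : IntervalIntegrable (etaIntegrand γ (2 * (l + L)) (hyperbolicControl l r q ν))
      volume 0 (r + w * L) :=
    ContinuousOn.intervalIntegrable (by
      rw [uIcc_of_le hb]; exact continuousOn_etaIntegrand hb (hi 0 _) γ _)
  have h0 : (0 : ℝ) ∈ Icc 0 (r + w * L) := ⟨le_rfl, hb⟩
  have hlm : l ∈ Icc 0 (r + w * L) := ⟨hl, hlr.trans hrb⟩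
  have hrm : r ∈ Icc 0 (r + w * L) := ⟨hr, hrb⟩
  have hbm : r + w * L ∈ Icc 0 (r + w * L) := ⟨hb, le_rfl⟩
  rw [← intervalIntegral.integral_add_adjacent_intervals (intervalIntegrable_sub hI h0 hrm)
      (intervalIntegrable_sub hI hrm hbm),
    ← intervalIntegral.integral_add_adjacent_intervals (intervalIntegrable_sub hI h0 hlm)
      (intervalIntegrable_sub hI hlm hrm)]
  have e1 : ∫ x in (0 : ℝ)..l, etaIntegrand γ (2 * (l + L)) (hyperbolicControl l r q ν) x
      = (1 + γ / (l + L)) ^ 2 * (l ^ 3 / 3) := by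
    rw [intervalIntegral.integral_congr (g := fun x => (1 + γ / (l + L)) ^ 2 * x ^ 2)]
    · simp; left; norm_num
    · intro x hx
      rw [uIcc_of_le hl] at hx
      simp only [etaIntegrand, gInt_hyperbolicControl_left hx.1 hx.2,
        gFun_hyperbolicControl_left hx.1 hx.2]
      field_simp
      ring
  have e2 : ∫ x in l..r, etaIntegrand γ (2 * (l + L)) (hyperbolicControl l r q ν) x
      = ∫ x in l..r, (x + γ - γ * L / (l + L) * (1 + (x - l) / q)) ^ 2
            * (1 + (x - l) / q) ^ (-(ν + 1)) := by
    refine intervalIntegral.integral_congr fun x hx => ?_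
    rw [uIcc_of_le hlr] at hx
    have hwx := one_add_div_pos hw hx.1 hx.2
    simp only [etaIntegrand, gInt_hyperbolicControl_mid hl hq hL.ne' hν hw hx.1 hx.2,
        gFun_hyperbolicControl_mid hl hq hw hx.1 hx.2, ← rpow_neg_add_one_mul hwx ν]
    set W := 1 + (x - l) / q
    have hW := Real.rpow_pos_of_pos hwx (-(ν + 1))
    congr 2
    field_simp
    ring
  have e3 : ∫ x in r..(r + w * L), etaIntegrand γ (2 * (l + L)) (hyperbolicControl l r q ν) x
      = w ^ (-(ν + 1)) * ∫ y in (0 : ℝ)..w * L,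
            (r + γ - γ * L / (l + L) * w + (1 + γ / (l + L)) * y) ^ 2 := by
    have h := intervalIntegral.integral_comp_sub_right (a := r) (b := r + w * L)
      (fun y => (r + γ - γ * L / (l + L) * w + (1 + γ / (l + L)) * y) ^ 2) r
    rw [sub_self, add_sub_cancel_left] at h
    rw [← h, ← intervalIntegral.integral_const_mul]
    refine intervalIntegral.integral_congr fun x hx => ?_
    rw [uIcc_of_le hrb] at hx
    simp only [etaIntegrand, gInt_hyperbolicControl_right hl hlr hq hL.ne' hν hw hx.1,
        gFun_hyperbolicControl_right hl hlr hq hw hx.1, ← hwdef, ← rpow_neg_add_one_mul hw ν]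
    have hW := Real.rpow_pos_of_pos hw (-(ν + 1))
    rw [mul_comm]
    congr 2
    field_simp
    ring
  rw [e1, e2, e3]
  congr 1
  field_simp

end Hyperbolic
end

noncomputable section

/-! ### The explicit minimizing sequence -/

/-! ### Evaluation and estimates of the variance for hyperbolic and zero controls. -/

section ClosedForms

variable {l r q ν L γ : ℝ}

lemma sq_mul_rpow {w : ℝ} (hw : 0 < w) (ν : ℝ) : w ^ 2 * w ^ (-(ν + 1)) = w ^ (2 - ν - 1) := by
  rw [← Real.rpow_natCast, ← Real.rpow_add hw]; congr 1; push_cast; ring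

lemma cube_mul_rpow {w : ℝ} (hw : 0 < w) (ν : ℝ) : w ^ (-(ν + 1)) * w ^ 3 = w ^ (2 - ν) := by
  rw [← Real.rpow_natCast, ← Real.rpow_add hw]; congr 1; push_cast; ring

/-- For `q = γ + l` one has `x + γ = q w(x)`, so the residual on `[l, r]` is a multiple of `l w(x)`.
A logarithm could appear only for `ν = 2`, and there the prefactor `l²` has to vanish. -/
lemma etaVal_hyperbolicControl_closed (hl : 0 ≤ l) (hlr : l ≤ r) (hq : q ≠ 0) (hL : 0 < L)
    (hν : ν = q / L) (hw : 0 < 1 + (r - l) / q) (hqγ : q = γ + l) (hν2 : l = 0 ∨ ν ≠ 2) :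
    etaVal γ (r + (1 + (r - l) / q) * L) (hyperbolicControl l r q ν)
      = (1 + γ / (l + L)) ^ 2 / (l + L) * (l ^ 3 / 3
        + l ^ 2 * (q / (2 - ν) * ((1 + (r - l) / q) ^ (2 - ν) - 1))
        + (1 + (r - l) / q) ^ (2 - ν) * (l ^ 2 * L + l * L ^ 2 + L ^ 3 / 3)) := by
  rw [etaVal_hyperbolicControl hl hlr hq hL hν hw]
  have hS : 0 < l + L := by linarith
  have hlin : ∀ x, x + γ - γ * L / (l + L) * (1 + (x - l) / q)
      = (1 + γ / (l + L)) * l * (1 + (x - l) / q) := by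
    intro x
    have : γ = q - l := by linarith
    rw [this]; field_simp; ring
  have e1 : ∫ x in l..r, (x + γ - γ * L / (l + L) * (1 + (x - l) / q)) ^ 2
            * (1 + (x - l) / q) ^ (-(ν + 1))
      = (1 + γ / (l + L)) ^ 2 * (l ^ 2 * (q / (2 - ν) * ((1 + (r - l) / q) ^ (2 - ν) - 1))) := by
    have h1 : ∫ x in l..r, (x + γ - γ * L / (l + L) * (1 + (x - l) / q)) ^ 2
            * (1 + (x - l) / q) ^ (-(ν + 1))
        = ∫ x in l..r, (1 + γ / (l + L)) ^ 2 * (l ^ 2 * (1 + (x - l) / q) ^ (2 - ν - 1)) := by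
      refine intervalIntegral.integral_congr fun x hx => ?_
      rw [uIcc_of_le hlr] at hx
      have hwx := one_add_div_pos hw hx.1 hx.2
      simp only [hlin, ← sq_mul_rpow hwx ν]
      ring
    rw [h1]
    rcases hν2 with rfl | h
    · simp
    · rw [intervalIntegral.integral_const_mul, intervalIntegral.integral_const_mul,
        integral_one_add_div_rpow hq hw (sub_ne_zero.2 h.symm) hlr le_rfl]
  rw [e1, hlin r]
  set w := 1 + (r - l) / q with hwdef
  have e2 : ∫ y in (0 : ℝ)..w * L,
            ((1 + γ / (l + L)) * l * w + (1 + γ / (l + L)) * y) ^ 2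
      = (1 + γ / (l + L)) ^ 2 * (w ^ 3 * (l ^ 2 * L + l * L ^ 2 + L ^ 3 / 3)) := by
    rw [intervalIntegral.integral_eq_sub_of_hasDerivAt
      (f := fun y => (1 + γ / (l + L)) ^ 2 * ((l * w + y) ^ 3 / 3))]
    · ring
    · intro y _
      convert! ((((hasDerivAt_id y).const_add (l * w)).pow 3).div_const 3).const_mul
        ((1 + γ / (l + L)) ^ 2) using 1
      simp; ring
    · exact Continuous.intervalIntegrable (by fun_prop) _ _
  rw [e2, ← cube_mul_rpow hw ν]
  ring

/-- The case `a = γ`, where `ψ < 1`. -/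
lemma etaVal_hyperbolicControl_le (hγ : 0 < γ) (hr : 0 ≤ r) (hqγ : γ < q) (hν : ν = q / (γ / 2)) :
    etaVal γ (r + (1 + r / q) * (γ / 2)) (hyperbolicControl 0 r q ν)
      ≤ 2 / γ * ((q - γ) ^ 2 * (q / (ν - 2))
        + (1 + r / q) ^ (2 - ν) * (((q - γ) + 3 * γ / 2) ^ 2 * (γ / 2))) := by
  have hq : 0 < q := hγ.trans hqγ
  have hw : 0 < 1 + (r - 0) / q := by rw [sub_zero]; positivity
  have hν2 : 2 < ν := by rw [hν, lt_div_iff₀ (by positivity)]; linarith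
  have h := etaVal_hyperbolicControl le_rfl hr hq.ne' (half_pos hγ) hν hw γ
  have hK : (1 : ℝ) + γ / (γ / 2) = 3 := by field_simp; norm_num
  have hK' : γ * (γ / 2) / (γ / 2) = γ := by field_simp
  simp only [zero_add, sub_zero, hK, hK'] at h hw
  rw [h]
  -- The mismatch `q - γ` leaves a small residual, bounded below by replacing `w(x) - 1` with
  -- `w(x)`; the resulting power is integrable up to infinity because `ν > 2`.
  have hlin : ∀ x, x + γ - γ * (1 + x / q) = (q - γ) * ((1 + x / q) - 1) := by
    intro x; field_simp; ring
  set w := 1 + r / q with hwdef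
  have hw1 : 1 ≤ w := by rw [hwdef]; linarith [div_nonneg hr hq.le]
  have hδ : 0 < q - γ := by linarith
  have hpos : ∀ x ∈ Icc 0 r, 0 < 1 + x / q := fun x hx => by
    have := div_nonneg hx.1 hq.le; linarith
  have hcont : ∀ e : ℝ, ContinuousOn (fun x : ℝ => (1 + x / q) ^ e) (uIcc 0 r) := by
    intro e
    rw [uIcc_of_le hr]
    exact ContinuousOn.rpow_const (by fun_prop) fun x hx => Or.inl (hpos x hx).ne'
  have e1 : ∫ x in (0 : ℝ)..r, (x + γ - γ * (1 + x / q)) ^ 2 * (1 + x / q) ^ (-(ν + 1))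
      ≤ (q - γ) ^ 2 * (q / (ν - 2)) := by
    calc ∫ x in (0 : ℝ)..r, (x + γ - γ * (1 + x / q)) ^ 2 * (1 + x / q) ^ (-(ν + 1))
        ≤ ∫ x in (0 : ℝ)..r, (q - γ) ^ 2 * (1 + x / q) ^ (2 - ν - 1) := by
          refine intervalIntegral.integral_mono_on hr ?_ ?_ fun x hx => ?_
          · exact (ContinuousOn.mul (by fun_prop) (hcont _)).intervalIntegrable
          · exact (continuousOn_const.mul (hcont _)).intervalIntegrable
          · have hp := hpos x hx
            rw [hlin, mul_pow, ← sq_mul_rpow hp ν, mul_assoc]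
            have := Real.rpow_pos_of_pos hp (-(ν + 1))
            have : 0 ≤ x / q := div_nonneg hx.1 hq.le
            gcongr <;> linarith
      _ = (q - γ) ^ 2 * (q / (2 - ν) * (w ^ (2 - ν) - 1)) := by
          rw [intervalIntegral.integral_const_mul]
          have := integral_one_add_div_rpow (l := 0) (r := r) (x := r) (e := 2 - ν) hq.ne'
            (by simpa using hw) (by linarith) hr le_rfl
          simp only [sub_zero] at this
          rw [this]
      _ ≤ _ := by
          have h1 : q / (2 - ν) * (w ^ (2 - ν) - 1) = q / (ν - 2) * (1 - w ^ (2 - ν)) := by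
            have h3 : (2 - ν) ≠ 0 := by linarith
            have h4 : (ν - 2) ≠ 0 := by linarith
            field_simp; ring
          have h2 := Real.rpow_pos_of_pos hw (2 - ν)
          have h3 : 0 < q / (ν - 2) := div_pos hq (by linarith)
          rw [h1]
          gcongr
          nlinarith
  have e2 : ∫ y in (0 : ℝ)..w * (γ / 2), (r + γ - γ * w + 3 * y) ^ 2
      ≤ w ^ 3 * (((q - γ) + 3 * γ / 2) ^ 2 * (γ / 2)) := by
    have hb : 0 ≤ w * (γ / 2) := by positivity
    calc ∫ y in (0 : ℝ)..w * (γ / 2), (r + γ - γ * w + 3 * y) ^ 2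
        ≤ ∫ _ in (0 : ℝ)..w * (γ / 2), (w * ((q - γ) + 3 * γ / 2)) ^ 2 := by
          refine intervalIntegral.integral_mono_on hb
            (Continuous.intervalIntegrable (by fun_prop) _ _) intervalIntegrable_const
            fun y hy => ?_
          rw [hwdef, hlin, ← hwdef]
          have h1 : 0 ≤ w - 1 := by linarith
          have h2 := hy.1
          gcongr
          nlinarith [hy.2]
      _ = _ := by simp; ring
  rw [← cube_mul_rpow hw ν]
  have hS : 1 / (γ / 2) = 2 / γ := by field_simp
  rw [hS]
  have h3 := Real.rpow_pos_of_pos hw (-(ν + 1))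
  have h4 : (0 : ℝ) ^ 3 / 3 = 0 := by norm_num
  rw [h4, mul_zero, zero_add, mul_assoc (w ^ (-(ν + 1)))]
  gcongr

end ClosedForms

/-- The degenerate hyperbolic control with `l = r = 0`; the choice `q = 1` is arbitrary. -/
lemma etaVal_zero_control {a : ℝ} (ha : 0 < a) (γ : ℝ) :
    etaVal γ (a / 2) (fun _ => 0) = (a + 2 * γ) ^ 2 / 12 := by
  have h := etaVal_hyperbolicControl (l := 0) (r := 0) (q := 1) (ν := 1 / (a / 2)) (L := a / 2)
    le_rfl le_rfl one_ne_zero (half_pos ha) rfl (by simp) γ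
  have hc : hyperbolicControl 0 0 1 (1 / (a / 2)) = fun _ => 0 := by
    funext x; exact hyperbolicControl_of_le (abs_nonneg x)
  rw [hc] at h
  simp only [sub_self, zero_div, add_zero, one_mul, zero_add] at h
  rw [h]
  have h2 : γ * (a / 2) / (a / 2) = γ := by field_simp
  simp only [h2, mul_one, sub_self, zero_add, Real.one_rpow, one_mul, mul_pow,
    intervalIntegral.integral_const_mul, intervalIntegral.integral_same, integral_pow]
  field_simp
  norm_num
  ring

lemma isAdmissible_zero_control {a : ℝ} (ha : 0 < a) : IsAdmissible a (a / 2) (fun _ => 0) where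
  pos := half_pos ha
  nonneg _ := le_rfl
  even _ := rfl
  measurable := measurable_const
  bounded := ⟨0, fun _ => le_rfl⟩
  support := ⟨0, fun _ _ => rfl⟩
  aVal_eq := by simp [aVal, gFun]; ring

/-! ### The explicit sequence in each range of `a / γ`. -/

section Sequence

variable {φ : ℕ → ℝ → ℝ} {γ a : ℝ} {n : ℕ}

/-- The explicit sequence consists, eventually, of admissible controls and is minimizing. -/
structure IsMinimizing (γ a : ℝ) (b : ℕ → ℝ) (c : ℕ → ℝ → ℝ) : Prop where
  admissible : ∀ᶠ n in atTop, IsAdmissible a (b n) (c n)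
  tendsto : Tendsto (fun n => etaVal γ (b n) (c n)) atTop (𝓝 (etaMin γ a))

/-- Factoring `ψ` out of `γ + ψ |x|` turns `ψ` into the shift `q = γ/ψ + l`. The constant in `cSeq`
is then the one matching `ν = q / L` with `L = a/2 - l`. -/
lemma cSeq_eq_hyperbolicControl {ψ l r q ν : ℝ} (hψ : psiSeq φ γ a n = ψ) (hψ0 : ψ ≠ 0)
    (hl : lVal γ a = l) (hr : rSeq γ a n = r) (hL : a / 2 - l ≠ 0)
    (hq : q = γ / ψ + l) (hν : ν = q / (a / 2 - l)) :
    cSeq φ γ a n = hyperbolicControl l r q ν := by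
  funext x
  rw [cSeq, hyperbolicControl, hψ, hl, hr]
  refine if_congr Iff.rfl ?_ rfl
  have hL' : a - 2 * l ≠ 0 := by intro h; apply hL; linarith
  have e : q + (|x| - l) = (γ + ψ * |x|) / ψ := by rw [hq]; field_simp; ring
  have e2 : ν + 1 = (a * ψ + 2 * γ) / (ψ * (a - 2 * l)) := by
    have : a / 2 - l = (a - 2 * l) / 2 := by ring
    rw [hν, hq, this]
    have ha : a = (a - 2 * l) + 2 * l := by ring
    generalize a - 2 * l = D at hL' ha ⊢
    rw [ha]; field_simp; ring
  rw [e, e2]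
  field_simp

lemma bSeq_eq {ψ l r q : ℝ} (hγ : γ ≠ 0) (hψ : psiSeq φ γ a n = ψ) (hψ0 : ψ ≠ 0)
    (hl : lVal γ a = l) (hr : rSeq γ a n = r) (hq : q = γ / ψ + l) (hq0 : q ≠ 0) :
    bSeq φ γ a n = r + (1 + (r - l) / q) * (a / 2 - l) := by
  rw [bSeq, if_neg hγ, hψ, hl, hr]
  have e1 : γ + ψ * l = ψ * q := by rw [hq]; field_simp
  have e2 : γ + ψ * r = ψ * (q + (r - l)) := by rw [hq]; field_simp; ring
  rw [e1, e2]
  congr 2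
  field_simp

lemma lVal_of_le (h : a / γ ≤ 1) : lVal γ a = 0 := by
  rw [lVal, max_eq_right (by linarith)]; simp

lemma rSeq_of_neg (h : 2 * γ ≤ a) : rSeq γ a n = lVal γ a
    + |γ| * (min (1 - 1 / (n : ℝ)) (max (-(2 * γ + a)) 0)) ^ (1 / (n : ℝ)) := by
  rw [rSeq, max_eq_right (a := 2 * γ - a) (by linarith)]; ring

/-- The case `n = 0` is excluded because there the exponent `1 / n` is `0` and `0 ^ 0 = 1`. -/
lemma rSeq_of_pos (hn : 1 ≤ n) (h : 0 ≤ 2 * γ + a) : rSeq γ a n = lVal γ a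
    + max (2 * γ - a) 0 * Real.exp ((n : ℝ) ^ 2) := by
  have hn' : (1 : ℝ) ≤ n := by exact_mod_cast hn
  have h1 : 0 ≤ 1 - 1 / (n : ℝ) := by
    rw [sub_nonneg, div_le_one (by linarith)]; exact hn'
  rw [rSeq, max_eq_right (a := -(2 * γ + a)) (by linarith), min_eq_right h1,
    Real.zero_rpow (by positivity)]
  ring

lemma eventually_psiSeq_eq_one
    (hφ : ∀ n : ℕ, 1 ≤ n → ∀ x, 1 / (n : ℝ) ≤ |x - 1| → φ n x = 1) (h : a ≠ γ) :
    ∀ᶠ n in atTop, psiSeq φ γ a n = 1 := by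
  by_cases hγ : γ = 0
  · simp [psiSeq, hγ]
  have hpos : 0 < |a / γ - 1| := by
    rw [abs_pos, sub_ne_zero, ne_eq, div_eq_one_iff_eq hγ]; exact h
  filter_upwards [tendsto_one_div_atTop_nhds_zero_nat.eventually (Iio_mem_nhds hpos),
    eventually_ge_atTop 1] with n h1 h2
  rw [psiSeq, if_neg hγ]
  exact hφ n h2 _ (le_of_lt h1)

lemma IsMinimizing.congr {b : ℕ → ℝ} {c : ℕ → ℝ → ℝ} {b' : ℕ → ℝ} {c' : ℕ → ℝ → ℝ}
    (h : IsMinimizing γ a b c) (hb : ∀ᶠ n in atTop, b' n = b n ∧ c' n = c n) :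
    IsMinimizing γ a b' c' where
  admissible := by
    filter_upwards [h.admissible, hb] with n h1 h2
    rwa [h2.1, h2.2]
  tendsto := h.tendsto.congr' (by
    filter_upwards [hb] with n h2
    rw [h2.1, h2.2])

lemma isMinimizing_zero_control (ha : 0 < a) (h : etaMin γ a = (a + 2 * γ) ^ 2 / 12) :
    IsMinimizing γ a (fun _ => a / 2) (fun _ _ => 0) where
  admissible := Eventually.of_forall fun _ => isAdmissible_zero_control ha
  tendsto := by simp only [etaVal_zero_control ha, h, tendsto_const_nhds_iff]

lemma etaMin_of_eta2 (hγ : γ ≠ 0) (h : etaDagger (a / γ) = eta2 (a / γ)) :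
    etaMin γ a = (a + 2 * γ) ^ 2 / 12 := by
  rw [etaMin, if_neg hγ, h, sq_abs, eta2]; field_simp

/-- For `ψ = 1`, the sequence is minimizing as soon as `(1 + (r_n - l) / q) ^ (2 - ν) → 0`. -/
lemma isMinimizing_hyperbolicControl {l q ν : ℝ} {r : ℕ → ℝ} (hl : 0 ≤ l) (hL : 0 < a / 2 - l)
    (hq : q ≠ 0) (hν : ν = q / (a / 2 - l)) (hqγ : q = γ + l) (hν2 : l = 0 ∨ ν ≠ 2)
    (hc : 0 ≤ (ν + 1) / q)
    (hr : ∀ᶠ n in atTop, l ≤ r n) (hw : ∀ᶠ n in atTop, 0 < 1 + (r n - l) / q)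
    (hlim : Tendsto (fun n => (1 + (r n - l) / q) ^ (2 - ν)) atTop (𝓝 0))
    (hval : etaMin γ a
      = (1 + γ / (a / 2)) ^ 2 / (a / 2) * (l ^ 3 / 3 + l ^ 2 * (q / (2 - ν) * (0 - 1)))) :
    IsMinimizing γ a (fun n => r n + (1 + (r n - l) / q) * (a / 2 - l))
      (fun n => hyperbolicControl l (r n) q ν) where
  admissible := by
    filter_upwards [hr, hw] with n h1 h2
    have := isAdmissible_hyperbolicControl hl h1 hq hL hν h2 hc
    rwa [show 2 * (l + (a / 2 - l)) = a by ring] at this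
  tendsto := by
    have h1 : Tendsto (fun n => (1 + γ / (a / 2)) ^ 2 / (a / 2) * (l ^ 3 / 3
        + l ^ 2 * (q / (2 - ν) * ((1 + (r n - l) / q) ^ (2 - ν) - 1))
        + (1 + (r n - l) / q) ^ (2 - ν) * (l ^ 2 * (a / 2 - l) + l * (a / 2 - l) ^ 2
          + (a / 2 - l) ^ 3 / 3))) atTop (𝓝 (etaMin γ a)) := by
      have h2 := ((((hlim.sub_const 1).const_mul (q / (2 - ν))).const_mul (l ^ 2)).const_add
        (l ^ 3 / 3)).add (hlim.mul_const (l ^ 2 * (a / 2 - l) + l * (a / 2 - l) ^ 2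
          + (a / 2 - l) ^ 3 / 3))
      have h3 := h2.const_mul ((1 + γ / (a / 2)) ^ 2 / (a / 2))
      rw [zero_mul, add_zero, ← hval] at h3
      exact h3
    refine h1.congr' ?_
    filter_upwards [hr, hw] with n h2 h3
    rw [etaVal_hyperbolicControl_closed hl h2 hq hL hν h3 hqγ hν2, add_sub_cancel]

lemma tendsto_exp_sq : Tendsto (fun n : ℕ => Real.exp ((n : ℝ) ^ 2)) atTop atTop :=
  Real.tendsto_exp_atTop.comp ((tendsto_pow_atTop two_ne_zero).comp tendsto_natCast_atTop_atTop)

/-- Here `r_n = l` eventually, so the control lives on an empty interval and `l` cancels from the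
boundary, provided that `γ + l ≠ 0`. -/
lemma isMinimizing_of_two_mul_le
    (hφ : ∀ n : ℕ, 1 ≤ n → ∀ x, 1 / (n : ℝ) ≤ |x - 1| → φ n x = 1) (ha : 0 < a) (hγ : γ ≠ 0)
    (h : 2 * |γ| ≤ a) : IsMinimizing γ a (bSeq φ γ a) (cSeq φ γ a) := by
  have h1 : 2 * γ ≤ a := by linarith [le_abs_self γ]
  have h2 : 0 ≤ 2 * γ + a := by linarith [neg_abs_le γ]
  have hne : a ≠ γ := by
    rcases lt_or_gt_of_ne hγ with h | h <;> linarith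
  have hmin : etaMin γ a = (a + 2 * γ) ^ 2 / 12 := by
    refine etaMin_of_eta2 hγ ?_
    rw [etaDagger]
    rcases lt_or_gt_of_ne hγ with h | h
    · rw [if_pos]
      rw [div_le_iff_of_neg h]; linarith
    · have : 2 ≤ a / γ := by rw [le_div_iff₀ h]; linarith
      rw [if_neg (by linarith), if_neg (by linarith), if_neg (by linarith)]
  refine (isMinimizing_zero_control ha hmin).congr ?_
  filter_upwards [eventually_psiSeq_eq_one hφ hne, eventually_ge_atTop 1] with n hψ hn
  have hr : rSeq γ a n = lVal γ a := by
    rw [rSeq_of_pos hn h2, max_eq_right (by linarith)]; simp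
  constructor
  · rw [bSeq, if_neg hγ, hr, hψ, div_self, one_mul]
    · ring
    · rw [lVal, if_neg hγ]
      rcases lt_or_gt_of_ne hγ with h | h
      · have : a / γ ≤ 0 := div_nonpos_of_nonneg_of_nonpos ha.le h.le
        rw [max_eq_right (by linarith)]; simpa using hγ
      · have : 2 ≤ a / γ := by rw [le_div_iff₀ h]; linarith
        rw [max_eq_left (by linarith)]
        -- For `a = 4γ`, division by zero yields `l = 0`, in agreement with the stated convention.
        by_cases h4 : 4 * γ - a = 0
        · rw [h4]; simpa using hγ
        · have : γ + 1 * (2 * γ ^ 2 * (a / γ - 1) / (4 * γ - a))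
              = γ * (2 * γ + a) / (4 * γ - a) := by
            have ha : a = 4 * γ - (4 * γ - a) := by ring
            generalize 4 * γ - a = D at h4 ha ⊢
            rw [ha]; field_simp; ring
          rw [this]
          exact div_ne_zero (mul_ne_zero hγ (by linarith)) h4
  · funext x
    rw [cSeq, if_neg]
    rw [hr]
    exact fun h => absurd h.1 (not_le.2 h.2)

lemma isMinimizing_of_eq_zero (ha : 0 < a) : IsMinimizing 0 a (bSeq φ 0 a) (cSeq φ 0 a) := by
  refine (isMinimizing_zero_control ha (by simp [etaMin])).congr ?_
  filter_upwards [eventually_ge_atTop 1] with n hn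
  refine ⟨by simp [bSeq], ?_⟩
  funext x
  have hr : rSeq 0 a n = lVal 0 a := by
    rw [rSeq_of_pos hn (by linarith), max_eq_right (by linarith)]; simp
  rw [cSeq, if_neg]
  rw [hr]
  exact fun h => absurd h.1 (not_le.2 h.2)

/-- For `n ≥ 2` the base lies between a fixed positive number and `1`, so the exponent `1/n` alone
forces the limit `1`. -/
lemma tendsto_min_rpow {d : ℝ} (hd : 0 < d) :
    Tendsto (fun n : ℕ => (min (1 - 1 / (n : ℝ)) d) ^ (1 / (n : ℝ))) atTop (𝓝 1) := by
  have hd' : 0 < min (1 / 2) d := lt_min (by norm_num) hd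
  have h0 : Tendsto (fun n : ℕ => (min (1 / 2) d) ^ (1 / (n : ℝ))) atTop (𝓝 1) := by
    have := (Real.continuousAt_const_rpow hd'.ne' (b := 0)).tendsto.comp
      tendsto_one_div_atTop_nhds_zero_nat
    simpa [Function.comp_def] using this
  refine tendsto_of_tendsto_of_tendsto_of_le_of_le' h0 tendsto_const_nhds ?_ ?_ <;>
  filter_upwards [eventually_ge_atTop 2] with n hn <;>
  have hn' : (2 : ℝ) ≤ n := by exact_mod_cast hn
  · have h1 : 1 / (n : ℝ) ≤ 1 / 2 := by gcongr
    refine Real.rpow_le_rpow hd'.le ?_ (by positivity)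
    exact min_le_min_right d (by linarith)
  · have h1 : 1 / (n : ℝ) ≤ 1 / 2 := by gcongr
    have h2 : (0 : ℝ) ≤ 1 / n := by positivity
    refine Real.rpow_le_one (le_min (by linarith) hd.le) ?_ h2
    exact (min_le_left _ _).trans (by linarith)

/-- With `q = γ < 0` the control has a pole at `|x| = |γ|`. The cap `1 - 1/n` keeps `r_n` short of
it, while `r_n → |γ|` drives `w(r_n)` to `0`. Since `ν < -1`, the exponent `2 - ν` is positive and
the tail vanishes; the control is nonnegative since `ν + 1` and `q` are both negative. -/
lemma isMinimizing_of_neg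
    (hφ : ∀ n : ℕ, 1 ≤ n → ∀ x, 1 / (n : ℝ) ≤ |x - 1| → φ n x = 1) (ha : 0 < a)
    (h : a < -(2 * γ)) : IsMinimizing γ a (bSeq φ γ a) (cSeq φ γ a) := by
  have hγ : γ < 0 := by linarith
  have hl : lVal γ a = 0 := lVal_of_le (by
    have := div_neg_of_pos_of_neg ha hγ; linarith)
  have hd : 0 < -(2 * γ + a) := by linarith
  have hr : ∀ n, rSeq γ a n = |γ| * (min (1 - 1 / (n : ℝ)) (-(2 * γ + a))) ^ (1 / (n : ℝ)) := by
    intro n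
    rw [rSeq_of_neg (by linarith), hl, max_eq_left hd.le, zero_add]
  have hw : ∀ n, 1 + (rSeq γ a n - 0) / γ
      = 1 - (min (1 - 1 / (n : ℝ)) (-(2 * γ + a))) ^ (1 / (n : ℝ)) := by
    intro n
    rw [hr, abs_of_neg hγ, sub_zero, neg_mul, neg_div, mul_div_cancel_left₀ _ hγ.ne]; ring
  obtain ⟨ν, hν⟩ : ∃ ν, ν = γ / (a / 2 - 0) := ⟨_, rfl⟩
  have hν1 : ν + 1 < 0 := by
    have : ν < -1 := by rw [hν, div_lt_iff₀ (by linarith)]; linarith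
    linarith
  have hlim := tendsto_min_rpow hd
  refine (isMinimizing_hyperbolicControl (r := rSeq γ a) (q := γ) le_rfl (by linarith) hγ.ne hν
    (by simp) (Or.inl rfl) (div_pos_of_neg_of_neg hν1 hγ).le ?_ ?_ ?_ ?_).congr ?_
  · filter_upwards [eventually_ge_atTop 1] with n hn
    have hn' : (1 : ℝ) ≤ n := by exact_mod_cast hn
    have h1 : 1 / (n : ℝ) ≤ 1 := by rw [div_le_one (by linarith)]; exact hn'
    rw [hr]
    exact mul_nonneg (abs_nonneg γ) (Real.rpow_nonneg (le_min (by linarith) hd.le) _)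
  · filter_upwards [eventually_ge_atTop 2] with n hn
    have hn' : (2 : ℝ) ≤ n := by exact_mod_cast hn
    have h1 : 1 / (n : ℝ) ≤ 1 / 2 := by gcongr
    have h2 : (0 : ℝ) < 1 / n := by positivity
    rw [hw, sub_pos]
    refine Real.rpow_lt_one (le_min (by linarith) hd.le) ?_ h2
    exact (min_le_left _ _).trans_lt (by linarith)
  · simp only [hw]
    have h1 := (hlim.const_sub 1).rpow_const (p := 2 - ν) (Or.inr (by linarith))
    rwa [sub_self, Real.zero_rpow (by linarith)] at h1
  · rw [etaMin, if_neg hγ.ne, etaDagger, if_neg, if_pos]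
    · simp
    · have := div_neg_of_pos_of_neg ha hγ; linarith
    · rw [div_le_iff_of_neg hγ]; linarith
  · filter_upwards [eventually_psiSeq_eq_one hφ (by linarith : γ < a).ne'] with n hψ
    exact ⟨bSeq_eq hγ.ne hψ one_ne_zero hl rfl (by simp) hγ.ne,
      cSeq_eq_hyperbolicControl hψ one_ne_zero hl rfl (by simpa using ha.ne') (by simp) hν⟩

lemma tendsto_one_add_mul_exp_sq_rpow {q κ e : ℝ} (hq : 0 < q) (hκ : 0 < κ) (he : e < 0) (l : ℝ) :
    Tendsto (fun n : ℕ => (1 + (l + κ * Real.exp ((n : ℝ) ^ 2) - l) / q) ^ e) atTop (𝓝 0) := by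
  have h1 : Tendsto (fun n : ℕ => 1 + (l + κ * Real.exp ((n : ℝ) ^ 2) - l) / q) atTop atTop := by
    refine tendsto_atTop_add_const_left _ _ ?_
    simp only [add_sub_cancel_left]
    exact (tendsto_exp_sq.const_mul_atTop hκ).atTop_div_const hq
  have h2 := (tendsto_rpow_neg_atTop (y := -e) (by linarith)).comp h1
  simpa [Function.comp_def] using h2

/-- Here `l = 0` and `ν = 2γ/a > 2`: the residual vanishes up to `r_n`, and the tail dies as `w(r_n)
→ ∞`. -/
lemma isMinimizing_of_lt
    (hφ : ∀ n : ℕ, 1 ≤ n → ∀ x, 1 / (n : ℝ) ≤ |x - 1| → φ n x = 1) (ha : 0 < a)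
    (h : a < γ) : IsMinimizing γ a (bSeq φ γ a) (cSeq φ γ a) := by
  have hγ : 0 < γ := by linarith
  have hl : lVal γ a = 0 := lVal_of_le (by rw [div_le_one hγ]; exact h.le)
  have hd : 0 < 2 * γ - a := by linarith
  obtain ⟨r, hr⟩ : ∃ r : ℕ → ℝ, r = fun n : ℕ => 0 + (2 * γ - a) * Real.exp ((n : ℝ) ^ 2) := ⟨_, rfl⟩
  have hr0 : ∀ n, 0 ≤ r n := fun n => by rw [hr]; positivity
  obtain ⟨ν, hν⟩ : ∃ ν, ν = γ / (a / 2 - 0) := ⟨_, rfl⟩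
  have hν2 : 2 < ν := by rw [hν, lt_div_iff₀ (by linarith)]; linarith
  refine (isMinimizing_hyperbolicControl (r := r) (q := γ) le_rfl (by linarith) hγ.ne' hν
    (by simp) (Or.inl rfl) (by positivity) ?_ ?_ ?_ ?_).congr ?_
  · exact Eventually.of_forall hr0
  · refine Eventually.of_forall fun n => ?_
    rw [sub_zero]; have := div_nonneg (hr0 n) hγ.le; linarith
  · rw [hr]; exact tendsto_one_add_mul_exp_sq_rpow hγ hd (by linarith) 0
  · have h3 := div_pos ha hγ
    rw [etaMin, if_neg hγ.ne', etaDagger, if_neg (by linarith), if_pos]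
    · simp
    · rw [div_le_one hγ]; exact h.le
  · filter_upwards [eventually_psiSeq_eq_one hφ h.ne, eventually_ge_atTop 1] with n hψ hn
    have hrn : rSeq γ a n = r n := by
      rw [rSeq_of_pos hn (by linarith), hl, hr, max_eq_left hd.le]
    exact ⟨bSeq_eq hγ.ne' hψ one_ne_zero hl hrn (by simp) hγ.ne',
      cSeq_eq_hyperbolicControl hψ one_ne_zero hl hrn (by simpa using ha.ne') (by simp) hν⟩

/-- The tail dies again, but `l > 0`, and the cost of `[0, l]` and of the hyperbolic stretch
survives; in the limit it equals the dual bound `γ² η₁(a/γ)`. -/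
lemma isMinimizing_of_lt_of_lt
    (hφ : ∀ n : ℕ, 1 ≤ n → ∀ x, 1 / (n : ℝ) ≤ |x - 1| → φ n x = 1)
    (h1 : γ < a) (h2 : a < 2 * γ) : IsMinimizing γ a (bSeq φ γ a) (cSeq φ γ a) := by
  have hγ : 0 < γ := by linarith
  have ha : 0 < a := by linarith
  have h1' : 1 < a / γ := by rw [lt_div_iff₀ hγ]; linarith
  have h2' : a / γ < 2 := by rw [div_lt_iff₀ hγ]; linarith
  have h4 : 0 < 4 * γ - a := by linarith
  have hd : 0 < 2 * γ - a := by linarith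
  have ha1 : 0 < a - γ := by linarith
  -- In terms of these two positive quantities, `L = d (2γ + a) / (2D)`, `q = γ (2γ + a) / D` and `ν
  -- = 2γ / d`, so `ν > 2` amounts to `γ < a`.
  obtain ⟨D, hD⟩ : ∃ D, D = 4 * γ - a := ⟨_, rfl⟩
  obtain ⟨d, hd'⟩ : ∃ d, d = 2 * γ - a := ⟨_, rfl⟩
  rw [← hD] at h4
  rw [← hd'] at hd
  obtain ⟨l, hl⟩ : ∃ l, l = 2 * γ * (a - γ) / D := ⟨_, rfl⟩
  have hl' : lVal γ a = l := by
    rw [lVal, if_neg hγ.ne', max_eq_left (by linarith), hl, hD]; field_simp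
  have hl0 : 0 ≤ l := by rw [hl]; positivity
  obtain ⟨q, hq⟩ : ∃ q, q = γ + l := ⟨_, rfl⟩
  have hq0 : 0 < q := by linarith
  have hLe : a / 2 - l = d * (2 * γ + a) / (2 * D) := by
    rw [hl]; field_simp; rw [hD, hd']; ring
  have hL : 0 < a / 2 - l := by rw [hLe]; positivity
  have hqe : q = γ * (2 * γ + a) / D := by rw [hq, hl]; field_simp; rw [hD]; ring
  obtain ⟨ν, hν⟩ : ∃ ν, ν = q / (a / 2 - l) := ⟨_, rfl⟩
  have hνe : ν = 2 * γ / d := by rw [hν, hLe, hqe]; field_simp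
  have hν2 : 2 < ν := by rw [hνe, lt_div_iff₀ hd]; linarith
  have hν2e : 2 - ν = 2 * (γ - a) / d := by rw [hνe]; field_simp; rw [hd']; ring
  obtain ⟨r, hr⟩ : ∃ r : ℕ → ℝ, r = fun n : ℕ => l + d * Real.exp ((n : ℝ) ^ 2) := ⟨_, rfl⟩
  have hr0 : ∀ n, l ≤ r n := fun n => by
    rw [hr]; have := mul_pos hd (Real.exp_pos ((n : ℝ) ^ 2)); simp only; linarith
  refine (isMinimizing_hyperbolicControl (r := r) (q := q) hl0 hL hq0.ne' hν
    hq (Or.inr hν2.ne') (by positivity) ?_ ?_ ?_ ?_).congr ?_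
  · exact Eventually.of_forall hr0
  · refine Eventually.of_forall fun n => ?_
    have := div_nonneg (sub_nonneg.2 (hr0 n)) hq0.le; linarith
  · rw [hr]; exact tendsto_one_add_mul_exp_sq_rpow hq0 hd (by linarith) l
  · rw [etaMin, if_neg hγ.ne', etaDagger, if_neg (by linarith), if_neg (by linarith), if_pos h2',
      sq_abs, eta1, hν2e, hqe, hl]
    have h5 : γ - a ≠ 0 := by linarith
    have h7 : 4 - a / γ = D / γ := by rw [hD]; field_simp
    have h8 : a / γ - 1 = -(γ - a) / γ := by field_simp; ring
    rw [h7, h8]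
    have hd2 : d = γ + (γ - a) := by linarith
    have hD2 : D = 3 * γ + (γ - a) := by linarith
    field_simp
    rw [hd2, hD2]
    ring
  · filter_upwards [eventually_psiSeq_eq_one hφ h1.ne', eventually_ge_atTop 1] with n hψ hn
    have hrn : rSeq γ a n = r n := by
      rw [rSeq_of_pos hn (by linarith), hl', hr, ← hd', max_eq_left hd.le]
    exact ⟨bSeq_eq hγ.ne' hψ one_ne_zero hl' hrn (by simp [hq]) hq0.ne',
      cSeq_eq_hyperbolicControl hψ one_ne_zero hl' hrn hL.ne' (by simp [hq]) hν⟩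

/-- At `a = γ` the choice `q = γ` would give the critical `ν = 2`. With `ψ = 1 - 1/n`, `q - γ = γ/(n
- 1)` and `ν - 2 = 2/(n - 1)`. The stretch up to `r_n` then costs `O((q - γ)² / (ν - 2)) = O(1/n)`.
-/
lemma isMinimizing_of_eq (hφ : ∀ n : ℕ, 1 ≤ n → φ n 1 = 1 - 1 / (n : ℝ)) (hγ : 0 < γ) :
    IsMinimizing γ γ (bSeq φ γ γ) (cSeq φ γ γ) := by
  have hl : lVal γ γ = 0 := lVal_of_le (by rw [div_self hγ.ne'])
  obtain ⟨r, hr⟩ : ∃ r : ℕ → ℝ, r = fun n : ℕ => γ * Real.exp ((n : ℝ) ^ 2) := ⟨_, rfl⟩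
  have hr0 : ∀ n, 0 < r n := fun n => by rw [hr]; positivity
  obtain ⟨q, hq⟩ : ∃ q : ℕ → ℝ, q = fun n : ℕ => γ / (1 - 1 / (n : ℝ)) + 0 := ⟨_, rfl⟩
  obtain ⟨ν, hν⟩ : ∃ ν : ℕ → ℝ, ν = fun n => q n / (γ / 2 - 0) := ⟨_, rfl⟩
  have hψpos : ∀ n : ℕ, 2 ≤ n → 1 / 2 ≤ 1 - 1 / (n : ℝ) ∧ 1 - 1 / (n : ℝ) < 1 := by
    intro n hn
    have hn' : (2 : ℝ) ≤ n := by exact_mod_cast hn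
    have h1 : 1 / (n : ℝ) ≤ 1 / 2 := by gcongr
    have h2 : (0 : ℝ) < 1 / n := by positivity
    constructor <;> linarith
  have hqγ : ∀ n : ℕ, 2 ≤ n → γ < q n := by
    intro n hn
    obtain ⟨h1, h2⟩ := hψpos n hn
    rw [hq]
    simp only [add_zero]
    rw [lt_div_iff₀ (by linarith)]
    nlinarith
  have hw : ∀ n : ℕ, 2 ≤ n → 0 < 1 + (r n - 0) / q n := by
    intro n hn
    have h3 := hr0 n
    have h4 := hγ.trans (hqγ n hn)
    rw [sub_zero]; positivity
  have hmin : etaMin γ γ = 0 := by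
    rw [etaMin, if_neg hγ.ne', div_self hγ.ne', etaDagger, if_neg (by norm_num), if_pos le_rfl,
      mul_zero]
  suffices h : IsMinimizing γ γ (fun n => r n + (1 + (r n - 0) / q n) * (γ / 2 - 0))
      (fun n => hyperbolicControl 0 (r n) (q n) (ν n)) by
    refine h.congr ?_
    filter_upwards [eventually_ge_atTop 2] with n hn
    have hψ : psiSeq φ γ γ n = 1 - 1 / (n : ℝ) := by
      rw [psiSeq, if_neg hγ.ne', div_self hγ.ne', hφ n (by omega)]
    have hψ0 : 1 - 1 / (n : ℝ) ≠ 0 := by linarith [(hψpos n hn).1]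
    have hrn : rSeq γ γ n = r n := by
      rw [rSeq_of_pos (by omega) (by linarith), hl, hr, max_eq_left (by linarith)]; ring
    exact ⟨bSeq_eq hγ.ne' hψ hψ0 hl hrn (by rw [hq]) (hγ.trans (hqγ n hn)).ne',
      cSeq_eq_hyperbolicControl hψ hψ0 hl hrn (by simpa using hγ.ne') (by rw [hq]) (by rw [hν])⟩
  constructor
  · filter_upwards [eventually_ge_atTop 2] with n hn
    have h4 := hγ.trans (hqγ n hn)
    have h5 : 0 < ν n := by rw [hν]; simp only [sub_zero]; positivity
    have := isAdmissible_hyperbolicControl (L := γ / 2 - 0) le_rfl (hr0 n).le h4.ne' (by linarith)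
      (by rw [hν] : ν n = _) (hw n hn) (by positivity)
    rwa [show 2 * (0 + (γ / 2 - 0)) = γ by ring] at this
  · rw [hmin]
    have hU : Tendsto (fun n : ℕ => 2 / γ * (γ ^ 3 * 2 * (1 / (n : ℝ))
        + Real.exp (-(2 * ((n : ℝ) + 1))) * ((γ + 3 * γ / 2) ^ 2 * (γ / 2)))) atTop (𝓝 0) := by
      have h1 : Tendsto (fun n : ℕ => Real.exp (-(2 * ((n : ℝ) + 1)))) atTop (𝓝 0) := by
        refine Real.tendsto_exp_neg_atTop_nhds_zero.comp ?_
        exact (tendsto_atTop_add_const_right _ _ tendsto_natCast_atTop_atTop).const_mul_atTop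
          two_pos
      have h2 := ((tendsto_one_div_atTop_nhds_zero_nat.const_mul (γ ^ 3 * 2)).add
        (h1.mul_const ((γ + 3 * γ / 2) ^ 2 * (γ / 2)))).const_mul (2 / γ)
      simpa using h2
    refine tendsto_of_tendsto_of_tendsto_of_le_of_le' tendsto_const_nhds hU ?_ ?_
    · filter_upwards [eventually_ge_atTop 2] with n hn
      refine etaVal_nonneg ?_ γ
      have h1 := mul_pos (hw n hn) (by linarith : 0 < γ / 2 - 0)
      linarith [hr0 n]
    · filter_upwards [eventually_ge_atTop 2] with n hn
      have hn' : (2 : ℝ) ≤ n := by exact_mod_cast hn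
      have hqn := hqγ n hn
      have hνn : ν n = q n / (γ / 2) := by rw [hν]; simp
      have hn1 : 0 < (n : ℝ) - 1 := by linarith
      have hqe : q n = γ * n / (n - 1) := by
        rw [hq]; simp only [add_zero]
        have : 1 - 1 / (n : ℝ) = (n - 1) / n := by field_simp
        rw [this]; field_simp
      have hδ : q n - γ = γ / (n - 1) := by rw [hqe]; field_simp; ring
      have hν2 : ν n - 2 = 2 / (n - 1) := by rw [hνn, hqe]; field_simp; ring
      have hδγ : γ / ((n : ℝ) - 1) ≤ γ := by
        rw [div_le_iff₀ hn1]; nlinarith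
      have hkey := etaVal_hyperbolicControl_le hγ (hr0 n).le hqn hνn
      simp only [sub_zero]
      refine hkey.trans ?_
      have hx1 : (q n - γ) ^ 2 * (q n / (ν n - 2)) ≤ γ ^ 3 * 2 * (1 / (n : ℝ)) := by
        rw [hδ, hν2, hqe]
        have : (γ / ((n : ℝ) - 1)) ^ 2 * (γ * n / (n - 1) / (2 / (n - 1)))
          = γ ^ 3 * (n / (2 * (n - 1) ^ 2)) := by field_simp
        rw [this, mul_assoc]
        gcongr
        rw [div_le_iff₀ (by positivity)]
        have : 2 * (1 / (n : ℝ)) * (2 * (n - 1) ^ 2) = (2 * (n - 1)) ^ 2 / n := by field_simp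
        rw [this, le_div_iff₀ (by positivity)]
        nlinarith
      have hx2 : (1 + r n / q n) ^ (2 - ν n) ≤ Real.exp (-(2 * ((n : ℝ) + 1))) := by
        -- The growth `e^{n²}` of `r_n` beats the small exponent: `(n² - 1) · 2/(n - 1) = 2(n + 1)`.
        -- The `-1` absorbs the factor `1 - 1/n ≥ 1/2`.
        have h3 : Real.exp ((n : ℝ) ^ 2 - 1) ≤ 1 + r n / q n := by
          have h4 : r n / q n = (1 - 1 / (n : ℝ)) * Real.exp ((n : ℝ) ^ 2) := by
            rw [hr, hqe]; field_simp
          have h5 : Real.exp (-1) ≤ 1 / 2 := by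
            rw [Real.exp_neg, ← one_div]
            have := Real.add_one_le_exp (1 : ℝ)
            gcongr; linarith
          rw [h4, sub_eq_add_neg, Real.exp_add]
          have h6 := Real.exp_pos ((n : ℝ) ^ 2)
          have h7 := (hψpos n hn).1
          nlinarith
        calc (1 + r n / q n) ^ (2 - ν n) ≤ (Real.exp ((n : ℝ) ^ 2 - 1)) ^ (2 - ν n) := by
              refine Real.rpow_le_rpow_of_nonpos (Real.exp_pos _) h3 ?_
              have : 0 < 2 / ((n : ℝ) - 1) := by positivity
              linarith
          _ = _ := by
              rw [← Real.exp_mul]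
              congr 1
              have : 2 - ν n = -(2 / ((n : ℝ) - 1)) := by linarith
              rw [this]; field_simp; ring
      rw [hδ] at hx1 ⊢
      have : 0 < γ / ((n : ℝ) - 1) := by positivity
      gcongr

/-- The explicit sequence is minimizing. -/
lemma isMinimizing_seq
    (hφ_far : ∀ n : ℕ, 1 ≤ n → ∀ x, 1 / (n : ℝ) ≤ |x - 1| → φ n x = 1)
    (hφ_one : ∀ n : ℕ, 1 ≤ n → φ n 1 = 1 - 1 / (n : ℝ)) (ha : 0 < a) (γ : ℝ) :
    IsMinimizing γ a (bSeq φ γ a) (cSeq φ γ a) := by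
  rcases eq_or_ne γ 0 with rfl | hγ
  · exact isMinimizing_of_eq_zero ha
  rcases le_or_gt (2 * |γ|) a with h | h
  · exact isMinimizing_of_two_mul_le hφ_far ha hγ h
  rcases lt_or_gt_of_ne hγ with h0 | h0
  · rw [abs_of_neg h0] at h
    exact isMinimizing_of_neg hφ_far ha (by linarith)
  rw [abs_of_pos h0] at h
  rcases lt_trichotomy a γ with h1 | rfl | h1
  · exact isMinimizing_of_lt hφ_far ha h1
  · exact isMinimizing_of_eq hφ_one h0
  · exact isMinimizing_of_lt_of_lt hφ_far h1 h

end Sequence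
end

noncomputable section

/-! ### Approximation by smooth controls -/

section SmoothApproximation

open scoped ContDiff Convolution

/-- Convolution with normalized even bumps preserves evenness and the bounds `0` and `K`; almost
everywhere convergence is Lebesgue differentiation. -/
lemma exists_smooth_approximation {c : ℝ → ℝ} {K : ℝ} (hm : Measurable c) (h0 : ∀ x, 0 ≤ c x)
    (hK : ∀ x, c x ≤ K) (heven : ∀ x, c (-x) = c x) (hsupp : HasCompactSupport c) :
    ∃ f : ℕ → ℝ → ℝ, (∀ k, ContDiff ℝ ∞ (f k)) ∧ (∀ k, HasCompactSupport (f k)) ∧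
      (∀ k x, 0 ≤ f k x) ∧ (∀ k x, f k x ≤ K) ∧ (∀ k x, f k (-x) = f k x) ∧
      ∀ᵐ x, Tendsto (fun k => f k x) atTop (𝓝 (c x)) := by
  have hcK : ∀ x, ‖c x‖ ≤ K := fun x => by
    rw [Real.norm_eq_abs, abs_of_nonneg (h0 x)]; exact hK x
  have hloc : LocallyIntegrable c volume :=
    (locallyIntegrable_const K).mono hm.aestronglyMeasurable (Eventually.of_forall fun x => by
      rw [Real.norm_eq_abs K]; exact (hcK x).trans (le_abs_self K))
  -- The ratio of outer to inner radius is fixed at `2`, as the almost everywhere convergence of the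
  -- mollifications requires it bounded.
  let ψ : ℕ → ContDiffBump (0 : ℝ) := fun k =>
    ⟨1 / (k + 1), 2 * (1 / (k + 1)), by positivity, by
      have : (0 : ℝ) < 1 / (k + 1) := by positivity
      linarith⟩
  have hsub : ∀ x, Measurable fun t => c (x - t) := fun x => hm.comp (measurable_const.sub
    measurable_id)
  have hint : ∀ k x, Integrable (fun t => (ψ k).normed volume t * c (x - t)) := by
    intro k x
    refine ((ψ k).integrable_normed (μ := volume)).mul_bdd (c := K) (hsub x).aestronglyMeasurable
      (Eventually.of_forall fun t => hcK _)
  refine ⟨fun k => (ψ k).normed volume ⋆[ContinuousLinearMap.lsmul ℝ ℝ, volume] c,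
    fun k => ?_, fun k => ?_, fun k x => ?_, fun k x => ?_, fun k x => ?_, ?_⟩
  · exact (ψ k).hasCompactSupport_normed.contDiff_convolution_left _ (ψ k).contDiff_normed hloc
  · exact (ψ k).hasCompactSupport_normed.convolution _ hsupp
  · exact integral_nonneg fun t => mul_nonneg ((ψ k).nonneg_normed t) (h0 _)
  · calc ∫ t, (ψ k).normed volume t * c (x - t)
        ≤ ∫ t, (ψ k).normed volume t * K := by
          refine integral_mono (hint k x) ((ψ k).integrable_normed.mul_const K) fun t => ?_
          exact mul_le_mul_of_nonneg_left (hK _) ((ψ k).nonneg_normed t)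
      _ = K := by rw [integral_mul_const, (ψ k).integral_normed, one_mul]
  · change ∫ t, (ψ k).normed volume t * c (-x - t) = ∫ t, (ψ k).normed volume t * c (x - t)
    rw [← integral_neg_eq_self]
    refine integral_congr_ae (Eventually.of_forall fun t => ?_)
    simp only [(ψ k).normed_neg]
    rw [← heven]
    congr 2
    ring
  · refine ContDiffBump.ae_convolution_tendsto_right_of_locallyIntegrable (K := 2) ?_ ?_ hloc
    · have := (tendsto_one_div_add_atTop_nhds_zero_nat (𝕜 := ℝ)).const_mul 2
      rwa [mul_zero] at this
    · exact Eventually.of_forall fun k => le_rfl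

/-! ### Stability of `g`, `G`, the boundary and the variance under bounded almost everywhere
convergence. -/

section Convergence

variable {c : ℝ → ℝ} {f : ℕ → ℝ → ℝ} {K : ℝ}

lemma exp_le_gFun (hm : Measurable c) (h0 : ∀ x, 0 ≤ c x) (hK : ∀ x, c x ≤ K) {R x : ℝ}
    (hx : x ∈ Icc 0 R) : Real.exp (-2 * (K * R)) ≤ gFun c x := by
  have hK0 : 0 ≤ K := (h0 0).trans (hK 0)
  rw [gFun_of_nonneg c hx.1, Real.exp_le_exp]
  have h1 : ∫ y in (0 : ℝ)..x, c y ≤ ∫ _ in (0 : ℝ)..x, K :=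
    intervalIntegral.integral_mono_on hx.1
      (intervalIntegrable_of_bounded hm (K := K) (fun z => by
        rw [abs_of_nonneg (h0 z)]; exact hK z) _ _) intervalIntegrable_const fun y _ => hK y
  simp only [intervalIntegral.integral_const, sub_zero, smul_eq_mul] at h1
  nlinarith [hx.2]

lemma gInt_mem_Icc (hm : Measurable c) (h0 : ∀ x, 0 ≤ c x) (hK : ∀ x, c x ≤ K) {x : ℝ}
    (hx : 0 ≤ x) : gInt c x ∈ Icc 0 x := by
  have hc : IntervalIntegrable c volume 0 x := intervalIntegrable_of_bounded hm (K := K)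
    (fun z => by rw [abs_of_nonneg (h0 z)]; exact hK z) _ _
  refine ⟨intervalIntegral.integral_nonneg hx fun y _ => (gFun_pos c y).le, ?_⟩
  calc gInt c x ≤ ∫ _ in (0 : ℝ)..x, (1 : ℝ) :=
        intervalIntegral.integral_mono_on hx (intervalIntegrable_gFun hx hc)
          intervalIntegrable_const fun y hy => gFun_le_one (fun z _ => h0 z) hy
    _ = x := by simp

lemma mul_sub_le_gInt_sub (hm : Measurable c) (h0 : ∀ x, 0 ≤ c x) (hK : ∀ x, c x ≤ K)
    {R x y : ℝ} (hx : 0 ≤ x) (hxy : x ≤ y) (hy : y ≤ R) :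
    Real.exp (-2 * (K * R)) * (y - x) ≤ gInt c y - gInt c x := by
  have hc : ∀ x y, IntervalIntegrable c volume x y := intervalIntegrable_of_bounded hm (K := K)
    (fun z => by rw [abs_of_nonneg (h0 z)]; exact hK z)
  have h1 : gInt c y - gInt c x = ∫ z in x..y, gFun c z :=
    intervalIntegral.integral_interval_sub_left (intervalIntegrable_gFun' hc le_rfl (hx.trans hxy))
      (intervalIntegrable_gFun' hc le_rfl hx)
  have h2 : ∫ _ in x..y, Real.exp (-2 * (K * R)) = Real.exp (-2 * (K * R)) * (y - x) := by
    simp [mul_comm]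
  rw [h1, ← h2]
  exact intervalIntegral.integral_mono_on hxy intervalIntegrable_const
    (intervalIntegrable_gFun' hc hx hxy) fun z hz =>
      exp_le_gFun hm h0 hK ⟨hx.trans hz.1, hz.2.trans hy⟩

lemma tendsto_gFun (hfm : ∀ k, Measurable (f k)) (hf0 : ∀ k x, 0 ≤ f k x)
    (hfK : ∀ k x, f k x ≤ K) (hlim : ∀ᵐ x, Tendsto (fun k => f k x) atTop (𝓝 (c x))) (x : ℝ) :
    Tendsto (fun k => gFun (f k) x) atTop (𝓝 (gFun c x)) := by
  unfold gFun
  refine (Real.continuous_exp.tendsto _).comp (Tendsto.const_mul _ ?_)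
  refine intervalIntegral.tendsto_integral_filter_of_dominated_convergence (fun _ => K)
    (Eventually.of_forall fun k => (hfm k).aestronglyMeasurable)
    (Eventually.of_forall fun k => Eventually.of_forall fun y _ => ?_) intervalIntegrable_const ?_
  · rw [Real.norm_eq_abs, abs_of_nonneg (hf0 k y)]; exact hfK k y
  · filter_upwards [hlim] with y hy _ using hy

lemma tendsto_gInt (hfm : ∀ k, Measurable (f k)) (hf0 : ∀ k x, 0 ≤ f k x)
    (hfK : ∀ k x, f k x ≤ K) (hlim : ∀ᵐ x, Tendsto (fun k => f k x) atTop (𝓝 (c x))) {x : ℝ}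
    (hx : 0 ≤ x) : Tendsto (fun k => gInt (f k) x) atTop (𝓝 (gInt c x)) := by
  have hc : ∀ k, IntervalIntegrable (f k) volume 0 x := fun k =>
    intervalIntegrable_of_bounded (hfm k) (K := K)
    (fun z => by rw [abs_of_nonneg (hf0 k z)]; exact hfK k z) _ _
  refine intervalIntegral.tendsto_integral_filter_of_dominated_convergence (fun _ => 1)
    (Eventually.of_forall fun k =>
      (intervalIntegrable_gFun hx (hc k)).def'.aestronglyMeasurable)
    (Eventually.of_forall fun k => Eventually.of_forall fun y hy => ?_) intervalIntegrable_const
    (Eventually.of_forall fun y _ => tendsto_gFun hfm hf0 hfK hlim y)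
  rw [uIoc_of_le hx] at hy
  rw [Real.norm_eq_abs, abs_of_pos (gFun_pos _ _)]
  exact gFun_le_one (fun z _ => hf0 k z) ⟨hy.1.le, hy.2⟩

lemma abs_etaIntegrand_le (hm : Measurable c) (h0 : ∀ x, 0 ≤ c x) (hK : ∀ x, c x ≤ K)
    (γ : ℝ) {a R x : ℝ} (ha : 0 < a) (hx : x ∈ Icc 0 R) : |etaIntegrand γ a c x|
      ≤ (R + |γ| + |γ| * ((1 + 2 * R / a) / Real.exp (-2 * (K * R)))) ^ 2 := by
  have hR : 0 ≤ R := hx.1.trans hx.2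
  have hg := exp_le_gFun hm h0 hK hx
  have hg1 : gFun c x ≤ 1 := gFun_le_one (fun z _ => h0 z) hx
  have hG := gInt_mem_Icc hm h0 hK hx.1
  have h1 : |1 - 2 * gInt c x / a| ≤ 1 + 2 * R / a := by
    have h2 : 0 ≤ 2 * gInt c x / a := div_nonneg (by linarith [hG.1]) ha.le
    have h3 : 2 * gInt c x / a ≤ 2 * R / a := by gcongr; exact hG.2.trans hx.2
    rw [abs_le]; constructor <;> linarith
  have h2 : |x + γ - γ * ((1 - 2 * gInt c x / a) / gFun c x)|
      ≤ R + |γ| + |γ| * ((1 + 2 * R / a) / Real.exp (-2 * (K * R))) := by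
    refine (abs_sub _ _).trans (add_le_add ((abs_add_le _ _).trans ?_) ?_)
    · rw [abs_of_nonneg hx.1]; linarith [hx.2]
    · rw [abs_mul, abs_div, abs_of_pos (gFun_pos c x)]
      gcongr
  rw [etaIntegrand, abs_mul, abs_pow, abs_of_pos (gFun_pos c x)]
  calc _ ≤ (R + |γ| + |γ| * ((1 + 2 * R / a) / Real.exp (-2 * (K * R)))) ^ 2 * 1 := by
        gcongr
        exact (gFun_pos c x).le
    _ = _ := mul_one _

/-- Since `G(2b) > G(b)`, the approximating primitives eventually exceed `G(b)` at `2b`, and the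
intermediate value theorem yields `β k`. The uniform lower bound `m` on their slopes turns
convergence at `b` into convergence of `β k`. -/
lemma exists_tendsto_boundary {b : ℝ} (hb : 0 < b) (hcm : Measurable c) (hc0 : ∀ x, 0 ≤ c x)
    (hcK : ∀ x, c x ≤ K) (hfm : ∀ k, Measurable (f k)) (hf0 : ∀ k x, 0 ≤ f k x)
    (hfK : ∀ k x, f k x ≤ K) (hlim : ∀ᵐ x, Tendsto (fun k => f k x) atTop (𝓝 (c x))) :
    ∃ β : ℕ → ℝ, Tendsto β atTop (𝓝 b) ∧
      ∀ᶠ k in atTop, β k ∈ Ioc 0 (2 * b) ∧ aVal (β k) (f k) = aVal b c := by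
  have hcI : ∀ x y, IntervalIntegrable c volume x y := intervalIntegrable_of_bounded hcm (K := K)
    (fun z => by rw [abs_of_nonneg (hc0 z)]; exact hcK z)
  have hfI : ∀ k x y, IntervalIntegrable (f k) volume x y := fun k =>
    intervalIntegrable_of_bounded (hfm k) (K := K)
    (fun z => by rw [abs_of_nonneg (hf0 k z)]; exact hfK k z)
  have hGb : 0 < gInt c b := by
    have := aVal_pos hb (hcI 0 b)
    rw [aVal_eq_gInt] at this; linarith
  have hmono : gInt c b < gInt c (2 * b) :=
    strictMonoOn_gInt (by linarith) (hcI 0 (2 * b)) ⟨hb.le, by linarith⟩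
      ⟨by linarith, le_rfl⟩ (by linarith)
  have hex : ∀ᶠ k in atTop, ∃ β, β ∈ Ioc 0 (2 * b) ∧ gInt (f k) β = gInt c b := by
    filter_upwards [(tendsto_gInt hfm hf0 hfK hlim (by linarith : 0 ≤ 2 * b)).eventually
      (Ioi_mem_nhds hmono)] with k hk
    obtain ⟨β, hβ, h⟩ := intermediate_value_Icc (by linarith : (0 : ℝ) ≤ 2 * b)
      (continuousOn_gInt (by linarith) (hfI k 0 (2 * b)))
      (show gInt c b ∈ Icc _ _ from ⟨by rw [gInt_zero]; exact hGb.le, le_of_lt hk⟩)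
    refine ⟨β, ⟨hβ.1.lt_of_ne ?_, hβ.2⟩, h⟩
    rintro rfl
    rw [gInt_zero] at h
    exact hGb.ne h
  obtain ⟨β, hβ⟩ := hex.choice
  refine ⟨β, ?_, by
    filter_upwards [hβ] with k hk
    exact ⟨hk.1, by rw [aVal_eq_gInt, aVal_eq_gInt, hk.2]⟩⟩
  have hm := Real.exp_pos (-2 * (K * (2 * b)))
  set m := Real.exp (-2 * (K * (2 * b)))
  have hz : Tendsto (fun k => |gInt c b - gInt (f k) b| / m) atTop (𝓝 0) := by
    have := (((tendsto_gInt hfm hf0 hfK hlim hb.le).const_sub (gInt c b)).abs).div_const m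
    simpa using this
  rw [tendsto_iff_dist_tendsto_zero]
  refine squeeze_zero' (Eventually.of_forall fun k => dist_nonneg) ?_ hz
  filter_upwards [hβ] with k hk
  rw [Real.dist_eq, le_div_iff₀ hm, mul_comm]
  rcases le_total b (β k) with h | h
  · have := mul_sub_le_gInt_sub (hfm k) (hf0 k) (hfK k) hb.le h hk.1.2
    rw [hk.2] at this
    rw [abs_of_nonneg (sub_nonneg.2 h)]
    exact this.trans (le_abs_self _)
  · have := mul_sub_le_gInt_sub (hfm k) (hf0 k) (hfK k) hk.1.1.le h (by linarith : b ≤ 2 * b)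
    rw [hk.2] at this
    rw [abs_sub_comm, abs_of_nonneg (sub_nonneg.2 h), abs_sub_comm]
    exact this.trans (le_abs_self _)

lemma tendsto_etaVal {b : ℝ} {β : ℕ → ℝ} (hb : 0 < b) (hcm : Measurable c) (hc0 : ∀ x, 0 ≤ c x)
    (hcK : ∀ x, c x ≤ K) (hfm : ∀ k, Measurable (f k)) (hf0 : ∀ k x, 0 ≤ f k x)
    (hfK : ∀ k x, f k x ≤ K) (hlim : ∀ᵐ x, Tendsto (fun k => f k x) atTop (𝓝 (c x)))
    (hβ : Tendsto β atTop (𝓝 b))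
    (hβa : ∀ᶠ k in atTop, β k ∈ Ioc 0 (2 * b) ∧ aVal (β k) (f k) = aVal b c) (γ : ℝ) :
    Tendsto (fun k => etaVal γ (β k) (f k)) atTop (𝓝 (etaVal γ b c)) := by
  have hcI : ∀ x y, IntervalIntegrable c volume x y := intervalIntegrable_of_bounded hcm (K := K)
    (fun z => by rw [abs_of_nonneg (hc0 z)]; exact hcK z)
  have hfI : ∀ k x y, IntervalIntegrable (f k) volume x y := fun k =>
    intervalIntegrable_of_bounded (hfm k) (K := K)
    (fun z => by rw [abs_of_nonneg (hf0 k z)]; exact hfK k z)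
  have ha := aVal_pos hb (hcI 0 b)
  obtain ⟨a, hadef⟩ : ∃ a, a = aVal b c := ⟨_, rfl⟩
  rw [etaVal_eq hb.le (hcI 0 b)]
  rw [← hadef] at ha ⊢
  obtain ⟨Q, hQ⟩ : ∃ Q, Q = (2 * b + |γ| + |γ| * ((1 + 2 * (2 * b) / a)
    / Real.exp (-2 * (K * (2 * b))))) ^ 2 := ⟨_, rfl⟩
  have hEQ : ∀ k, ∀ x ∈ Icc 0 (2 * b), ‖etaIntegrand γ a (f k) x‖ ≤ Q := by
    intro k x hx
    rw [hQ]; exact abs_etaIntegrand_le (hfm k) (hf0 k) (hfK k) γ ha hx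
  have hEI : ∀ k, IntervalIntegrable (etaIntegrand γ a (f k)) volume 0 (2 * b) := by
    intro k
    refine ContinuousOn.intervalIntegrable ?_
    rw [uIcc_of_le (by linarith)]
    exact continuousOn_etaIntegrand (by linarith) (hfI k 0 _) γ a
  have h2b : (0 : ℝ) ∈ Icc 0 (2 * b) := ⟨le_rfl, by linarith⟩
  have hbm : b ∈ Icc 0 (2 * b) := ⟨hb.le, by linarith⟩
  have h1 : Tendsto (fun k => ∫ x in (0 : ℝ)..b, etaIntegrand γ a (f k) x) atTop
      (𝓝 (∫ x in (0 : ℝ)..b, etaIntegrand γ a c x)) := by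
    refine intervalIntegral.tendsto_integral_filter_of_dominated_convergence (fun _ => Q)
      (Eventually.of_forall fun k =>
        (intervalIntegrable_sub (hEI k) h2b hbm).def'.aestronglyMeasurable)
      (Eventually.of_forall fun k => Eventually.of_forall fun y hy => ?_) intervalIntegrable_const
      (Eventually.of_forall fun y hy => ?_)
    · rw [uIoc_of_le hb.le] at hy
      exact hEQ k y ⟨hy.1.le, by linarith [hy.2]⟩
    · rw [uIoc_of_le hb.le] at hy
      have hg := tendsto_gFun hfm hf0 hfK hlim y
      have hG := tendsto_gInt hfm hf0 hfK hlim hy.1.le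
      exact ((((((hG.const_mul 2).div_const a).const_sub 1).div hg (gFun_pos c y).ne').const_mul
        γ).const_sub (y + γ)).pow 2 |>.mul hg
  -- The boundary moves with `k`; the uniform bound `Q` makes the integral between `b` and `β k`
  -- negligible.
  have h2 : Tendsto (fun k => ∫ x in b..β k, etaIntegrand γ a (f k) x) atTop (𝓝 0) := by
    have hz : Tendsto (fun k => Q * |β k - b|) atTop (𝓝 0) := by
      have := ((hβ.sub_const b).abs).const_mul Q
      simpa using this
    refine squeeze_zero_norm' ?_ hz
    filter_upwards [hβa] with k hk
    refine intervalIntegral.norm_integral_le_of_norm_le_const fun x hx => hEQ k x ?_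
    have := ordConnected_Icc.uIcc_subset hbm (show β k ∈ Icc 0 (2 * b) from ⟨hk.1.1.le, hk.1.2⟩)
    exact this (uIoc_subset_uIcc hx)
  have h3 := (h1.add h2).const_mul (2 / a)
  rw [add_zero] at h3
  refine h3.congr' ?_
  filter_upwards [hβa] with k hk
  rw [etaVal_eq hk.1.1.le (hfI k 0 _), hk.2, ← hadef]
  congr 1
  have hβm : β k ∈ Icc 0 (2 * b) := ⟨hk.1.1.le, hk.1.2⟩
  exact intervalIntegral.integral_add_adjacent_intervals
    (intervalIntegrable_sub (hEI k) h2b hbm) (intervalIntegrable_sub (hEI k) hbm hβm)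

end Convergence

/-- Smooth, even, compactly supported, nonnegative controls. -/
structure IsSmoothControl (c : ℝ → ℝ) : Prop where
  smooth : ContDiff ℝ ∞ c
  compactSupport : HasCompactSupport c
  nonneg : ∀ x, 0 ≤ c x
  even : ∀ x, c (-x) = c x

lemma IsAdmissible.exists_smooth {a b : ℝ} {c : ℝ → ℝ} (h : IsAdmissible a b c) (γ : ℝ) {ε : ℝ}
    (hε : 0 < ε) : ∃ b₀ c₀, IsSmoothControl c₀ ∧ 0 < b₀ ∧ aVal b₀ c₀ = a ∧ |b₀ - b| < ε ∧
      (∫ x in (0 : ℝ)..min b₀ b, |c₀ x - c x|) < ε ∧ |etaVal γ b₀ c₀ - etaVal γ b c| < ε := by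
  obtain ⟨K, hK⟩ := h.bounded
  obtain ⟨R, hR⟩ := h.support
  have hsupp : HasCompactSupport c := by
    refine HasCompactSupport.intro (isCompact_closedBall (0 : ℝ) R) fun x hx => hR x ?_
    rw [mem_closedBall_zero_iff, Real.norm_eq_abs, not_le] at hx
    exact hx.le
  obtain ⟨f, hfs, hfc, hf0, hfK, hfe, hlim⟩ :=
    exists_smooth_approximation h.measurable h.nonneg hK h.even hsupp
  have hfm : ∀ k, Measurable (f k) := fun k => (hfs k).continuous.measurable
  obtain ⟨β, hβ, hβa⟩ := exists_tendsto_boundary h.pos h.measurable h.nonneg hK hfm hf0 hfK hlim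
  have heta := tendsto_etaVal h.pos h.measurable h.nonneg hK hfm hf0 hfK hlim hβ hβa γ
  have hcf : ∀ k x, |f k x - c x| ≤ K := fun k x => by
    have h1 := hf0 k x
    have h2 := hfK k x
    have h3 := h.nonneg x
    have h4 := hK x
    rw [abs_le]; constructor <;> linarith
  have hdm : ∀ k, Measurable fun x => |f k x - c x| := fun k =>
    continuous_abs.measurable.comp ((hfm k).sub h.measurable)
  have hL1 : Tendsto (fun k => ∫ x in (0 : ℝ)..b, |f k x - c x|) atTop (𝓝 0) := by
    have := intervalIntegral.tendsto_integral_filter_of_dominated_convergence (μ := volume)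
      (a := 0) (b := b) (F := fun k x => |f k x - c x|) (f := fun _ => (0 : ℝ)) (l := atTop)
      (fun _ => K) (Eventually.of_forall fun k => (hdm k).aestronglyMeasurable)
      (Eventually.of_forall fun k => Eventually.of_forall fun y _ => by
        rw [Real.norm_eq_abs, abs_abs]; exact hcf k y) intervalIntegrable_const (by
        filter_upwards [hlim] with y hy _
        have := (hy.sub_const (c y)).abs
        simpa using this)
    simpa using this
  obtain ⟨k, hk1, hk2, hk3, hk4⟩ := (hβa.and ((Metric.tendsto_nhds.1 hβ ε hε).and
    ((hL1.eventually (Iio_mem_nhds hε)).and (Metric.tendsto_nhds.1 heta ε hε)))).exists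
  refine ⟨β k, f k, ⟨hfs k, hfc k, hf0 k, hfe k⟩, hk1.1.1, hk1.2.trans h.aVal_eq, hk2, ?_, hk4⟩
  refine lt_of_le_of_lt ?_ hk3
  refine intervalIntegral.integral_mono_interval le_rfl (le_min hk1.1.1.le h.pos.le)
    (min_le_right _ _) (Eventually.of_forall fun x => abs_nonneg _) ?_
  exact intervalIntegrable_of_bounded (hdm k) (fun x => by rw [abs_abs]; exact hcf k x) _ _

end SmoothApproximation

end

noncomputable section

/-! ### Members of the class `𝓒_b` at a fixed point -/

lemma IsCut.le {T : ℝ≥0} {b : ℝ → ℝ → ℝ} {m : ℕ} {β : ℕ → ℝ → ℝ → ℝ} (h : IsCut T b m β)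
    {s t : ℝ} (hs : 0 < s) (ht : t ∈ Ico (0 : ℝ) T) {i j : ℕ} (hij : i ≤ j) (hj : j ≤ m) :
    β i s t ≤ β j s t := by
  induction j, hij using Nat.le_induction with
  | base => exact le_rfl
  | succ k _ ih => exact (ih (by omega)).trans (h.mono k (by omega) s t hs ht)

/-- On each piece the function agrees with a continuous one except possibly at the two end points,
which form a null set. -/
lemma PiecewiseContOn.intervalIntegrable {T : ℝ≥0} {b : ℝ → ℝ → ℝ} {m : ℕ} {β : ℕ → ℝ → ℝ → ℝ}
    {F : ℝ → ℝ → ℝ → ℝ} (hF : PiecewiseContOn T b m β F) (hβ : IsCut T b m β)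
    {s t : ℝ} (hs : 0 < s) (ht : t ∈ Ico (0 : ℝ) T) :
    IntervalIntegrable (fun x => F x s t) volume (-b s t) (b s t) := by
  rw [← hβ.first s t hs ht, ← hβ.last s t hs ht]
  refine IntervalIntegrable.trans_iterate (a := fun k => β k s t) fun k hk => ?_
  obtain ⟨e, he, hFe⟩ := hF k hk
  have hle := hβ.mono k hk s t hs ht
  have hmem : ∀ x ∈ Icc (β k s t) (β (k + 1) s t), (x, s, t) ∈ DomD T b := by
    intro x hx
    refine ⟨hs, ht, abs_le.2 ⟨?_, ?_⟩⟩
    · rw [← hβ.first s t hs ht]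
      exact (hβ.le hs ht (Nat.zero_le k) hk.le).trans hx.1
    · rw [← hβ.last s t hs ht]
      exact hx.2.trans (hβ.le hs ht (Nat.succ_le_of_lt hk) le_rfl)
  have hcont : ContinuousOn (fun x => e (x, s, t)) (uIcc (β k s t) (β (k + 1) s t)) := by
    rw [uIcc_of_le hle]
    exact he.comp (by fun_prop) hmem
  refine hcont.intervalIntegrable.congr_uIoo ?_
  rw [uIoo_of_le hle]
  intro x hx
  exact (hFe x s t (hmem x ⟨hx.1.le, hx.2.le⟩) hx.1 hx.2).symm

section

variable {Ω : Type*} {mΩ : MeasurableSpace Ω} {P : Measure Ω} {T : ℝ≥0} {S : ℝ≥0 → Ω → ℝ}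

lemma intervalIntegrable_of_mem_classC {b : ℝ → ℝ → ℝ} {c : ℝ → ℝ → ℝ → ℝ}
    (hc : c ∈ ClassC P T S b) {s t : ℝ} (hs : 0 < s) (ht : t ∈ Ico (0 : ℝ) T)
    (hb : 0 < b s t) : IntervalIntegrable (fun x => c x s t) volume 0 (b s t) := by
  obtain ⟨-, -, ⟨d, hd, ⟨m, β, hβ, hpc⟩, -⟩, -⟩ := hc
  have h := (hpc 0 (by norm_num) 0 (by norm_num)).intervalIntegrable hβ hs ht
  have h2 : IntervalIntegrable (fun x => d 0 0 x s t) volume 0 (b s t) := by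
    refine h.mono_set ?_
    rw [uIcc_of_le hb.le, uIcc_of_le (by linarith)]
    exact Icc_subset_Icc (by linarith) le_rfl
  refine h2.congr_uIoo ?_
  rw [uIoo_of_le hb.le]
  intro x hx
  exact (hd x).zero s t ⟨hs, ht, by rw [abs_of_pos hx.1]; exact hx.2.le⟩

lemma etaMin_le_etaBC {lam p a : ℝ → ℝ → ℝ} {bc : (ℝ → ℝ → ℝ) × (ℝ → ℝ → ℝ → ℝ)}
    (h : bc ∈ StratS P T S a) {s t : ℝ} (hs : 0 < s) (ht : t ∈ Ico (0 : ℝ) T) :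
    etaMin (gam lam p s t) (a s t) ≤ etaBC lam p bc.1 bc.2 s t := by
  obtain ⟨hb, hc, ha⟩ := h
  have hbpos := hb.1 s t hs ht
  rw [ha s t hs ht]
  refine etaMin_le_etaVal hbpos (intervalIntegrable_of_mem_classC hc hs ht hbpos) ?_ _
  exact fun x hx => hc.1 x s t ⟨hs, ht, by rw [abs_of_nonneg hx.1]; exact hx.2⟩

/-! ### Partial derivatives -/

lemma HasPartialsOn.mono {E E' : Set (ℝ × ℝ)} {φ : ℝ → ℝ → ℝ} {d : ℕ → ℕ → ℝ → ℝ → ℝ}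
    (h : HasPartialsOn E φ d) (hE : E' ⊆ E) : HasPartialsOn E' φ d where
  zero s t hst := h.zero s t (hE hst)
  dt s t hst := (h.dt s t (hE hst)).mono fun _ h' => hE h'
  ds i hi j hj s t hst := (h.ds i hi j hj s t (hE hst)).mono fun _ h' => hE h'
  cont i hi j hj := (h.cont i hi j hj).mono hE

lemma pd_const_mul (I : Set ℝ) (i j : ℕ) (κ : ℝ) (φ : ℝ → ℝ → ℝ) :
    pd I i j (fun s t => κ * φ s t) = fun s t => κ * pd I i j φ s t := by
  funext s t
  simp only [pd, iteratedDerivWithin_const_mul_field, iteratedDeriv_const_mul_field]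

lemma IsC21.const_mul {I : Set ℝ} {φ : ℝ → ℝ → ℝ} (h : IsC21 I φ) (κ : ℝ) :
    IsC21 I (fun s t => κ * φ s t) := by
  unfold IsC21 at h ⊢
  simp only [pd_const_mul]
  exact
  { zero := fun s t hst => by rw [h.zero s t hst]
    dt := fun s t hst => (h.dt s t hst).const_mul κ
    ds := fun i hi j hj s t hst => (h.ds i hi j hj s t hst).const_mul κ
    cont := fun i hi j hj => (h.cont i hi j hj).const_smul κ }

lemma const_mul_mem_classA {φ : ℝ → ℝ → ℝ} (h : φ ∈ ClassA P T S) (κ : ℝ) :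
    (fun s t => κ * φ s t) ∈ ClassA P T S := by
  refine ⟨h.1.const_mul κ, fun i hi j hj => ?_⟩
  filter_upwards [h.2 i hi j hj] with ω ⟨l, hl⟩
  refine ⟨κ * l, ?_⟩
  simp only [pd_const_mul]
  exact hl.const_mul κ

lemma const_mul_mem_classB {b : ℝ → ℝ → ℝ} (h : b ∈ ClassB P T S) {κ : ℝ} (hκ : 0 < κ) :
    (fun s t => κ * b s t) ∈ ClassB P T S := by
  refine ⟨fun s t hs ht => mul_pos hκ (h.1 s t hs ht), const_mul_mem_classA h.2.1 κ, ?_⟩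
  convert! const_mul_mem_classA h.2.2 κ⁻¹ using 3
  rw [one_div, mul_inv, one_div]

/-- The limit controls a left neighbourhood of `T`, compactness the rest. This is how membership in
`𝓐` yields bounds along the path. -/
lemma exists_bound_of_tendsto {T : ℝ≥0} (hT : 0 < T) {F : ℝ≥0 → ℝ} {l : ℝ}
    (hF : ContinuousOn F (Iio T)) (hl : Tendsto F (𝓝[<] T) (𝓝 l)) :
    ∃ M, ∀ t < T, |F t| ≤ M := by
  have h1 : ∀ᶠ t in 𝓝[<] T, |F t| < |l| + 1 := hl.abs.eventually (Iio_mem_nhds (lt_add_one _))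
  obtain ⟨r, hr, hsub⟩ := (mem_nhdsLT_iff_exists_Ioo_subset' hT).1 h1
  obtain ⟨M, hM⟩ := (isCompact_Icc (a := (0 : ℝ≥0)) (b := r)).exists_bound_of_continuousOn
    (hF.mono fun x hx => lt_of_le_of_lt hx.2 hr)
  refine ⟨max M (|l| + 1), fun t ht => ?_⟩
  rcases le_or_gt t r with h | h
  · exact (hM t ⟨zero_le, h⟩).trans (le_max_left _ _)
  · exact (le_of_lt (hsub ⟨h, ht⟩)).trans (le_max_right _ _)

lemma ae_exists_bound_of_mem_classA {𝓕 : Filtration ℝ≥0 mΩ} {σ : ℝ → ℝ → ℝ}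
    {Θ B : ℝ≥0 → Ω → ℝ} (hT : 0 < T) (hS : IsPriceProcess P 𝓕 T σ Θ B S)
    {φ : ℝ → ℝ → ℝ} (hφ : φ ∈ ClassA P T S) {i j : ℕ} (hi : i ≤ 2) (hj : j ≤ 1) :
    ∀ᵐ ω ∂P, ∃ M, ∀ t < T, |pd (Ico 0 (T : ℝ)) i j φ (S t ω) t| ≤ M := by
  filter_upwards [hS.pos, hS.cont, hφ.2 i hi j hj] with ω hpos hcont ⟨l, hl⟩
  refine exists_bound_of_tendsto hT ?_ hl
  have hc := hφ.1.cont i hi j hj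
  refine hc.comp (f := fun t : ℝ≥0 => (S t ω, (t : ℝ))) ?_ ?_
  · exact (hcont.mono Iio_subset_Iic_self).prodMk NNReal.continuous_coe.continuousOn
  · intro t ht
    exact ⟨hpos t (le_of_lt ht), NNReal.coe_nonneg t, NNReal.coe_lt_coe.2 ht⟩

/-- The partial derivatives of `k ∘ φ` in terms of those of `k` and `φ`. -/
def chainPartials (k : ℕ → ℝ → ℝ) (d : ℕ → ℕ → ℝ → ℝ → ℝ) : ℕ → ℕ → ℝ → ℝ → ℝ
  | 0, 0 => fun s t => k 0 (d 0 0 s t)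
  | 1, 0 => fun s t => k 1 (d 0 0 s t) * d 1 0 s t
  | 2, 0 => fun s t => k 2 (d 0 0 s t) * (d 1 0 s t * d 1 0 s t) + k 1 (d 0 0 s t) * d 2 0 s t
  | 0, 1 => fun s t => k 1 (d 0 0 s t) * d 0 1 s t
  | 1, 1 => fun s t => k 2 (d 0 0 s t) * (d 1 0 s t * d 0 1 s t) + k 1 (d 0 0 s t) * d 1 1 s t
  | 2, 1 => fun s t => k 3 (d 0 0 s t) * (d 1 0 s t * d 1 0 s t * d 0 1 s t)
      + k 2 (d 0 0 s t) * (d 2 0 s t * d 0 1 s t + d 1 0 s t * d 1 1 s t + d 1 0 s t * d 1 1 s t)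
      + k 1 (d 0 0 s t) * d 2 1 s t
  | _, _ => fun _ _ => 0

lemma HasPartialsOn.comp {E : Set (ℝ × ℝ)} {φ : ℝ → ℝ → ℝ} {d : ℕ → ℕ → ℝ → ℝ → ℝ}
    (h : HasPartialsOn E φ d) {k : ℕ → ℝ → ℝ}
    (hk : ∀ m < 3, ∀ v, HasDerivAt (k m) (k (m + 1) v) v)
    (hcont : ∀ i ≤ 2, ∀ j ≤ 1, ContinuousOn (fun q : ℝ × ℝ => chainPartials k d i j q.1 q.2) E) :
    HasPartialsOn E (fun s t => k 0 (φ s t)) (chainPartials k d) where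
  zero s t hst := by simp only [chainPartials, h.zero s t hst]
  dt s t hst := by
    simp only [chainPartials, h.zero s t hst]
    exact (hk 0 (by norm_num) (φ s t)).comp_hasDerivWithinAt t (h.dt s t hst)
  ds i hi j hj s t hst := by
    have d0 : ∀ i < 2, HasDerivWithinAt (fun s' => d i 0 s' t) (d (i + 1) 0 s t)
      {s' | (s', t) ∈ E} s := fun i hi => h.ds i hi 0 (by norm_num) s t hst
    have d1 : ∀ i < 2, HasDerivWithinAt (fun s' => d i 1 s' t) (d (i + 1) 1 s t)
      {s' | (s', t) ∈ E} s := fun i hi => h.ds i hi 1 le_rfl s t hst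
    have d00 := d0 0 (by norm_num)
    have d10 := d0 1 (by norm_num)
    have d01 := d1 0 (by norm_num)
    have d11 := d1 1 (by norm_num)
    have k0 := (hk 0 (by norm_num) (d 0 0 s t)).comp_hasDerivWithinAt s d00
    have k1 := (hk 1 (by norm_num) (d 0 0 s t)).comp_hasDerivWithinAt s d00
    have k2 := (hk 2 (by norm_num) (d 0 0 s t)).comp_hasDerivWithinAt s d00
    interval_cases i <;> interval_cases j <;> simp only [chainPartials]
    · exact k0
    · convert! k1.mul d01 using 1
      simp; ring
    · convert! k1.mul d10 using 1
      simp; ring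
    · convert! (k2.mul (d10.mul d01)).add (k1.mul d11) using 1
      simp; ring
  cont := hcont

lemma continuousOn_chainPartials {X : Type*} [TopologicalSpace X] {A : Set X}
    {k : ℝ → ℕ → ℝ → ℝ} (hk : ∀ m, Continuous fun q : ℝ × ℝ => k q.1 m q.2)
    {d : ℕ → ℕ → ℝ → ℝ → ℝ} {x s t : X → ℝ} (hx : ContinuousOn x A)
    (hd : ∀ i ≤ 2, ∀ j ≤ 1, ContinuousOn (fun z => d i j (s z) (t z)) A)
    {i j : ℕ} (hi : i ≤ 2) (hj : j ≤ 1) :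
    ContinuousOn (fun z => chainPartials (k (x z)) d i j (s z) (t z)) A := by
  have hkc : ∀ m, ContinuousOn (fun z => k (x z) m (d 0 0 (s z) (t z))) A := fun m =>
    (hk m).comp_continuousOn (hx.prodMk (hd 0 (by norm_num) 0 (by norm_num)))
  have d10 := hd 1 (by norm_num) 0 (by norm_num)
  have d20 := hd 2 (by norm_num) 0 (by norm_num)
  have d01 := hd 0 (by norm_num) 1 (by norm_num)
  have d11 := hd 1 (by norm_num) 1 (by norm_num)
  have d21 := hd 2 (by norm_num) 1 (by norm_num)
  interval_cases i <;> interval_cases j <;> simp only [chainPartials]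
  · exact hkc 0
  · exact (hkc 1).mul d01
  · exact (hkc 1).mul d10
  · exact ((hkc 2).mul (d10.mul d01)).add ((hkc 1).mul d11)
  · exact ((hkc 2).mul (d10.mul d10)).add ((hkc 1).mul d20)
  · exact (((hkc 3).mul ((d10.mul d10).mul d01)).add
      ((hkc 2).mul (((d20.mul d01).add (d10.mul d11)).add (d10.mul d11)))).add ((hkc 1).mul d21)

/-- `F` is bounded on `A`. -/
def BddFunOn {X : Type*} (A : Set X) (F : X → ℝ) : Prop := ∃ M, ∀ z ∈ A, |F z| ≤ M

lemma BddFunOn.mul {X : Type*} {A : Set X} {F G : X → ℝ} (hF : BddFunOn A F)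
    (hG : BddFunOn A G) : BddFunOn A (fun z => F z * G z) := by
  obtain ⟨M, hM⟩ := hF
  obtain ⟨N, hN⟩ := hG
  refine ⟨M * N, fun z hz => ?_⟩
  rw [abs_mul]
  exact mul_le_mul (hM z hz) (hN z hz) (abs_nonneg _) ((abs_nonneg _).trans (hM z hz))

lemma BddFunOn.add {X : Type*} {A : Set X} {F G : X → ℝ} (hF : BddFunOn A F)
    (hG : BddFunOn A G) : BddFunOn A (fun z => F z + G z) := by
  obtain ⟨M, hM⟩ := hF
  obtain ⟨N, hN⟩ := hG
  exact ⟨M + N, fun z hz => (abs_add_le _ _).trans (add_le_add (hM z hz) (hN z hz))⟩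

lemma BddFunOn.comp_continuous {X : Type*} {A : Set X} {k : ℝ × ℝ → ℝ} (hk : Continuous k)
    {F G : X → ℝ} (hF : BddFunOn A F) (hG : BddFunOn A G) :
    BddFunOn A (fun z => k (F z, G z)) := by
  obtain ⟨M, hM⟩ := hF
  obtain ⟨N, hN⟩ := hG
  obtain ⟨Q, hQ⟩ := ((isCompact_Icc (a := -M) (b := M)).prod
    (isCompact_Icc (a := -N) (b := N))).exists_bound_of_continuousOn hk.continuousOn
  exact ⟨Q, fun z hz => hQ (F z, G z) ⟨abs_le.1 (hM z hz), abs_le.1 (hN z hz)⟩⟩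

lemma bddFunOn_chainPartials {X : Type*} {A : Set X}
    {k : ℝ → ℕ → ℝ → ℝ} (hk : ∀ m, Continuous fun q : ℝ × ℝ => k q.1 m q.2)
    {d : ℕ → ℕ → ℝ → ℝ → ℝ} {x s t : X → ℝ} (hx : BddFunOn A x)
    (hd : ∀ i ≤ 2, ∀ j ≤ 1, BddFunOn A (fun z => d i j (s z) (t z)))
    {i j : ℕ} (hi : i ≤ 2) (hj : j ≤ 1) :
    BddFunOn A (fun z => chainPartials (k (x z)) d i j (s z) (t z)) := by
  have hkc : ∀ m, BddFunOn A (fun z => k (x z) m (d 0 0 (s z) (t z))) := fun m =>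
    BddFunOn.comp_continuous (hk m) hx (hd 0 (by norm_num) 0 (by norm_num))
  have d10 := hd 1 (by norm_num) 0 (by norm_num)
  have d20 := hd 2 (by norm_num) 0 (by norm_num)
  have d01 := hd 0 (by norm_num) 1 (by norm_num)
  have d11 := hd 1 (by norm_num) 1 (by norm_num)
  have d21 := hd 2 (by norm_num) 1 (by norm_num)
  interval_cases i <;> interval_cases j <;> simp only [chainPartials]
  · exact hkc 0
  · exact (hkc 1).mul d01
  · exact (hkc 1).mul d10
  · exact ((hkc 2).mul (d10.mul d01)).add ((hkc 1).mul d11)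
  · exact ((hkc 2).mul (d10.mul d10)).add ((hkc 1).mul d20)
  · exact (((hkc 3).mul ((d10.mul d10).mul d01)).add
      ((hkc 2).mul (((d20.mul d01).add (d10.mul d11)).add (d10.mul d11)))).add ((hkc 1).mul d21)

end

/-! ### Scaling a control at a fixed point -/

lemma gFun_scale {θ : ℝ} (hθ : 0 < θ) (c : ℝ → ℝ) (x : ℝ) :
    gFun (fun y => θ * c (θ * y)) x = gFun c (θ * x) := by
  rw [gFun, gFun, abs_mul, abs_of_pos hθ, intervalIntegral.integral_const_mul,
    intervalIntegral.mul_integral_comp_mul_left, mul_zero]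

/-- Allows any positive `a` to be reached from one profile by choosing `θ`. -/
lemma aVal_scale {θ : ℝ} (hθ : 0 < θ) (c : ℝ → ℝ) (b : ℝ) :
    aVal (b / θ) (fun y => θ * c (θ * y)) = aVal b c / θ := by
  simp only [aVal, gFun_scale hθ]
  rw [intervalIntegral.integral_comp_mul_left _ hθ.ne', mul_zero, mul_div_cancel₀ _ hθ.ne',
    smul_eq_mul]
  field_simp

/-- `∂_u^m` of `κ u c(κ x u)`. -/
def scaledPartials (κ : ℝ) (c : ℝ → ℝ) (x : ℝ) : ℕ → ℝ → ℝ
  | 0 => fun u => κ * u * c (κ * x * u)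
  | m + 1 => fun u => κ * (κ * x) ^ m * iteratedDeriv (m + 1) (fun y => y * c y) (κ * x * u)

section Scaled

variable {κ : ℝ} {c : ℝ → ℝ}

lemma IsSmoothControl.contDiff_id_mul (hc : IsSmoothControl c) :
    ContDiff ℝ (⊤ : ℕ∞) fun y => y * c y :=
  contDiff_id.mul hc.smooth

lemma continuous_scaledPartials (hc : IsSmoothControl c) (m : ℕ) :
    Continuous fun q : ℝ × ℝ => scaledPartials κ c q.1 m q.2 := by
  cases m with
  | zero =>
    have := hc.smooth.continuous
    simp only [scaledPartials]
    fun_prop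
  | succ m =>
    have : Continuous (iteratedDeriv (m + 1) fun y => y * c y) :=
      hc.contDiff_id_mul.continuous_iteratedDeriv (m + 1) (by exact_mod_cast le_top)
    simp only [scaledPartials]
    fun_prop

/-- For `x ≠ 0` the function is `F(κ x u) / x` with `F(y) = y c(y)`. One differentiation cancels the
`1/x`, so the formulas for the derivatives are also valid, and jointly continuous, at `x = 0`; only
order zero has to be written separately. -/
lemma hasDerivAt_scaledPartials (hc : IsSmoothControl c) (x : ℝ) (m : ℕ) (u : ℝ) :
    HasDerivAt (scaledPartials κ c x m) (scaledPartials κ c x (m + 1) u) u := by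
  have hlin : HasDerivAt (fun u => κ * x * u) (κ * x) u := by
    simpa using (hasDerivAt_id u).const_mul (κ * x)
  cases m with
  | zero =>
    have hcd : ∀ y, HasDerivAt c (deriv c y) y := fun y =>
      (hc.smooth.differentiable (by simp)).differentiableAt.hasDerivAt
    have h1 : deriv (fun y => y * c y) (κ * x * u)
        = c (κ * x * u) + κ * x * u * deriv c (κ * x * u) := by
      refine HasDerivAt.deriv ?_
      convert! (hasDerivAt_id (κ * x * u)).mul (hcd _) using 1
      simp
    have h2 : HasDerivAt (fun u => κ * u) κ u := by
      simpa using (hasDerivAt_id u).const_mul κ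
    have := h2.mul ((hcd (κ * x * u)).comp u hlin)
    simp only [scaledPartials, zero_add, iteratedDeriv_one, h1]
    convert! this using 1
    simp only [Function.comp]
    ring
  | succ m =>
    have hd : HasDerivAt (iteratedDeriv (m + 1) fun y => y * c y)
        (iteratedDeriv (m + 2) (fun y => y * c y) (κ * x * u)) (κ * x * u) := by
      rw [iteratedDeriv_succ (n := m + 1)]
      exact ((hc.contDiff_id_mul.differentiable_iteratedDeriv (m + 1)
        (by exact_mod_cast ENat.natCast_lt_top _)).differentiableAt).hasDerivAt
    have := (hd.comp u hlin).const_mul (κ * (κ * x) ^ m)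
    simp only [scaledPartials]
    convert! this using 1
    ring

end Scaled

/-! ### Extension of a control from one point to a member of `𝓢_a`. -/

section

variable {Ω : Type*} {mΩ : MeasurableSpace Ω} {P : Measure Ω} {T : ℝ≥0} {S : ℝ≥0 → Ω → ℝ}

lemma bddFunOn_of_continuousOn {X : Type*} [TopologicalSpace X] {A : Set X} {F : X → ℝ}
    (hA : IsCompact A) (hF : ContinuousOn F A) : BddFunOn A F :=
  hA.exists_bound_of_continuousOn hF

/-- The control `(κ / a) c(κ x / a)`, obtained from `c` by scaling, belongs to the class `𝓒_b`,
`b = β a`. -/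
lemma scaled_mem_classC {𝓕 : Filtration ℝ≥0 mΩ} {σ : ℝ → ℝ → ℝ} {Θ B : ℝ≥0 → Ω → ℝ}
    (hT : 0 < T) (hS : IsPriceProcess P 𝓕 T σ Θ B S) {a : ℝ → ℝ → ℝ} (ha : a ∈ ClassB P T S)
    {c : ℝ → ℝ} (hc : IsSmoothControl c) {κ β : ℝ} (hκ : 0 < κ) (hβ : 0 < β) :
    (fun x s t => κ * (1 / a s t) * c (κ * x * (1 / a s t)))
      ∈ ClassC P T S (fun s t => β * a s t) := by
  have hdom : ∀ x, {q : ℝ × ℝ | (x, q.1, q.2) ∈ DomD T (fun s t => β * a s t)}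
      ⊆ Ioi 0 ×ˢ Ico 0 (T : ℝ) := fun x q hq => ⟨hq.1, hq.2.1⟩
  have hcont : ∀ i ≤ 2, ∀ j ≤ 1, ContinuousOn (fun z : ℝ × ℝ × ℝ =>
      pd (Ico 0 (T : ℝ)) i j (fun s t => 1 / a s t) z.2.1 z.2.2)
      (DomD T (fun s t => β * a s t)) := fun i hi j hj =>
    (ha.2.2.1.cont i hi j hj).comp (f := fun z : ℝ × ℝ × ℝ => z.2) (by fun_prop)
      fun z hz => ⟨hz.1, hz.2.1⟩
  have hchain : ∀ i ≤ 2, ∀ j ≤ 1, ContinuousOn (fun z : ℝ × ℝ × ℝ =>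
      chainPartials (scaledPartials κ c z.1)
        (fun i j => pd (Ico 0 (T : ℝ)) i j (fun s t => 1 / a s t)) i j z.2.1 z.2.2)
      (DomD T (fun s t => β * a s t)) := fun i hi j hj =>
    continuousOn_chainPartials (continuous_scaledPartials hc) (by fun_prop) hcont hi hj
  refine ⟨?_, ?_, ⟨fun i j x => chainPartials (scaledPartials κ c x)
    (fun i j => pd (Ico 0 (T : ℝ)) i j (fun s t => 1 / a s t)) i j, ?_, ?_, ?_⟩, ?_⟩
  · intro x s t h
    have := ha.1 s t h.1 h.2.1
    have := hc.nonneg (κ * x * (1 / a s t))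
    positivity
  · intro x s t _
    simp only
    rw [← hc.even (κ * x * (1 / a s t))]
    congr 2; ring
  · intro x
    refine (ha.2.2.1.mono (hdom x)).comp (fun m _ v => hasDerivAt_scaledPartials hc x m v)
      fun i hi j hj => ?_
    exact (hchain i hi j hj).comp (f := fun q : ℝ × ℝ => (x, q.1, q.2)) (by fun_prop)
      fun q hq => hq
  · have hac : ContinuousOn (fun q : ℝ × ℝ => β * a q.1 q.2) (Ioi 0 ×ˢ Ico 0 (T : ℝ)) := by
      have h := ha.2.1.1.cont 0 (by norm_num) 0 (by norm_num)
      exact ContinuousOn.const_smul (h.congr fun q hq => (ha.2.1.1.zero q.1 q.2 hq).symm) β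
    -- The control is continuous across `x = 0`, so a single piece between `-b` and `b` suffices.
    refine ⟨1, fun k s t => if k = 0 then -(β * a s t) else β * a s t, ⟨?_, ?_, ?_, ?_⟩, ?_⟩
    · intro k _
      split_ifs
      · exact hac.neg
      · exact hac
    · intro s t _ _; simp
    · intro s t _ _; simp
    · intro k hk s t hs ht
      have := mul_pos hβ (ha.1 s t hs ht)
      obtain rfl : k = 0 := by omega
      simp only [if_true, zero_add, one_ne_zero, if_false]
      linarith
    · intro i hi j hj k _
      exact ⟨_, hchain i hi j hj, fun x s t _ _ _ => rfl⟩
  · intro i hi j hj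
    have hall : ∀ᵐ ω ∂P, ∀ i : Fin 3, ∀ j : Fin 2, ∃ M, ∀ t < T,
        |pd (Ico 0 (T : ℝ)) i j (fun s t => 1 / a s t) (S t ω) t| ≤ M :=
      ae_all_iff.2 fun i => ae_all_iff.2 fun j =>
        ae_exists_bound_of_mem_classA hT hS ha.2.2 (by omega) (by omega)
    filter_upwards [hall, hS.pos, ae_exists_bound_of_mem_classA hT hS ha.2.1
      (i := 0) (j := 0) (by norm_num) (by norm_num)] with ω hω hpos ⟨M, hM⟩
    have hSt : ∀ t < T, (S t ω, (t : ℝ)) ∈ Ioi 0 ×ˢ Ico 0 (T : ℝ) := fun t ht =>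
      ⟨hpos t ht.le, NNReal.coe_nonneg t, NNReal.coe_lt_coe.2 ht⟩
    have hbdd := bddFunOn_chainPartials (X := ℝ≥0 × ℝ)
      (A := {z | z.1 < T ∧ |z.2| ≤ β * a (S z.1 ω) z.1})
      (k := scaledPartials κ c) (continuous_scaledPartials hc)
      (d := fun i j => pd (Ico 0 (T : ℝ)) i j (fun s t => 1 / a s t))
      (x := fun z => z.2) (s := fun z => S z.1 ω) (t := fun z => z.1)
      ⟨β * M, fun z hz => hz.2.trans (by
        gcongr
        rw [← ha.2.1.1.zero _ _ (hSt z.1 hz.1)]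
        exact (le_abs_self _).trans (hM z.1 hz.1))⟩
      (fun i hi j hj => by
        obtain ⟨N, hN⟩ := hω ⟨i, by omega⟩ ⟨j, by omega⟩
        exact ⟨N, fun z hz => hN z.1 hz.1⟩) hi hj
    obtain ⟨N, hN⟩ := hbdd
    exact ⟨N, fun t ht x hx => hN (t, x) ⟨ht, hx⟩⟩
  · intro A hA hAD
    obtain ⟨C, hC⟩ := hc.smooth.lipschitzWith_of_hasCompactSupport hc.compactSupport (by simp)
    have huc : ContinuousOn (fun z : ℝ × ℝ × ℝ => 1 / a z.2.1 z.2.2) A := by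
      refine ((hcont 0 (by norm_num) 0 (by norm_num)).mono hAD).congr fun z hz => ?_
      exact (ha.2.2.1.zero _ _ ⟨(hAD hz).1, (hAD hz).2.1⟩).symm
    obtain ⟨M, hM⟩ := bddFunOn_of_continuousOn hA huc
    -- The Lipschitz constant in `x`, with `1/a ≤ M` on `A`; the `+ 1` only secures positivity.
    refine ⟨κ * M * (C * (κ * M)) + 1, by
      have := mul_self_nonneg (κ * M)
      have : 0 ≤ κ * M * (C * (κ * M)) := by
        have h : κ * M * (C * (κ * M)) = C * (κ * M * (κ * M)) := by ring
        rw [h]; positivity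
      linarith, fun x y s t hx hy => ?_⟩
    have hu : 0 < 1 / a s t := one_div_pos.2 (ha.1 s t (hAD hx).1 (hAD hx).2.1)
    have huM : 1 / a s t ≤ M := (le_abs_self _).trans (hM _ hx)
    set u := 1 / a s t
    have hM0 : 0 ≤ M := hu.le.trans huM
    have hlip : |κ * u * c (κ * x * u) - κ * u * c (κ * y * u)|
        ≤ κ * M * (C * (κ * M)) * |x - y| := by
      have h1 := hC.dist_le_mul (κ * x * u) (κ * y * u)
      rw [Real.dist_eq, Real.dist_eq, show κ * x * u - κ * y * u = κ * u * (x - y) by ring,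
        abs_mul (κ * u), abs_of_pos (mul_pos hκ hu)] at h1
      rw [← mul_sub, abs_mul, abs_of_pos (mul_pos hκ hu)]
      calc κ * u * |c (κ * x * u) - c (κ * y * u)|
          ≤ κ * u * (C * (κ * u * |x - y|)) := by gcongr
        _ ≤ κ * M * (C * (κ * M * |x - y|)) := by gcongr
        _ = _ := by ring
    have hnx : 0 ≤ κ * u * c (κ * x * u) := mul_nonneg (by positivity) (hc.nonneg _)
    have hny : 0 ≤ κ * u * c (κ * y * u) := mul_nonneg (by positivity) (hc.nonneg _)
    set X := κ * u * c (κ * x * u)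
    set Y := κ * u * c (κ * y * u)
    -- For `x`, `y` of the same strict sign this is Lipschitz continuity. Across zero the jump of
    -- `-sgn(x) c` is downwards because `c ≥ 0`, so the left side is not positive.
    have hbase : (x - y) * (-Real.sign x * X + Real.sign y * Y) ≤ |x - y| * |X - Y| := by
      have hpos : 0 ≤ |x - y| * |X - Y| := by positivity
      have h1 : (x - y) * (Y - X) ≤ |x - y| * |X - Y| := by
        rw [← abs_mul, ← abs_neg]; exact (le_of_eq (by ring)).trans (le_abs_self _)
      have h2 : (x - y) * (X - Y) ≤ |x - y| * |X - Y| := by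
        rw [← abs_mul]; exact le_abs_self _
      rcases lt_trichotomy x 0 with hx0 | rfl | hx0 <;>
      rcases lt_trichotomy y 0 with hy0 | rfl | hy0 <;>
      simp only [Real.sign_of_neg, Real.sign_of_pos, Real.sign_zero, *] <;> nlinarith
    refine hbase.trans ?_
    have h3 : |x - y| * |X - Y| ≤ |x - y| * (κ * M * (C * (κ * M)) * |x - y|) := by gcongr
    refine h3.trans ?_
    nlinarith [sq_nonneg |x - y|]

/-- Every smooth control with the right value of `a` at the point `(s, t)` is the value at `(s, t)`
of a member of `𝓢_a`. -/
lemma exists_mem_stratS {𝓕 : Filtration ℝ≥0 mΩ} {σ : ℝ → ℝ → ℝ} {Θ B : ℝ≥0 → Ω → ℝ}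
    (hT : 0 < T) (hS : IsPriceProcess P 𝓕 T σ Θ B S) {a : ℝ → ℝ → ℝ} (ha : a ∈ ClassB P T S)
    {s t : ℝ} (hs : 0 < s) (ht : t ∈ Ico (0 : ℝ) T) {b₀ : ℝ} {c₀ : ℝ → ℝ} (hb₀ : 0 < b₀)
    (hc₀ : IsSmoothControl c₀) (haV : aVal b₀ c₀ = a s t) :
    ∃ bc ∈ StratS P T S a, bc.1 s t = b₀ ∧ (fun x => bc.2 x s t) = c₀ := by
  have hκ := ha.1 s t hs ht
  set κ := a s t with hκdef
  have hβ : 0 < b₀ / κ := div_pos hb₀ hκ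
  -- Scaling by `θ = κ / a(s', t')` turns the value `κ` of `2 ∫ g` into `a(s', t')`; at the base
  -- point `θ = 1`, which returns `b₀` and `c₀`.
  refine ⟨(fun s t => b₀ / κ * a s t, fun x s t => κ * (1 / a s t) * c₀ (κ * x * (1 / a s t))),
    ⟨const_mul_mem_classB ha hβ, scaled_mem_classC hT hS ha hc₀ hκ hβ, fun s' t' hs' ht' => ?_⟩,
    ?_, ?_⟩
  · have ha' := ha.1 s' t' hs' ht'
    have hθ : 0 < κ * (1 / a s' t') := by positivity
    have h := aVal_scale hθ c₀ b₀
    rw [haV] at h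
    have e1 : b₀ / (κ * (1 / a s' t')) = b₀ / κ * a s' t' := by field_simp
    have e2 : κ / (κ * (1 / a s' t')) = a s' t' := by field_simp
    rw [e1, e2] at h
    rw [← h]
    congr 1
    funext x
    congr 2
    ring
  · simp only [← hκdef]; field_simp
  · funext x
    simp only [← hκdef]
    rw [mul_one_div_cancel hκ.ne', one_mul]
    congr 1
    field_simp

end
end

/-! ### The theorem -/

/-- Once `2|ε| < a`, the argument lies in the `η₂` branch on either side, and the expression is the
polynomial `(a + 2ε)²/12`. -/
lemma tendsto_sq_mul_etaDagger {a : ℝ} (ha : 0 < a) :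
    Tendsto (fun ε : ℝ => ε ^ 2 * etaDagger (a / ε)) (𝓝[≠] 0) (𝓝 (a ^ 2 / 12)) := by
  have h : Tendsto (fun ε : ℝ => (a + 2 * ε) ^ 2 / 12) (𝓝[≠] 0) (𝓝 (a ^ 2 / 12)) := by
    have h1 : Continuous fun ε : ℝ => (a + 2 * ε) ^ 2 / 12 := by fun_prop
    have := h1.tendsto 0
    simp only [mul_zero, add_zero] at this
    exact this.mono_left nhdsWithin_le_nhds
  refine h.congr' ?_
  have hsmall : ∀ᶠ ε : ℝ in 𝓝[≠] 0, 2 * |ε| < a := by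
    have h1 : Tendsto (fun ε : ℝ => 2 * |ε|) (𝓝[≠] 0) (𝓝 0) := by
      have h2 : Continuous fun ε : ℝ => 2 * |ε| := by fun_prop
      have := h2.tendsto 0
      simp only [abs_zero, mul_zero] at this
      exact this.mono_left nhdsWithin_le_nhds
    exact h1.eventually (Iio_mem_nhds ha)
  filter_upwards [hsmall, self_mem_nhdsWithin] with ε h1 h2
  have hε : ε ≠ 0 := h2
  have hval : etaDagger (a / ε) = eta2 (a / ε) := by
    rw [etaDagger]
    rcases lt_or_gt_of_ne hε with h | h
    · rw [abs_of_neg h] at h1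
      rw [if_pos]
      rw [div_le_iff_of_neg h]; linarith
    · rw [abs_of_pos h] at h1
      have : 2 ≤ a / ε := by rw [le_div_iff₀ h]; linarith
      rw [if_neg (by linarith), if_neg (by linarith), if_neg (by linarith)]
  rw [hval, eta2]
  field_simp

theorem theorem2 {Ω : Type*} [mΩ : MeasurableSpace Ω] (P : Measure Ω) [IsProbabilityMeasure P]
    (𝓕 : Filtration ℝ≥0 mΩ) (h𝓕 : UsualAssumptions P 𝓕) (T : ℝ≥0) (hT : 0 < T)
    (σ : ℝ → ℝ → ℝ) (Θ B S : ℝ≥0 → Ω → ℝ) (hS : IsPriceProcess P 𝓕 T σ Θ B S)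
    (lam : ℝ → ℝ → ℝ) (hlam : ∀ s t, 0 < s → t ∈ Icc (0 : ℝ) T → 0 ≤ lam s t)
    (hlam_reg : IsC21 (Icc 0 (T : ℝ)) lam)
    (f : ℝ → ℝ) (α p : ℝ → ℝ → ℝ) (hp : IsModifiedPrice P T S σ α f p)
    (a : ℝ → ℝ → ℝ) (ha : a ∈ ClassB P T S)
    (φ : ℕ → ℝ → ℝ) (hφ_smooth : ∀ n, ContDiff ℝ (⊤ : ℕ∞) (φ n))
    (hφ_far : ∀ n : ℕ, 1 ≤ n → ∀ x, 1 / (n : ℝ) ≤ |x - 1| → φ n x = 1)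
    (hφ_one : ∀ n : ℕ, 1 ≤ n → φ n 1 = 1 - 1 / (n : ℝ))
    (s t : ℝ) (hs : 0 < s) (ht : t ∈ Ico (0 : ℝ) T) :
    -- the infimum is the greatest lower bound of a nonempty set
    IsGLB (etaSet P T S lam p a s t) (etaStar P T S lam p a s t) ∧
    -- its value
    (gam lam p s t ≠ 0 →
      etaStar P T S lam p a s t = |gam lam p s t| ^ 2 * etaDagger (a s t / gam lam p s t)) ∧
    (gam lam p s t = 0 →
      Tendsto (fun ε : ℝ => ε ^ 2 * etaDagger (a s t / ε)) (𝓝[≠] 0)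
        (𝓝 (etaStar P T S lam p a s t)) ∧
      etaStar P T S lam p a s t = a s t ^ 2 / 12) ∧
    -- the explicit sequence is eventually a nonnegative control with the prescribed value of `a`,
    -- a limit of members of `𝓢_a`
    (∀ᶠ n in atTop,
      0 < bSeq φ (gam lam p s t) (a s t) n ∧
      (∀ x, 0 ≤ cSeq φ (gam lam p s t) (a s t) n x) ∧
      aVal (bSeq φ (gam lam p s t) (a s t) n) (cSeq φ (gam lam p s t) (a s t) n) = a s t ∧
      ∀ ε > 0, ∃ bc ∈ StratS P T S a,
        |bc.1 s t - bSeq φ (gam lam p s t) (a s t) n| < ε ∧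
        (∫ x in (0 : ℝ)..min (bc.1 s t) (bSeq φ (gam lam p s t) (a s t) n),
          |bc.2 x s t - cSeq φ (gam lam p s t) (a s t) n x|) < ε ∧
        |etaBC lam p bc.1 bc.2 s t
          - etaVal (gam lam p s t) (bSeq φ (gam lam p s t) (a s t) n)
              (cSeq φ (gam lam p s t) (a s t) n)| < ε) ∧
    -- along the explicit sequence the infimum is approached
    Tendsto (fun n => etaVal (gam lam p s t) (bSeq φ (gam lam p s t) (a s t) n)
        (cSeq φ (gam lam p s t) (a s t) n)) atTop
      (𝓝 (etaStar P T S lam p a s t)) := by 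
  have hapos : 0 < a s t := ha.1 s t hs ht
  obtain ⟨hadm, hlim⟩ := isMinimizing_seq hφ_far hφ_one hapos (gam lam p s t)
  have happrox : ∀ᶠ n in atTop, ∀ ε > 0, ∃ bc ∈ StratS P T S a,
      |bc.1 s t - bSeq φ (gam lam p s t) (a s t) n| < ε ∧
      (∫ x in (0 : ℝ)..min (bc.1 s t) (bSeq φ (gam lam p s t) (a s t) n),
        |bc.2 x s t - cSeq φ (gam lam p s t) (a s t) n x|) < ε ∧
      |etaBC lam p bc.1 bc.2 s t
        - etaVal (gam lam p s t) (bSeq φ (gam lam p s t) (a s t) n)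
            (cSeq φ (gam lam p s t) (a s t) n)| < ε := by
    filter_upwards [hadm] with n hn ε hε
    obtain ⟨b₀, c₀, hc₀, hb₀, haV, h1, h2, h3⟩ := hn.exists_smooth (gam lam p s t) hε
    obtain ⟨bc, hbc, rfl, rfl⟩ := exists_mem_stratS hT hS ha hs ht hb₀ hc₀ haV
    exact ⟨bc, hbc, h1, h2, h3⟩
  have hglb : IsGLB (etaSet P T S lam p a s t) (etaMin (gam lam p s t) (a s t)) := by
    refine ⟨?_, fun m hm => ?_⟩
    · rintro _ ⟨bc, hbc, rfl⟩
      exact etaMin_le_etaBC hbc hs ht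
    -- One half of `ε` is spent on the explicit sequence approaching `etaMin`, the other on
    -- approximating its `n`-th term from `𝓢_a`.
    · refine le_of_forall_pos_le_add fun ε hε => ?_
      obtain ⟨n, hn1, hn2⟩ := (happrox.and
        (hlim.eventually (Iio_mem_nhds (lt_add_of_pos_right _ (half_pos hε))))).exists
      obtain ⟨bc, hbc, -, -, h⟩ := hn1 (ε / 2) (half_pos hε)
      have h1 := hm ⟨bc, hbc, rfl⟩
      have h2 := (abs_lt.1 h).2
      have h3 : _ < _ := hn2
      simp only at h1
      linarith
  have hne : (etaSet P T S lam p a s t).Nonempty := by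
    obtain ⟨n, hn⟩ := happrox.exists
    obtain ⟨bc, hbc, -⟩ := hn 1 one_pos
    exact ⟨_, bc, hbc, rfl⟩
  have hstar : etaStar P T S lam p a s t = etaMin (gam lam p s t) (a s t) :=
    hglb.csInf_eq hne
  rw [hstar]
  refine ⟨hglb, fun h => by rw [etaMin, if_neg h], fun h => ?_, ?_, hlim⟩
  · rw [etaMin, if_pos h]
    exact ⟨tendsto_sq_mul_etaDagger hapos, rfl⟩
  · filter_upwards [hadm, happrox] with n hn hn'
    exact ⟨hn.pos, hn.nonneg, hn.aVal_eq, hn'⟩
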